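/- **Setting.** Let $n\ge 2$ and let $(\overline M,\overline\varphi,\overline\xi,\overline\eta,\overline g)$ be a $(2n+1)$-dimensional almost contact B-metric manifold: $\overline\varphi^2=-\mathrm{Id}+\overline\eta\otimes\overline\xi$, $\overline\eta(\overline\xi)=1$, and $\overline g$ is a semi-Riemannian metric with $\overline g(\overline\varphi X,\overline\varphi Y)=-\overline g(X,Y)+\overline\eta(X)\overline\eta(Y)$. Put $\overline{\widetilde g}(X,Y)=\overline g(X,\overline\varphi Y)+\overline\eta(X)\overline\eta(Y)$, and let $\overline\nabla,\overline{\widetilde\nabla}$ be the Levi-Civita connections of $\overline g,\overline{\widetilde g}$. Curvature tensors are $R(X,Y,Z)=\nabla_X\nabla_YZ-\nabla_Y\nabla_XZ-\nabla_{[X,Y]}Z$. Assume that $\overline\nabla\,\overline\varphi=0$ (an $\mathcal F_0$-manifold) and that there are functions $\overline\nu,\overline{\widetilde\nu}:\overline M\to\mathbb R$ such that, for every $p\in\overline M$ and every $\overline g$-non-degenerate plane $\alpha=\mathrm{span}\{x,y\}\subset T_p\overline M$ which is orthogonal to $\overline\xi$ and totally real ($\overline\varphi\alpha\perp\alpha$),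 $$\overline\nu(p)=\frac{\overline g(\overline R(x,y,y),x)}{\overline g(x,x)\overline g(y,y)-\overline g(x,y)^2},\qquad \overline{\widetilde\nu}(p)=\frac{\overline{\widetilde g}(\overline{\widetilde R}(x,y,y),x)}{\overline g(x,x)\overline g(y,y)-\overline g(x,y)^2}.$$ Let $(M,g)$ be an (immersed) half lightlike submanifold of $(\overline M,\overline g)$: $\dim M=2n-1$ and $\mathrm{Rad}(TM)=TM\cap TM^\perp$ has rank $1$; let $S(TM)$ be a screen distribution and $S(TM^\perp)$ a screen transversal bundle, $TM=\mathrm{Rad}(TM)\perp S(TM)$, $TM^\perp=\mathrm{Rad}(TM)\perp S(TM^\perp)$. For a local nowhere zero section $\xi$ of $\mathrm{Rad}(TM)$ let $N$ be the unique local section of $T\overline M|_M$ with $\overline g(N,\xi)=1$, $\overline g(N,N)=0$, $N\perp S(TM)$, $N\perp S(TM^\perp)$, and let $\mathrm{ltr}(TM)=\mathrm{span}\{N\}$. Let $P:TM\to S(TM)$ be the projection along $\mathrm{Rad}(TM)$, $\eta(X)=\overline g(X,N)$, $\nabla_XY$ the component of $\overline\nabla_XY$ in $TM$ for $T\overline M|_M=TM\oplus(S(TM^\perp)\perp\mathrm{ltr}(TM))$,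 $\tau(X)=\overline g(\overline\nabla_XN,\xi)$, $C(X,PY)=\eta(\nabla_XPY)$, and $\mu=\overline\eta(\xi)$. Assume that $M$ is radical screen transversal, $\overline\varphi(\mathrm{Rad}(TM))=S(TM^\perp)$; ascreen, $\overline\xi\in\mathrm{Rad}(TM)\oplus\mathrm{ltr}(TM)$ along $M$; and screen totally umbilical: locally $C(X,PY)=\gamma\,g(X,Y)$ with a smooth function $\gamma$ (depending on the choice of $\xi$). **Theorem.** One has $\overline{\widetilde\nu}=0$ at every point of $M$. For every local nowhere zero section $\xi$ of $\mathrm{Rad}(TM)$ and the corresponding function $\gamma$, $$\overline\nu+2\tau(\xi)\gamma-2\xi(\gamma)-4\mu^2\gamma^2=0,\qquad PX(\mu\gamma)=0\quad\text{for all }X\in\Gamma(TM).$$ The curvature tensor $R$ and the Ricci tensor $Ric(Y,Z)=\mathrm{trace}\{X\mapsto R(X,Y,Z)\}$ of $\nabla$ are given, for $X,Y,Z\in\Gamma(TM)$, by $$\begin{aligned}R(X,Y,Z)={}&[(\overline\nu-2\mu^2\gamma^2)g(Y,Z)-\overline\nu\,\overline\eta(Y)\overline\eta(Z)]PX-[(\overline\nu-2\mu^2\gamma^2)g(X,Z)-\overline\nu\,\overline\eta(X)\overline\eta(Z)]PY\\&+(4\mu^2\gamma^2-\overline\nu)\,\overline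 g(Y,\overline\varphi Z)\,\overline\varphi(PX)-(4\mu^2\gamma^2-\overline\nu)\,\overline g(X,\overline\varphi Z)\,\overline\varphi(PY)\\&+\tfrac{\overline\nu}{2}[g(Y,Z)\eta(X)-g(X,Z)\eta(Y)]\xi,\end{aligned}$$ $$Ric(Y,Z)=\Big[\tfrac{4n-7}{2}\overline\nu-2(2n-5)\mu^2\gamma^2\Big]g(Y,Z)-2(n-1)\overline\nu\,\overline\eta(Y)\overline\eta(Z).$$ Moreover, the local functions $\mu\gamma$ do not depend on the choice of $\xi$ and so define one function $\mu\gamma$ on $M$; on every connected open subset $V$ of $M$ (in particular on $V=M$, if $M$ is connected), $\mu\gamma$ is constant if and only if $\overline\nu=4\mu^2\gamma^2$. -/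

import Mathlib

open scoped Manifold ContDiff Bundle

noncomputable section

namespace LightlikeGeometry

/-! ### Connections and curvature on a manifold -/

section Ambient

variable {E : Type*} [NormedAddCommGroup E] [NormedSpace ℝ E]
  {A : Type*} [TopologicalSpace A] [ChartedSpace E A]

/-- The curvature operator `R(X,Y,Z) = ∇_X ∇_Y Z - ∇_Y ∇_X Z - ∇_[X,Y] Z` of an operator `D` on
vector fields, where `D Y x v` stands for `(∇_v Y)(x)`. -/
def curvature
    (D : (Π x : A, TangentSpace 𝓘(ℝ, E) x) →
      (Π x : A, TangentSpace 𝓘(ℝ, E) x → TangentSpace 𝓘(ℝ, E) x))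
    (X Y Z : Π x : A, TangentSpace 𝓘(ℝ, E) x) (x : A) : TangentSpace 𝓘(ℝ, E) x :=
  D (fun y ↦ D Z y (Y y)) x (X x) - D (fun y ↦ D Z y (X y)) x (Y x)
    - D Z x (VectorField.mlieBracket 𝓘(ℝ, E) X Y x)

variable [IsManifold 𝓘(ℝ, E) ∞ A]

/-- The value of the curvature tensor on three tangent vectors at `p`: they are extended to vector
fields which are smooth near `p` (constant in the chart at `p`). -/
def curvatureAt
    (D : (Π x : A, TangentSpace 𝓘(ℝ, E) x) →
      (Π x : A, TangentSpace 𝓘(ℝ, E) x → TangentSpace 𝓘(ℝ, E) x))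
    (p : A) (u v w : TangentSpace 𝓘(ℝ, E) p) : TangentSpace 𝓘(ℝ, E) p :=
  curvature D (FiberBundle.extend E u) (FiberBundle.extend E v) (FiberBundle.extend E w) p

open Classical in
/-- The Ricci tensor `Ric(v,w) = trace {u ↦ R(u,v,w)}`. -/
def ricciAt
    (D : (Π x : A, TangentSpace 𝓘(ℝ, E) x) →
      (Π x : A, TangentSpace 𝓘(ℝ, E) x → TangentSpace 𝓘(ℝ, E) x))
    (p : A) (v w : TangentSpace 𝓘(ℝ, E) p) : ℝ :=
  if h : IsLinearMap ℝ (fun u : TangentSpace 𝓘(ℝ, E) p ↦ curvatureAt D p u v w) then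
    LinearMap.trace ℝ (TangentSpace 𝓘(ℝ, E) p) (h.mk' _)
  else 0

/-- `D` is the Levi-Civita connection of the (possibly indefinite) metric `h`: a smooth connection
which is torsion-free and satisfies `v (h (Y, Z)) = h (∇_v Y, Z) + h (Y, ∇_v Z)`. -/
structure IsLeviCivita [FiniteDimensional ℝ E]
    (h : Π p : A, TangentSpace 𝓘(ℝ, E) p → TangentSpace 𝓘(ℝ, E) p → ℝ)
    (D : CovariantDerivative 𝓘(ℝ, E) E (TangentSpace 𝓘(ℝ, E) : A → Type _)) : Prop where
  smooth : CovariantDerivative.ContMDiffCovariantDerivative D ∞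
  torsion_free : ∀ (X Y : Π p : A, TangentSpace 𝓘(ℝ, E) p) (p : A),
    MDiffAt (T% X) p → MDiffAt (T% Y) p →
      D Y p (X p) - D X p (Y p) = VectorField.mlieBracket 𝓘(ℝ, E) X Y p
  metric : ∀ (Y Z : Π p : A, TangentSpace 𝓘(ℝ, E) p) (p : A) (v : TangentSpace 𝓘(ℝ, E) p),
    MDiffAt (T% Y) p → MDiffAt (T% Z) p →
      mvfderiv 𝓘(ℝ, E) (fun q ↦ h q (Y q) (Z q)) p v = h p (D Y p v) (Z p) + h p (Y p) (D Z p v)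

end Ambient

/-! ### Almost contact B-metric manifolds -/

section BMetric

variable (E : Type*) [NormedAddCommGroup E] [NormedSpace ℝ E]
  (A : Type*) [TopologicalSpace A] [ChartedSpace E A] [IsManifold 𝓘(ℝ, E) ∞ A]

/-- An almost contact structure `(φ, ξ, η)` with a B-metric `g` on the manifold `A`. -/
structure AlmostContactBMetric where
  phi : Π p : A, TangentSpace 𝓘(ℝ, E) p →L[ℝ] TangentSpace 𝓘(ℝ, E) p
  xi : Π p : A, TangentSpace 𝓘(ℝ, E) p
  eta : Π p : A, TangentSpace 𝓘(ℝ, E) p →L[ℝ] ℝ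
  g : Π p : A, TangentSpace 𝓘(ℝ, E) p →L[ℝ] TangentSpace 𝓘(ℝ, E) p →L[ℝ] ℝ
  phi_smooth : ContMDiff 𝓘(ℝ, E) (𝓘(ℝ, E).prod 𝓘(ℝ, E →L[ℝ] E)) ∞
    (fun p ↦ Bundle.TotalSpace.mk' (E →L[ℝ] E)
      (E := fun p ↦ TangentSpace 𝓘(ℝ, E) p →L[ℝ] TangentSpace 𝓘(ℝ, E) p) p (phi p))
  xi_smooth : ContMDiff 𝓘(ℝ, E) (𝓘(ℝ, E).prod 𝓘(ℝ, E)) ∞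
    (fun p ↦ Bundle.TotalSpace.mk' E (E := fun p ↦ TangentSpace 𝓘(ℝ, E) p) p (xi p))
  eta_smooth : ContMDiff 𝓘(ℝ, E) (𝓘(ℝ, E).prod 𝓘(ℝ, E →L[ℝ] ℝ)) ∞
    (fun p ↦ Bundle.TotalSpace.mk' (E →L[ℝ] ℝ)
      (E := fun p ↦ TangentSpace 𝓘(ℝ, E) p →L[ℝ] ℝ) p (eta p))
  g_smooth : ContMDiff 𝓘(ℝ, E) (𝓘(ℝ, E).prod 𝓘(ℝ, E →L[ℝ] E →L[ℝ] ℝ)) ∞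
    (fun p ↦ Bundle.TotalSpace.mk' (E →L[ℝ] E →L[ℝ] ℝ)
      (E := fun p ↦ TangentSpace 𝓘(ℝ, E) p →L[ℝ] TangentSpace 𝓘(ℝ, E) p →L[ℝ] ℝ) p (g p))
  g_symm : ∀ p x y, g p x y = g p y x
  g_nondegenerate : ∀ p x, (∀ y, g p x y = 0) → x = 0
  phi_sq : ∀ p x, phi p (phi p x) = -x + eta p x • xi p
  eta_xi : ∀ p, eta p (xi p) = 1
  g_phi : ∀ p x y, g p (phi p x) (phi p y) = -g p x y + eta p x * eta p y

variable {E A}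

namespace AlmostContactBMetric

variable (S : AlmostContactBMetric E A)

/-- The associated metric `g̃(x,y) = g(x, φ y) + η(x) η(y)`. -/
def assoc (p : A) (x y : TangentSpace 𝓘(ℝ, E) p) : ℝ :=
  S.g p x (S.phi p y) + S.eta p x * S.eta p y

/-- The class `F₀`: `F(X,Y,Z) = g((∇_X φ) Y, Z)` vanishes, where `D = ∇` is the Levi-Civita
connection of `g`. -/
def IsF0 (D : CovariantDerivative 𝓘(ℝ, E) E (TangentSpace 𝓘(ℝ, E) : A → Type _)) : Prop :=
  ∀ (p : A) (v z : TangentSpace 𝓘(ℝ, E) p) (Y : Π q : A, TangentSpace 𝓘(ℝ, E) q),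
    MDiffAt (T% Y) p → S.g p (D (fun q ↦ S.phi q (Y q)) p v - S.phi p (D Y p v)) z = 0

/-- `x, y` span a section which is non-degenerate with respect to `g`, totally real
(`φ α` is orthogonal to `α`) and orthogonal to `ξ`. -/
structure IsTotallyRealSection (p : A) (x y : TangentSpace 𝓘(ℝ, E) p) : Prop where
  nondegenerate : S.g p x x * S.g p y y - S.g p x y ^ 2 ≠ 0
  totally_real : ∀ a ∈ Submodule.span ℝ {x, y}, ∀ b ∈ Submodule.span ℝ {x, y},
    S.g p (S.phi p a) b = 0
  orthogonal_left : S.g p x (S.xi p) = 0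
  orthogonal_right : S.g p y (S.xi p) = 0

/-- The totally real sectional curvatures at the point `p` do not depend on the section `α ⊥ ξ`:
`ν(α; p) = ν p` and `ν̃(α; p) = ν̃ p`. Here `D` and `D'` are the Levi-Civita connections of `g` and
of the associated metric. -/
def HasTotallyRealSectionalCurvatures
    (D D' : CovariantDerivative 𝓘(ℝ, E) E (TangentSpace 𝓘(ℝ, E) : A → Type _))
    (ν ν' : A → ℝ) : Prop :=
  ∀ (p : A) (x y : TangentSpace 𝓘(ℝ, E) p), S.IsTotallyRealSection p x y →
    S.g p (curvatureAt (fun Y q v ↦ D Y q v) p x y y) x /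
        (S.g p x x * S.g p y y - S.g p x y ^ 2) = ν p ∧
      S.assoc p (curvatureAt (fun Y q v ↦ D' Y q v) p x y y) x /
        (S.g p x x * S.g p y y - S.g p x y ^ 2) = ν' p

end AlmostContactBMetric

end BMetric

/-! ### Half lightlike submanifolds -/

section Submanifold

variable {E : Type*} [NormedAddCommGroup E] [NormedSpace ℝ E]
  {A : Type*} [TopologicalSpace A] [ChartedSpace E A] [IsManifold 𝓘(ℝ, E) ∞ A]
  {G : Type*} [NormedAddCommGroup G] [NormedSpace ℝ G]
  {M : Type*} [TopologicalSpace M] [ChartedSpace G M] [IsManifold 𝓘(ℝ, G) ∞ M]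

/-- The connection induced by `D` on vector fields `V` along a map `f : M → A`: in the chart of `A`
at `f x`, `∇_v V = dV(v) + Γ(df v, V)`, the second term being the derivative by `D` in the direction
`df v` of the field with the constant components of `V x`. -/
def covAlong (f : M → A)
    (D : CovariantDerivative 𝓘(ℝ, E) E (TangentSpace 𝓘(ℝ, E) : A → Type _))
    (V : Π x : M, TangentSpace 𝓘(ℝ, E) (f x)) (x : M) (v : TangentSpace 𝓘(ℝ, G) x) :
    TangentSpace 𝓘(ℝ, E) (f x) :=
  (trivializationAt E (TangentSpace 𝓘(ℝ, E)) (f x)).symm (f x)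
      (mvfderiv 𝓘(ℝ, G)
        (fun y ↦ (trivializationAt E (TangentSpace 𝓘(ℝ, E)) (f x) ⟨f y, V y⟩).2) x v)
    + D (FiberBundle.extend E (V x)) (f x) (mfderiv 𝓘(ℝ, G) 𝓘(ℝ, E) f x v)

/-- The radical subspace of `T_x M` for the metric induced by `g` through `f`. -/
def radical (g : Π p : A, TangentSpace 𝓘(ℝ, E) p →L[ℝ] TangentSpace 𝓘(ℝ, E) p →L[ℝ] ℝ)
    (f : M → A) (x : M) : Submodule ℝ (TangentSpace 𝓘(ℝ, G) x) where
  carrier := {v | ∀ w : TangentSpace 𝓘(ℝ, G) x,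
    g (f x) (mfderiv 𝓘(ℝ, G) 𝓘(ℝ, E) f x v) (mfderiv 𝓘(ℝ, G) 𝓘(ℝ, E) f x w) = 0}
  add_mem' ha hb w := by simp [ha w, hb w]
  zero_mem' w := by simp
  smul_mem' c a ha w := by simp [ha w]

/-- The normal space `T_x M^⊥` in `T_{f x} A`. -/
def normalSpace (g : Π p : A, TangentSpace 𝓘(ℝ, E) p →L[ℝ] TangentSpace 𝓘(ℝ, E) p →L[ℝ] ℝ)
    (f : M → A) (x : M) : Submodule ℝ (TangentSpace 𝓘(ℝ, E) (f x)) where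
  carrier := {v | ∀ w : TangentSpace 𝓘(ℝ, G) x,
    g (f x) v (mfderiv 𝓘(ℝ, G) 𝓘(ℝ, E) f x w) = 0}
  add_mem' ha hb w := by simp [ha w, hb w]
  zero_mem' w := by simp
  smul_mem' c a ha w := by simp [ha w]

variable (G M) in
/-- A half lightlike submanifold `f : M → A` of codimension two of the manifold `A` with metric `g`,
together with a screen distribution `S(TM)` and a screen transversal bundle `S(TM^⊥)`. -/
structure HalfLightlike
    (g : Π p : A, TangentSpace 𝓘(ℝ, E) p →L[ℝ] TangentSpace 𝓘(ℝ, E) p →L[ℝ] ℝ) where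
  /-- the inclusion of the (immersed) submanifold -/
  f : M → A
  smooth : ContMDiff 𝓘(ℝ, G) 𝓘(ℝ, E) ∞ f
  immersion : ∀ x, Function.Injective (mfderiv 𝓘(ℝ, G) 𝓘(ℝ, E) f x)
  codim : Module.finrank ℝ G + 2 = Module.finrank ℝ E
  rank_radical : ∀ x, Module.finrank ℝ (radical (G := G) g f x) = 1
  /-- the screen distribution `S(TM)` -/
  screen : Π x : M, Submodule ℝ (TangentSpace 𝓘(ℝ, G) x)
  screen_isCompl : ∀ x, IsCompl (screen x) (radical g f x)
  screen_smooth : ∀ x₀ : M, ∃ U : Set M, IsOpen U ∧ x₀ ∈ U ∧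
    ∃ s : Fin (Module.finrank ℝ G - 1) → Π x : M, TangentSpace 𝓘(ℝ, G) x,
      (∀ i, CMDiff[U] ∞ (T% (s i))) ∧
      ∀ x ∈ U, screen x = Submodule.span ℝ (Set.range fun i ↦ s i x)
  /-- the screen transversal bundle `S(TM^⊥)` -/
  screenTrans : Π x : M, Submodule ℝ (TangentSpace 𝓘(ℝ, E) (f x))
  normal_eq : ∀ x, ((radical g f x).map (mfderiv 𝓘(ℝ, G) 𝓘(ℝ, E) f x).toLinearMap)
    ⊔ screenTrans x = normalSpace (G := G) g f x
  disjoint : ∀ x, Disjoint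
    ((radical g f x).map (mfderiv 𝓘(ℝ, G) 𝓘(ℝ, E) f x).toLinearMap) (screenTrans x)
  /-- locally `S(TM^⊥) = span {L}` with `L` smooth and `g(L,L) = ±1` -/
  screenTrans_smooth : ∀ x₀ : M, ∃ U : Set M, IsOpen U ∧ x₀ ∈ U ∧
    ∃ (L : Π x : M, TangentSpace 𝓘(ℝ, E) (f x)) (ε : ℝ), (ε = 1 ∨ ε = -1) ∧
      ContMDiffOn 𝓘(ℝ, G) (𝓘(ℝ, E).prod 𝓘(ℝ, E)) ∞
        (fun x ↦ (⟨f x, L x⟩ : TangentBundle 𝓘(ℝ, E) A)) U ∧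
      ∀ x ∈ U, screenTrans x = Submodule.span ℝ {L x} ∧ g (f x) (L x) (L x) = ε

namespace HalfLightlike

variable {g : Π p : A, TangentSpace 𝓘(ℝ, E) p →L[ℝ] TangentSpace 𝓘(ℝ, E) p →L[ℝ] ℝ}
  (H : HalfLightlike G M g)

/-- The differential of the inclusion, `T_x M → T_{f x} A`. -/
def df (x : M) : TangentSpace 𝓘(ℝ, G) x →L[ℝ] TangentSpace 𝓘(ℝ, E) (H.f x) :=
  mfderiv 𝓘(ℝ, G) 𝓘(ℝ, E) H.f x

/-- The radical distribution `Rad(TM)`. -/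
def rad (x : M) : Submodule ℝ (TangentSpace 𝓘(ℝ, G) x) := radical g H.f x

/-- The induced (degenerate) metric on `M`. -/
def gM (x : M) (v w : TangentSpace 𝓘(ℝ, G) x) : ℝ := g (H.f x) (H.df x v) (H.df x w)

/-- The projection `P : TM → S(TM)` along `Rad(TM)`. -/
def P (x : M) (v : TangentSpace 𝓘(ℝ, G) x) : TangentSpace 𝓘(ℝ, G) x :=
  (H.screen x).projection (H.rad x) (H.screen_isCompl x) v

/-- `N` is the lightlike transversal vector at `x` corresponding to the radical vector `ξ`. -/
structure IsNullPairAt (x : M) (ξ : TangentSpace 𝓘(ℝ, G) x)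
    (N : TangentSpace 𝓘(ℝ, E) (H.f x)) : Prop where
  mem_rad : ξ ∈ H.rad x
  pairing : g (H.f x) N (H.df x ξ) = 1
  null : g (H.f x) N N = 0
  orthogonal_screenTrans : ∀ l ∈ H.screenTrans x, g (H.f x) N l = 0
  orthogonal_screen : ∀ s ∈ H.screen x, g (H.f x) N (H.df x s) = 0

/-- The lightlike transversal bundle `ltr(TM)`. -/
def ltr (x : M) : Submodule ℝ (TangentSpace 𝓘(ℝ, E) (H.f x)) :=
  Submodule.span ℝ {N | ∃ ξ, H.IsNullPairAt x ξ N}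

/-- The transversal bundle `tr(TM) = S(TM^⊥) ⊥ ltr(TM)`. -/
def tr (x : M) : Submodule ℝ (TangentSpace 𝓘(ℝ, E) (H.f x)) := H.screenTrans x ⊔ H.ltr x

/-- The tangential part of `w ∈ T_{f x} A` for the decomposition `T_{f x} A = T_x M ⊕ tr(TM)_x`:
the unique `v` with `w - df v ∈ tr(TM)_x`. -/
def tangentialPart (x : M) (w : TangentSpace 𝓘(ℝ, E) (H.f x)) : TangentSpace 𝓘(ℝ, G) x :=
  Classical.epsilon fun v ↦ w - H.df x v ∈ H.tr x

section Connection

variable (D : CovariantDerivative 𝓘(ℝ, E) E (TangentSpace 𝓘(ℝ, E) : A → Type _))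

/-- The induced connection `∇` of `M`, from the Gauss formula: `∇_v Y` is the tangential part of the
ambient derivative; `H.nabla D Y x v` stands for `(∇_v Y)(x)`. -/
def nabla (Y : Π x : M, TangentSpace 𝓘(ℝ, G) x) (x : M) (v : TangentSpace 𝓘(ℝ, G) x) :
    TangentSpace 𝓘(ℝ, G) x :=
  H.tangentialPart x (covAlong H.f D (fun y ↦ H.df y (Y y)) x v)

/-- `ξ` is a smooth section of `Rad(TM)` over `U`, nowhere zero, and `N` is the corresponding
section of `ltr(TM)`. -/
def IsNullPairOn (U : Set M) (ξ : Π x : M, TangentSpace 𝓘(ℝ, G) x)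
    (N : Π x : M, TangentSpace 𝓘(ℝ, E) (H.f x)) : Prop :=
  CMDiff[U] ∞ (T% ξ) ∧ ∀ x ∈ U, H.IsNullPairAt x (ξ x) (N x)

/-- The 1-form `η(v) = g(v, N)`, with `v = P v + η(v) ξ`. -/
def etaM (N : Π x : M, TangentSpace 𝓘(ℝ, E) (H.f x)) (x : M) (v : TangentSpace 𝓘(ℝ, G) x) : ℝ :=
  g (H.f x) (H.df x v) (N x)

/-- The 1-form `τ` of the Weingarten formula `∇̄_v N = -A_N v + τ(v) N + ρ(v) L`: as `ξ` is
orthogonal to `TM` and to `S(TM^⊥)` and `g(N,ξ) = 1`, it is `g(∇̄_v N, ξ)`. -/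
def tau (ξ : Π x : M, TangentSpace 𝓘(ℝ, G) x) (N : Π x : M, TangentSpace 𝓘(ℝ, E) (H.f x))
    (x : M) (v : TangentSpace 𝓘(ℝ, G) x) : ℝ :=
  g (H.f x) (covAlong H.f D N x v) (H.df x (ξ x))

/-- The local second fundamental form of the screen distribution, from
`∇_v PY = ∇*_v PY + C(v, PY) ξ` with `∇*_v PY ∈ S(TM)`: `C(v, PY) = η(∇_v PY)`. -/
def screenForm (N : Π x : M, TangentSpace 𝓘(ℝ, E) (H.f x)) (x : M)
    (v : TangentSpace 𝓘(ℝ, G) x) (Y : Π x : M, TangentSpace 𝓘(ℝ, G) x) : ℝ :=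
  H.etaM N x (H.nabla D (fun y ↦ H.P y (Y y)) x v)

/-- `γ` is smooth on `U` and `C(X, PY) = γ g(X, Y)` on `U`, the form `C` being taken with respect
to `N`. -/
def IsScreenUmbilicalOn (U : Set M) (N : Π x : M, TangentSpace 𝓘(ℝ, E) (H.f x)) (γ : M → ℝ) :
    Prop :=
  CMDiff[U] ∞ γ ∧
    ∀ x ∈ U, ∀ (v : TangentSpace 𝓘(ℝ, G) x) (Y : Π x : M, TangentSpace 𝓘(ℝ, G) x),
      CMDiffAt ∞ (T% Y) x → H.screenForm D N x v Y = γ x * H.gM x v (Y x)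

/-- `M` is screen totally umbilical. -/
def IsScreenTotallyUmbilical : Prop :=
  ∀ x₀ : M, ∃ (U : Set M) (ξ : Π x : M, TangentSpace 𝓘(ℝ, G) x)
    (N : Π x : M, TangentSpace 𝓘(ℝ, E) (H.f x)) (γ : M → ℝ),
    IsOpen U ∧ x₀ ∈ U ∧ H.IsNullPairOn U ξ N ∧ H.IsScreenUmbilicalOn D U N γ

end Connection

end HalfLightlike

section RSTHL

variable {S : AlmostContactBMetric E A}

/-- `M` is radical screen transversal: `φ(Rad(TM)) = S(TM^⊥)`. -/
def IsRSTHL (H : HalfLightlike G M S.g) : Prop :=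
  ∀ x, ((H.rad x).map (H.df x).toLinearMap).map (S.phi (H.f x)).toLinearMap = H.screenTrans x

/-- `M` is ascreen: `ξ̄` belongs to `Rad(TM) ⊕ ltr(TM)` along `M`. -/
def IsAscreen (H : HalfLightlike G M S.g) : Prop :=
  ∀ x, S.xi (H.f x) ∈ (H.rad x).map (H.df x).toLinearMap ⊔ H.ltr x

/-- The function `μ = η̄(ξ)` of a section `ξ` of `Rad(TM)`. -/
def mu (H : HalfLightlike G M S.g) (ξ : Π x : M, TangentSpace 𝓘(ℝ, G) x) (x : M) : ℝ :=
  S.eta (H.f x) (H.df x (ξ x))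

/-- The restriction of `η̄` to `TM`. -/
def etaBar (H : HalfLightlike G M S.g) (x : M) (v : TangentSpace 𝓘(ℝ, G) x) : ℝ :=
  S.eta (H.f x) (H.df x v)

/-- `g(v, φ̄ w)` for `v, w` tangent to `M`. -/
def gPhi (H : HalfLightlike G M S.g) (x : M) (v w : TangentSpace 𝓘(ℝ, G) x) : ℝ :=
  S.g (H.f x) (H.df x v) (S.phi (H.f x) (H.df x w))

end RSTHL

end Submanifold

end LightlikeGeometry

end

open LightlikeGeometry

/-! The proof normalises everything by the parallel field ξ̄. Since φ̄ maps Rad(TM) onto a bundle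
with unit sections, and g(φ̄r,φ̄r) = η̄(r)² for r in Rad(TM), η̄ does not vanish on Rad(TM). Hence
there is a unique radical field ζ with η̄(ζ) = 1, defined on all of M. The ascreen condition makes
the screen orthogonal to ξ̄, so the lightlike transversal field of ζ is N₀ = ξ̄ - ζ/2, and φ̄ζ spans
S(TM^⊥). For any other pair (ξ, N) one has ξ = μζ and μN = N₀. The umbilicity function of N₀ is
therefore F = μγ, whatever the choice of ξ (`umbilicity_eq`).

As φ̄ is parallel, so are ξ̄ and η̄. Thus ∇̄N₀ = -∇̄ζ/2, and screen umbilicity determines the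
derivatives of the whole normal frame: ∇̄_vζ = 2F Pv, ∇̄_vN₀ = -F Pv, ∇̄_v(φ̄ζ) = 2F φ̄Pv
(`covAlong_zeta`). Differentiating once more expresses R̄(u,v)N₀ through F and dF
(`curvatureAt_nullVec`).

On the other side, the two sectional curvatures determine R̄. The connections of ḡ and of the
associated metric coincide, and R̄ is complex linear for φ̄ in each argument and is killed by ξ̄. It
is thus determined by its values on a real form of ker η̄ on which φ̄ is totally real and ḡ is
definite. There polarisation gives R̄ = νA - ν̃ φ̄A with an explicit model A (`eq_model`).

Comparing the two expressions of R̄(s,ζ)N₀ for s ≠ 0 in the screen gives ν̃ = 0 and ν = 2 dF(ζ) +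
4F², because s and φ̄s are independent. Comparing those of R̄(s,φ̄s)N₀ gives dF(s) = 0
(`main_equation`). So dF is controlled by dF(ζ), which vanishes exactly when ν = 4F²; this is the
statement on constancy. The relation τ = -dμ/μ translates the equation for F into the one for γ. The
Gauss equation gives R, and tracing it gives Ric, the endomorphism φ̄P being traceless.

Fields tangent to M are not treated as restrictions of ambient fields: all derivatives are taken
with the connection pulled back along f, whose torsion and curvature are compared with those of D by
reduction to fields constant in a chart (`SmoothAlong.induction`). -/

noncomputable section

namespace LightlikeGeometry

set_option linter.unusedSectionVars false

open Filter Topology FiberBundle VectorField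

/-! ### Vector fields along a map: smoothness and reduction to chart-constant fields. -/

section Along

variable {E : Type*} [NormedAddCommGroup E] [NormedSpace ℝ E]
  {A : Type*} [TopologicalSpace A] [ChartedSpace E A] [IsManifold 𝓘(ℝ, E) ∞ A]
  {G : Type*} [NormedAddCommGroup G] [NormedSpace ℝ G]
  {M : Type*} [TopologicalSpace M] [ChartedSpace G M] [IsManifold 𝓘(ℝ, G) ∞ M]

variable (G) in
/-- `V` is a vector field along the map `f`, of class `C^k` at the point `x`. -/
def SmoothAlong (k : ℕ∞ω) (f : M → A) (V : Π y : M, TangentSpace 𝓘(ℝ, E) (f y)) (x : M) : Prop :=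
  ContMDiffAt 𝓘(ℝ, G) (𝓘(ℝ, E).prod 𝓘(ℝ, E)) k
    (fun y ↦ (⟨f y, V y⟩ : TangentBundle 𝓘(ℝ, E) A)) x

variable {k : ℕ∞ω} {f : M → A} {x : M} {V W : Π y : M, TangentSpace 𝓘(ℝ, E) (f y)}

/-- The coordinates of a vector field along `f` in the chart at `p`. -/
def coordAlong (f : M → A) (p : A) (V : Π y : M, TangentSpace 𝓘(ℝ, E) (f y)) (y : M) : E :=
  (trivializationAt E (TangentSpace 𝓘(ℝ, E)) p ⟨f y, V y⟩).2

theorem smoothAlong_iff : SmoothAlong G k f V x ↔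
    ContMDiffAt 𝓘(ℝ, G) 𝓘(ℝ, E) k f x ∧
      ContMDiffAt 𝓘(ℝ, G) 𝓘(ℝ, E) k (coordAlong f (f x) V) x :=
  Bundle.contMDiffAt_totalSpace

theorem SmoothAlong.base (h : SmoothAlong G k f V x) : ContMDiffAt 𝓘(ℝ, G) 𝓘(ℝ, E) k f x :=
  (smoothAlong_iff.1 h).1

theorem SmoothAlong.coord (h : SmoothAlong G k f V x) :
    ContMDiffAt 𝓘(ℝ, G) 𝓘(ℝ, E) k (coordAlong f (f x) V) x :=
  (smoothAlong_iff.1 h).2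

theorem SmoothAlong.of_le {m : ℕ∞ω} (h : SmoothAlong G k f V x) (hm : m ≤ k) :
    SmoothAlong G m f V x := ContMDiffAt.of_le h hm

theorem SmoothAlong.congr (h : SmoothAlong G k f V x) (hVW : ∀ᶠ y in 𝓝 x, W y = V y) :
    SmoothAlong G k f W x :=
  ContMDiffAt.congr_of_eventuallyEq h (hVW.mono fun y hy ↦ by simp only [hy])

theorem SmoothAlong.eventually (h : SmoothAlong G ∞ f V x) : ∀ᶠ y in 𝓝 x, SmoothAlong G 1 f V y :=
  (contMDiffAt_iff_contMDiffAt_nhds (by simp)).1 (h.of_le (m := 1) (by simp))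

theorem eventually_mem_baseSet (hf : ContinuousAt f x) : ∀ᶠ y in 𝓝 x,
    f y ∈ (trivializationAt E (TangentSpace 𝓘(ℝ, E) : A → Type _) (f x)).baseSet :=
  hf.eventually_mem ((trivializationAt E (TangentSpace 𝓘(ℝ, E)) (f x)).open_baseSet.mem_nhds
    (mem_baseSet_trivializationAt' (f x)))

theorem coordAlong_add {p : A} {y : M}
    (hy : f y ∈ (trivializationAt E (TangentSpace 𝓘(ℝ, E) : A → Type _) p).baseSet) :
    coordAlong f p (fun y ↦ V y + W y) y = coordAlong f p V y + coordAlong f p W y :=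
  ((trivializationAt E (TangentSpace 𝓘(ℝ, E)) p).linear ℝ hy).map_add _ _

theorem coordAlong_smul {p : A} {h : M → ℝ} {y : M}
    (hy : f y ∈ (trivializationAt E (TangentSpace 𝓘(ℝ, E) : A → Type _) p).baseSet) :
    coordAlong f p (fun y ↦ h y • V y) y = h y • coordAlong f p V y :=
  ((trivializationAt E (TangentSpace 𝓘(ℝ, E)) p).linear ℝ hy).map_smul _ _

theorem SmoothAlong.add (hV : SmoothAlong G k f V x) (hW : SmoothAlong G k f W x) :
    SmoothAlong G k f (fun y ↦ V y + W y) x := by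
  refine smoothAlong_iff.2 ⟨hV.base, (hV.coord.add hW.coord).congr_of_eventuallyEq ?_⟩
  filter_upwards [eventually_mem_baseSet (E := E) hV.base.continuousAt] with y hy
  exact coordAlong_add hy

theorem SmoothAlong.smul {h : M → ℝ} (hh : ContMDiffAt 𝓘(ℝ, G) 𝓘(ℝ, ℝ) k h x)
    (hV : SmoothAlong G k f V x) : SmoothAlong G k f (fun y ↦ h y • V y) x := by
  refine smoothAlong_iff.2 ⟨hV.base, (hh.smul hV.coord).congr_of_eventuallyEq ?_⟩
  filter_upwards [eventually_mem_baseSet (E := E) hV.base.continuousAt] with y hy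
  exact coordAlong_smul hy

theorem SmoothAlong.const_smul (c : ℝ) (hV : SmoothAlong G k f V x) :
    SmoothAlong G k f (fun y ↦ c • V y) x := hV.smul contMDiffAt_const

theorem SmoothAlong.neg (hV : SmoothAlong G k f V x) : SmoothAlong G k f (fun y ↦ -V y) x := by
  simpa using hV.const_smul (-1)

theorem SmoothAlong.sub (hV : SmoothAlong G k f V x) (hW : SmoothAlong G k f W x) :
    SmoothAlong G k f (fun y ↦ V y - W y) x := by
  simpa [sub_eq_add_neg] using hV.add hW.neg

/-- The restriction of a vector field to the map `f`. -/
theorem SmoothAlong.comp {Y : Π p : A, TangentSpace 𝓘(ℝ, E) p}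
    (hY : ContMDiffAt 𝓘(ℝ, E) (𝓘(ℝ, E).prod 𝓘(ℝ, E)) k
      (fun p ↦ (⟨p, Y p⟩ : TangentBundle 𝓘(ℝ, E) A)) (f x))
    (hf : ContMDiffAt 𝓘(ℝ, G) 𝓘(ℝ, E) k f x) : SmoothAlong G k f (fun y ↦ Y (f y)) x :=
  ContMDiffAt.comp x hY hf

theorem coordAlong_extend {p : A} (w : TangentSpace 𝓘(ℝ, E) p) {y : M}
    (hy : f y ∈ (trivializationAt E (TangentSpace 𝓘(ℝ, E) : A → Type _) p).baseSet) :
    coordAlong f p (fun y ↦ extend E w (f y)) y =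
      (trivializationAt E (TangentSpace 𝓘(ℝ, E)) p ⟨p, w⟩).2 := by
  simp only [coordAlong, extend]
  rw [Bundle.Trivialization.apply_mk_symm _ hy]

theorem smooth_extend {p : A} (w : TangentSpace 𝓘(ℝ, E) p) (hk : k ≤ ∞) :
    ContMDiffAt 𝓘(ℝ, E) (𝓘(ℝ, E).prod 𝓘(ℝ, E)) k
      (fun q ↦ (⟨q, extend E w q⟩ : TangentBundle 𝓘(ℝ, E) A)) p :=
  (contMDiffAt_extend (k := ∞) 𝓘(ℝ, E) E w).of_le hk

theorem extend_add {p : A} (u v : TangentSpace 𝓘(ℝ, E) p) :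
    ∀ᶠ q in 𝓝 p, extend E (u + v) q = extend E u q + extend E v q := by
  have hp := mem_baseSet_trivializationAt' (F := E) (E := (TangentSpace 𝓘(ℝ, E) : A → Type _)) p
  have h1 := ((trivializationAt E (TangentSpace 𝓘(ℝ, E)) p).linear ℝ hp).map_add u v
  filter_upwards [(trivializationAt E (TangentSpace 𝓘(ℝ, E)) p).open_baseSet.mem_nhds hp] with q hq
  simp only [extend]
  rw [← Bundle.Trivialization.coe_symmₗ (R := ℝ) _ hq]
  exact (congrArg _ h1).trans (map_add _ _ _)

theorem extend_smul {p : A} (c : ℝ) (u : TangentSpace 𝓘(ℝ, E) p) :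
    ∀ᶠ q in 𝓝 p, extend E (c • u) q = c • extend E u q := by
  have hp := mem_baseSet_trivializationAt' (F := E) (E := (TangentSpace 𝓘(ℝ, E) : A → Type _)) p
  have h1 := ((trivializationAt E (TangentSpace 𝓘(ℝ, E)) p).linear ℝ hp).map_smul c u
  filter_upwards [(trivializationAt E (TangentSpace 𝓘(ℝ, E)) p).open_baseSet.mem_nhds hp] with q hq
  simp only [extend]
  rw [← Bundle.Trivialization.coe_symmₗ (R := ℝ) _ hq]
  exact (congrArg _ h1).trans (map_smul _ _ _)

/-- Induction principle for properties of the germ of a vector field along `f`: it is enough to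
consider the fields which are constant in the chart at `f x`. -/
theorem SmoothAlong.induction [FiniteDimensional ℝ E] (hk : k ≤ ∞)
    (hf : ContMDiffAt 𝓘(ℝ, G) 𝓘(ℝ, E) k f x)
    {P : (Π y : M, TangentSpace 𝓘(ℝ, E) (f y)) → Prop}
    (congr : ∀ V W, SmoothAlong G k f V x → SmoothAlong G k f W x → (∀ᶠ y in 𝓝 x, W y = V y) →
      P V → P W)
    (add : ∀ V W, SmoothAlong G k f V x → SmoothAlong G k f W x → P V → P W →
      P (fun y ↦ V y + W y))
    (smul : ∀ (h : M → ℝ) V, ContMDiffAt 𝓘(ℝ, G) 𝓘(ℝ, ℝ) k h x → SmoothAlong G k f V x → P V →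
      P (fun y ↦ h y • V y))
    (const : ∀ w : TangentSpace 𝓘(ℝ, E) (f x), P (fun y ↦ extend E w (f y)))
    (hV : SmoothAlong G k f V x) : P V := by
  classical
  have hfx := mem_baseSet_trivializationAt' (F := E) (E := (TangentSpace 𝓘(ℝ, E) : A → Type _)) (f x)
  set e := trivializationAt E (TangentSpace 𝓘(ℝ, E) : A → Type _) (f x) with he
  let b := Module.finBasis ℝ E
  let w : Fin (Module.finrank ℝ E) → TangentSpace 𝓘(ℝ, E) (f x) := fun i ↦ e.symm (f x) (b i)
  let h : Fin (Module.finrank ℝ E) → M → ℝ := fun i y ↦ b.coord i (coordAlong f (f x) V y)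
  have hh : ∀ i, ContMDiffAt 𝓘(ℝ, G) 𝓘(ℝ, ℝ) k (h i) x := fun i ↦ by
    have : ContMDiff 𝓘(ℝ, E) 𝓘(ℝ, ℝ) k (LinearMap.toContinuousLinearMap (b.coord i)) :=
      ContinuousLinearMap.contMDiff _
    exact this.contMDiffAt.comp x hV.coord
  have hw : ∀ i, SmoothAlong G k f (fun y ↦ extend E (w i) (f y)) x :=
    fun i ↦ SmoothAlong.comp (smooth_extend _ hk) hf
  have key : ∀ s : Finset (Fin (Module.finrank ℝ E)),
      SmoothAlong G k f (fun y ↦ ∑ i ∈ s, h i y • extend E (w i) (f y)) x ∧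
      P (fun y ↦ ∑ i ∈ s, h i y • extend E (w i) (f y)) := by
    intro s
    induction s using Finset.induction_on with
    | empty =>
      -- The zero field is not covered by the assumptions on `P`; it is obtained as 0 times a
      -- constant field.
      have h0 : SmoothAlong G k f (fun y ↦ (0 : ℝ) • extend E (0 : TangentSpace 𝓘(ℝ, E) (f x)) (f y)) x :=
        (SmoothAlong.comp (smooth_extend _ hk) hf).const_smul 0
      have := smul (fun _ ↦ 0) _ contMDiffAt_const (SmoothAlong.comp (smooth_extend _ hk) hf) (const 0)
      simp only [zero_smul] at this h0
      simpa using ⟨h0, this⟩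
    | insert a s ha ih =>
      simp only [Finset.sum_insert ha]
      exact ⟨((hw a).smul (hh a)).add ih.1,
        add _ _ ((hw a).smul (hh a)) ih.1 (smul _ _ (hh a) (hw a) (const _)) ih.2⟩
  refine congr _ _ (key Finset.univ).1 hV ?_ (key Finset.univ).2
  filter_upwards [eventually_mem_baseSet (E := E) hf.continuousAt] with y hy
  have hext : ∀ i, extend E (w i) (f y) = e.symm (f y) (b i) := fun i ↦ by
    simp only [extend, w, ← he]
    rw [Bundle.Trivialization.apply_mk_symm _ hfx]
  simp only [hext, ← Bundle.Trivialization.coe_symmₗ (R := ℝ) e hy, ← map_smul, ← map_sum, h]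
  have : ∑ i, b.coord i (coordAlong f (f x) V y) • b i = coordAlong f (f x) V y :=
    b.sum_repr _
  rw [this, Bundle.Trivialization.coe_symmₗ _ hy]
  exact (Bundle.Trivialization.symm_apply_apply_mk _ hy _).symm

end Along

theorem natCast_le_infty (n : ℕ) : (n : ℕ∞ω) ≤ ∞ := mod_cast le_top

/-! ### Derivatives of functions along vector fields, and the Lie bracket. -/

section Fields

variable {E : Type*} [NormedAddCommGroup E] [NormedSpace ℝ E]
  {A : Type*} [TopologicalSpace A] [ChartedSpace E A] [IsManifold 𝓘(ℝ, E) ∞ A]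
  {G : Type*} [NormedAddCommGroup G] [NormedSpace ℝ G]
  {M : Type*} [TopologicalSpace M] [ChartedSpace G M] [IsManifold 𝓘(ℝ, G) ∞ M]

variable {k m : ℕ∞ω} {f : M → A} {x : M} {X Y : Π y : M, TangentSpace 𝓘(ℝ, G) y}

theorem smoothAlong_mfderiv (hf : ContMDiffAt 𝓘(ℝ, G) 𝓘(ℝ, E) k f x)
    (hX : CMDiffAt m (T% X) x) (hm : m + 1 ≤ k) (hk : k ≤ ∞) :
    SmoothAlong G m f (fun y ↦ mfderiv 𝓘(ℝ, G) 𝓘(ℝ, E) f y (X y)) x := by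
  have h1 : (1 : ℕ∞ω) ≤ k := le_trans (by simp) hm
  have : IsManifold 𝓘(ℝ, G) k M := IsManifold.of_le hk
  have : IsManifold 𝓘(ℝ, E) k A := IsManifold.of_le hk
  exact ContMDiffAt.clm_apply_of_inCoordinates (hf.mfderiv_const hm) hX
    (hf.of_le (le_trans le_self_add hm))

theorem contMDiffAt_mvfderiv {F : Type*} [NormedAddCommGroup F] [NormedSpace ℝ F] {h : M → F}
    (hh : ContMDiffAt 𝓘(ℝ, G) 𝓘(ℝ, F) k h x)
    (hX : CMDiffAt m (T% X) x) (hm : m + 1 ≤ k) (hk : k ≤ ∞) :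
    ContMDiffAt 𝓘(ℝ, G) 𝓘(ℝ, F) m (fun y ↦ mvfderiv 𝓘(ℝ, G) h y (X y)) x := by
  have := (smoothAlong_mfderiv hh hX hm hk)
  refine ContMDiffAt.comp x (contMDiff_snd_tangentBundle_modelSpace F 𝓘(ℝ, F)).contMDiffAt this

/-- The second derivatives of a function `h` along two vector fields. -/
theorem mvfderiv_mlieBracket [CompleteSpace G] {h : M → ℝ}
    (hh : ContMDiffAt 𝓘(ℝ, G) 𝓘(ℝ, ℝ) ∞ h x)
    (hX : CMDiffAt ∞ (T% X) x) (hY : CMDiffAt ∞ (T% Y) x) :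
    mvfderiv 𝓘(ℝ, G) h x (mlieBracket 𝓘(ℝ, G) X Y x) =
      mvfderiv 𝓘(ℝ, G) (fun y ↦ mvfderiv 𝓘(ℝ, G) h y (Y y)) x (X x) -
      mvfderiv 𝓘(ℝ, G) (fun y ↦ mvfderiv 𝓘(ℝ, G) h y (X y)) x (Y x) := by
  have : IsManifold 𝓘(ℝ, G) (minSmoothness ℝ 3) M := IsManifold.of_le (n := ∞) (by simpa using natCast_le_infty 3)
  by_cases htriv : ∀ z : TangentSpace 𝓘(ℝ, G) x, z = 0
  · simp [htriv (X x), htriv (Y x), htriv (mlieBracket 𝓘(ℝ, G) X Y x)]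
  push Not at htriv
  obtain ⟨z, hz⟩ := htriv
  -- The formula for [X,Y]h is extracted from the Jacobi identity. Expand it for X, Y, hZ with Z
  -- nonzero at x and subtract h times the identity for X, Y, Z: the mixed first-order terms cancel
  -- and (XYh - YXh - [X,Y]h)Z = 0 remains.
  set Z : Π y : M, TangentSpace 𝓘(ℝ, G) y := extend G z with hZdef
  have hZ : CMDiffAt ∞ (T% Z) x := smooth_extend z le_rfl
  have two : ∀ {W : Π y : M, TangentSpace 𝓘(ℝ, G) y}, CMDiffAt ∞ (T% W) x →
      CMDiffAt (minSmoothness ℝ 2) (T% W) x := fun h ↦ h.of_le (by simpa using natCast_le_infty 2)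
  have one : ∀ {W : Π y : M, TangentSpace 𝓘(ℝ, G) y}, CMDiffAt ∞ (T% W) x →
      MDiffAt (T% W) x := fun h ↦ h.mdifferentiableAt (by simp)
  have evone : ∀ {W : Π y : M, TangentSpace 𝓘(ℝ, G) y}, CMDiffAt ∞ (T% W) x →
      ∀ᶠ y in 𝓝 x, MDiffAt (T% W) y := fun h ↦ by
    filter_upwards [(contMDiffAt_iff_contMDiffAt_nhds (n := 1) (by simp)).1 (h.of_le (by simp))] with
      y hy using hy.mdifferentiableAt (by simp)
  have evh : ∀ᶠ y in 𝓝 x, MDiffAt h y := by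
    filter_upwards [(contMDiffAt_iff_contMDiffAt_nhds (n := 1) (by simp)).1 (hh.of_le (by simp))] with
      y hy using hy.mdifferentiableAt (by simp)
  have hhZ : CMDiffAt ∞ (T% (h • Z)) x := hh.smul_section hZ
  have brk : ∀ {W W' : Π y : M, TangentSpace 𝓘(ℝ, G) y}, CMDiffAt ∞ (T% W) x →
      CMDiffAt ∞ (T% W') x → MDiffAt (T% (mlieBracket 𝓘(ℝ, G) W W')) x := fun h h' ↦ by
    have : IsManifold 𝓘(ℝ, G) (((2 : ℕ∞) : ℕ∞ω) + 1) M := IsManifold.of_le (n := ∞) (natCast_le_infty 3)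
    have := ContMDiffAt.mlieBracket_vectorField (m := 1) (n := 2) (h.of_le (natCast_le_infty 2))
      (h'.of_le (natCast_le_infty 2)) (by simp; norm_num)
    exact this.mdifferentiableAt (by simp)
  have dsm : ∀ {W : Π y : M, TangentSpace 𝓘(ℝ, G) y}, CMDiffAt ∞ (T% W) x →
      MDiffAt (fun y ↦ mvfderiv 𝓘(ℝ, G) h y (W y)) x := fun hW ↦
    (contMDiffAt_mvfderiv hh hW (m := ∞) (by simp) le_rfl).mdifferentiableAt (by simp)
  have expand : ∀ {W W' : Π y : M, TangentSpace 𝓘(ℝ, G) y}, CMDiffAt ∞ (T% W) x →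
      CMDiffAt ∞ (T% W') x → mlieBracket 𝓘(ℝ, G) W (mlieBracket 𝓘(ℝ, G) W' (h • Z)) x =
        mvfderiv 𝓘(ℝ, G) (fun y ↦ mvfderiv 𝓘(ℝ, G) h y (W' y)) x (W x) • Z x
        + mvfderiv 𝓘(ℝ, G) h x (W' x) • mlieBracket 𝓘(ℝ, G) W Z x
        + (mvfderiv 𝓘(ℝ, G) h x (W x) • mlieBracket 𝓘(ℝ, G) W' Z x
          + h x • mlieBracket 𝓘(ℝ, G) W (mlieBracket 𝓘(ℝ, G) W' Z) x) := by
    intro W W' hW hW'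
    have e1 : mlieBracket 𝓘(ℝ, G) W' (h • Z) =ᶠ[𝓝 x]
        ((fun y ↦ mvfderiv 𝓘(ℝ, G) h y (W' y)) • Z + h • mlieBracket 𝓘(ℝ, G) W' Z) := by
      filter_upwards [evh, evone hZ] with y h1 h2
      rw [mlieBracket_smul_right h1 h2]
      rfl
    refine (EventuallyEq.mlieBracket_vectorField_eq EventuallyEq.rfl e1).trans ?_
    rw [mlieBracket_add_right ((dsm hW').smul_section (one hZ)) (evh.self_of_nhds.smul_section (brk hW' hZ)),
      mlieBracket_smul_right (dsm hW') (one hZ),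
      mlieBracket_smul_right evh.self_of_nhds (brk hW' hZ)]
  have J1 := leibniz_identity_mlieBracket_apply (two hX) (two hY) (two hhZ)
  have J2 := leibniz_identity_mlieBracket_apply (two hX) (two hY) (two hZ)
  rw [expand hX hY, expand hY hX, mlieBracket_smul_right evh.self_of_nhds (one hZ), J2] at J1
  have hZx : Z x ≠ 0 := by simpa [hZdef] using hz
  have : (mvfderiv 𝓘(ℝ, G) (fun y ↦ mvfderiv 𝓘(ℝ, G) h y (Y y)) x (X x) -
      mvfderiv 𝓘(ℝ, G) (fun y ↦ mvfderiv 𝓘(ℝ, G) h y (X y)) x (Y x) -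
      mvfderiv 𝓘(ℝ, G) h x (mlieBracket 𝓘(ℝ, G) X Y x)) • Z x = 0 := by
    rw [← sub_eq_zero] at J1
    refine Eq.trans ?_ J1
    module
  rcases smul_eq_zero.1 this with h | h
  · linarith
  · exact absurd h hZx

end Fields

/-! ### The pulled-back connection: linearity, Leibniz rule, restriction of ambient fields. -/

section CovAlong

variable {E : Type*} [NormedAddCommGroup E] [NormedSpace ℝ E]
  {A : Type*} [TopologicalSpace A] [ChartedSpace E A] [IsManifold 𝓘(ℝ, E) ∞ A]
  {G : Type*} [NormedAddCommGroup G] [NormedSpace ℝ G]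
  {M : Type*} [TopologicalSpace M] [ChartedSpace G M] [IsManifold 𝓘(ℝ, G) ∞ M]
  {f : M → A} {x : M} {V W : Π y : M, TangentSpace 𝓘(ℝ, E) (f y)}
  {D : CovariantDerivative 𝓘(ℝ, E) E (TangentSpace 𝓘(ℝ, E) : A → Type _)}

theorem cov_congr {p : A} {Y Z : Π q : A, TangentSpace 𝓘(ℝ, E) q}
    (hY : CMDiffAt 1 (T% Y) p) (h : ∀ᶠ q in 𝓝 p, Z q = Y q) : D Z p = D Y p :=
  D.isCovariantDerivativeOnUniv.congr_of_eventuallyEq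
    ((hY.congr_of_eventuallyEq (h.mono fun q hq ↦ by simp only [hq])).mdifferentiableAt (by simp))
    (hY.mdifferentiableAt (by simp)) univ_mem h

/-- The zeroth-order term of `covAlong` depends on the field only through `extend E (V x)`; its
linearity in V x is what makes `covAlong` additive and gives the Leibniz rule. -/
theorem cov_extend_add {p : A} (u v : TangentSpace 𝓘(ℝ, E) p) :
    D (extend E (u + v)) p = D (extend E u) p + D (extend E v) p := by
  have hu := smooth_extend (k := 1) u (by simp)
  have hv := smooth_extend (k := 1) v (by simp)
  rw [← D.isCovariantDerivativeOnUniv.add (hu.mdifferentiableAt (by simp))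
    (hv.mdifferentiableAt (by simp))]
  exact cov_congr (hu.add_section hv) (extend_add u v)

theorem cov_extend_smul {p : A} (c : ℝ) (u : TangentSpace 𝓘(ℝ, E) p) :
    D (extend E (c • u)) p = c • D (extend E u) p := by
  have hu := smooth_extend (k := 1) u (by simp)
  rw [← D.isCovariantDerivativeOnUniv.smul_const c (hu.mdifferentiableAt (by simp))]
  exact cov_congr (hu.const_smul_section) (extend_smul c u)

theorem covAlong_congr (h : ∀ᶠ y in 𝓝 x, W y = V y) (v : TangentSpace 𝓘(ℝ, G) x) :
    covAlong f D W x v = covAlong f D V x v := by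
  have h1 : mvfderiv 𝓘(ℝ, G) (coordAlong f (f x) W) x = mvfderiv 𝓘(ℝ, G) (coordAlong f (f x) V) x := by
    have : coordAlong f (f x) W =ᶠ[𝓝 x] coordAlong f (f x) V := by
      filter_upwards [h] with y hy
      simp only [coordAlong, hy]
    simp only [mvfderiv, this.mfderiv_eq]
    rw [this.self_of_nhds]
  change Bundle.Trivialization.symm _ (f x) (mvfderiv 𝓘(ℝ, G) (coordAlong f (f x) W) x v) + _ =
    Bundle.Trivialization.symm _ (f x) (mvfderiv 𝓘(ℝ, G) (coordAlong f (f x) V) x v) + _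
  rw [h1, h.self_of_nhds]

theorem covAlong_def (v : TangentSpace 𝓘(ℝ, G) x) : covAlong f D V x v =
    (trivializationAt E (TangentSpace 𝓘(ℝ, E)) (f x)).symmₗ ℝ (f x)
      (mvfderiv 𝓘(ℝ, G) (coordAlong f (f x) V) x v)
    + D (extend E (V x)) (f x) (mfderiv 𝓘(ℝ, G) 𝓘(ℝ, E) f x v) := by
  rw [Bundle.Trivialization.coe_symmₗ _ (mem_baseSet_trivializationAt' (f x))]
  rfl

theorem covAlong_add (hV : SmoothAlong G 1 f V x) (hW : SmoothAlong G 1 f W x)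
    (v : TangentSpace 𝓘(ℝ, G) x) :
    covAlong f D (fun y ↦ V y + W y) x v = covAlong f D V x v + covAlong f D W x v := by
  have h1 : mvfderiv 𝓘(ℝ, G) (coordAlong f (f x) (fun y ↦ V y + W y)) x =
      mvfderiv 𝓘(ℝ, G) (coordAlong f (f x) V) x + mvfderiv 𝓘(ℝ, G) (coordAlong f (f x) W) x := by
    have : coordAlong f (f x) (fun y ↦ V y + W y) =ᶠ[𝓝 x]
        coordAlong f (f x) V + coordAlong f (f x) W := by
      filter_upwards [eventually_mem_baseSet (E := E) hV.base.continuousAt] with y hy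
      exact coordAlong_add hy
    rw [← mvfderiv_add (hV.coord.mdifferentiableAt (by simp)) (hW.coord.mdifferentiableAt (by simp))]
    simp only [mvfderiv, this.mfderiv_eq]
    rw [this.self_of_nhds]
  rw [covAlong_def, h1, cov_extend_add]
  simp only [covAlong_def, add_apply, map_add]
  abel

theorem covAlong_smul {h : M → ℝ} (hh : ContMDiffAt 𝓘(ℝ, G) 𝓘(ℝ, ℝ) 1 h x)
    (hV : SmoothAlong G 1 f V x) (v : TangentSpace 𝓘(ℝ, G) x) :
    covAlong f D (fun y ↦ h y • V y) x v =
      h x • covAlong f D V x v + mvfderiv 𝓘(ℝ, G) h x v • V x := by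
  have h1 : mvfderiv 𝓘(ℝ, G) (coordAlong f (f x) (fun y ↦ h y • V y)) x =
      h x • mvfderiv 𝓘(ℝ, G) (coordAlong f (f x) V) x +
        (mvfderiv 𝓘(ℝ, G) h x).smulRight (coordAlong f (f x) V x) := by
    have : coordAlong f (f x) (fun y ↦ h y • V y) =ᶠ[𝓝 x] h • coordAlong f (f x) V := by
      filter_upwards [eventually_mem_baseSet (E := E) hV.base.continuousAt] with y hy
      exact coordAlong_smul hy
    rw [← mvfderiv_smul (hh.mdifferentiableAt (by simp)) (hV.coord.mdifferentiableAt (by simp))]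
    simp only [mvfderiv, this.mfderiv_eq]
    rw [this.self_of_nhds]
  have h2 : (trivializationAt E (TangentSpace 𝓘(ℝ, E)) (f x)).symmₗ ℝ (f x)
      (coordAlong f (f x) V x) = V x := by
    rw [Bundle.Trivialization.coe_symmₗ _ (mem_baseSet_trivializationAt' (f x))]
    exact Bundle.Trivialization.symm_apply_apply_mk _ (mem_baseSet_trivializationAt' (f x)) _
  rw [covAlong_def, h1, cov_extend_smul]
  simp only [covAlong_def, add_apply, map_add, ContinuousLinearMap.smulRight_apply,
    smul_apply, map_smul, h2, smul_add]
  abel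

theorem covAlong_const_smul (c : ℝ) (hV : SmoothAlong G 1 f V x) (v : TangentSpace 𝓘(ℝ, G) x) :
    covAlong f D (fun y ↦ c • V y) x v = c • covAlong f D V x v := by
  simp [covAlong_smul (h := fun _ ↦ c) contMDiffAt_const hV, mvfderiv_const]

theorem covAlong_neg (hV : SmoothAlong G 1 f V x) (v : TangentSpace 𝓘(ℝ, G) x) :
    covAlong f D (fun y ↦ -V y) x v = -covAlong f D V x v := by
  simpa using covAlong_const_smul (D := D) (-1) hV v

theorem covAlong_sub (hV : SmoothAlong G 1 f V x) (hW : SmoothAlong G 1 f W x)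
    (v : TangentSpace 𝓘(ℝ, G) x) :
    covAlong f D (fun y ↦ V y - W y) x v = covAlong f D V x v - covAlong f D W x v := by
  simpa [sub_eq_add_neg, covAlong_neg hW] using covAlong_add (D := D) hV hW.neg v

/-- The derivative along `f` of the restriction of an ambient vector field. -/
theorem covAlong_comp [FiniteDimensional ℝ E] {Y : Π p : A, TangentSpace 𝓘(ℝ, E) p}
    (hY : CMDiffAt 1 (T% Y) (f x)) (hf : ContMDiffAt 𝓘(ℝ, G) 𝓘(ℝ, E) 1 f x)
    (v : TangentSpace 𝓘(ℝ, G) x) :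
    covAlong f D (fun y ↦ Y (f y)) x v = D Y (f x) (mfderiv 𝓘(ℝ, G) 𝓘(ℝ, E) f x v) := by
  have hcomp : ∀ {Z : Π p : A, TangentSpace 𝓘(ℝ, E) p}, SmoothAlong E 1 (id : A → A) Z (f x) →
    SmoothAlong G 1 f (fun y ↦ Z (f y)) x := fun hZ ↦ SmoothAlong.comp hZ hf
  refine SmoothAlong.induction (k := 1) (f := (id : A → A)) (x := f x) (by simp) contMDiffAt_id
    (P := fun Y ↦ covAlong f D (fun y ↦ Y (f y)) x v =
      D Y (f x) (mfderiv 𝓘(ℝ, G) 𝓘(ℝ, E) f x v)) ?_ ?_ ?_ ?_ hY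
  · intro Z Z' hZ hZ' h hP
    rw [cov_congr (Z := Z') (Y := Z) hZ h, ← hP]
    refine covAlong_congr ?_ v
    filter_upwards [hf.continuousAt.eventually h] with y hy using hy
  · intro Z Z' hZ hZ' hP hP'
    have := D.isCovariantDerivativeOnUniv.add (ContMDiffAt.mdifferentiableAt hZ (by simp))
      (ContMDiffAt.mdifferentiableAt hZ' (by simp))
    rw [covAlong_add (hcomp hZ) (hcomp hZ'), hP, hP']
    exact congr($this.symm (mfderiv 𝓘(ℝ, G) 𝓘(ℝ, E) f x v))
  · intro h Z hh hZ hP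
    have := D.isCovariantDerivativeOnUniv.leibniz (ContMDiffAt.mdifferentiableAt hZ (by simp))
      (hh.mdifferentiableAt (by simp))
    refine (covAlong_smul (h := h ∘ f) (ContMDiffAt.comp x hh hf) (hcomp hZ) v).trans ?_
    rw [hP]
    refine Eq.trans ?_ congr($this.symm (mfderiv 𝓘(ℝ, G) 𝓘(ℝ, E) f x v))
    rw [mvfderiv_comp_apply x (hh.mdifferentiableAt (by simp)) (hf.mdifferentiableAt (by simp))]
    rfl
  · intro w
    -- A chart-constant field has constant coordinates along f, so the derivative term of `covAlong`
    -- vanishes and the term with D is all that remains.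
    have hc : coordAlong f (f x) (fun y ↦ extend E w (f y)) =ᶠ[𝓝 x] fun _ ↦
        (trivializationAt E (TangentSpace 𝓘(ℝ, E)) (f x) ⟨f x, w⟩).2 := by
      filter_upwards [eventually_mem_baseSet (E := E) hf.continuousAt] with y hy
      exact coordAlong_extend _ hy
    have h0 : mvfderiv 𝓘(ℝ, G) (coordAlong f (f x) (fun y ↦ extend E w (f y))) x v = 0 := by
      have : mfderiv 𝓘(ℝ, G) 𝓘(ℝ, E) (coordAlong f (f x) (fun y ↦ extend E w (f y))) x = 0 :=
        hc.mfderiv_eq.trans mfderiv_const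
      simp only [mvfderiv, this]
      rw [ContinuousLinearMap.comp_zero]
      rfl
    refine (covAlong_def v).trans ?_
    refine (congrArg₂ (· + ·) (congrArg _ h0) rfl).trans ?_
    simp only [map_zero, zero_add]
    exact congr(D (extend E $(extend_apply_self E w)) (f x) (mfderiv 𝓘(ℝ, G) 𝓘(ℝ, E) f x v))

end CovAlong

section Congr

variable {G : Type*} [NormedAddCommGroup G] [NormedSpace ℝ G]
  {M : Type*} [TopologicalSpace M] [ChartedSpace G M] {x : M}

theorem mvfderiv_congr {F : Type*} [NormedAddCommGroup F] [NormedSpace ℝ F] {h h' : M → F}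
    (H : ∀ᶠ y in 𝓝 x, h y = h' y) : mvfderiv 𝓘(ℝ, G) h x = mvfderiv 𝓘(ℝ, G) h' x := by
  simp only [mvfderiv, EventuallyEq.mfderiv_eq H]
  rw [H.self_of_nhds]

end Congr

/-! ### Second derivatives: smoothness, torsion and curvature of the pulled-back connection. -/

section Second

variable {E : Type*} [NormedAddCommGroup E] [NormedSpace ℝ E] [FiniteDimensional ℝ E]
  {A : Type*} [TopologicalSpace A] [T2Space A] [ChartedSpace E A] [IsManifold 𝓘(ℝ, E) ∞ A]
  {G : Type*} [NormedAddCommGroup G] [NormedSpace ℝ G]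
  {M : Type*} [TopologicalSpace M] [ChartedSpace G M] [IsManifold 𝓘(ℝ, G) ∞ M]
  {f : M → A} {x : M} {V W U : Π y : M, TangentSpace 𝓘(ℝ, E) (f y)}
  {X Y : Π y : M, TangentSpace 𝓘(ℝ, G) y}
  {D : CovariantDerivative 𝓘(ℝ, E) E (TangentSpace 𝓘(ℝ, E) : A → Type _)}

theorem _root_.ContMDiffAt.eventually_one {F : Type*} [NormedAddCommGroup F] [NormedSpace ℝ F]
    {h : M → F} (hh : ContMDiffAt 𝓘(ℝ, G) 𝓘(ℝ, F) ∞ h x) :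
    ∀ᶠ y in 𝓝 x, ContMDiffAt 𝓘(ℝ, G) 𝓘(ℝ, F) 1 h y :=
  (contMDiffAt_iff_contMDiffAt_nhds (by simp)).1 (hh.of_le (by simp))

/-- Smoothness of D is used on globally smooth fields, whereas `extend E w` is smooth only near p. A
bump function equal to 1 near p globalises it without changing D near p. -/
theorem contMDiffAt_cov_extend (hD : CovariantDerivative.ContMDiffCovariantDerivative D ∞) {p : A}
    (w : TangentSpace 𝓘(ℝ, E) p) :
    ContMDiffAt 𝓘(ℝ, E) (𝓘(ℝ, E).prod 𝓘(ℝ, E →L[ℝ] E)) ∞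
    (fun q ↦ Bundle.TotalSpace.mk' (E →L[ℝ] E)
      (E := fun p ↦ TangentSpace 𝓘(ℝ, E) p →L[ℝ] TangentSpace 𝓘(ℝ, E) p) q (D (extend E w) q)) p := by
  obtain ⟨s, hs, hsm⟩ := exists_contMDiffOn_extend (k := ∞) 𝓘(ℝ, E) E w
  obtain ⟨χ, -, hχ⟩ := (SmoothBumpFunction.nhds_basis_tsupport (I := 𝓘(ℝ, E)) p).mem_iff.1
    (interior_mem_nhds.2 hs)
  have h1 : CMDiff ∞ (T% ((χ : A → ℝ) • extend E w : Π q : A, TangentSpace 𝓘(ℝ, E) q)) :=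
    ContMDiffOn.smul_section_of_tsupport χ.contMDiff.contMDiffOn isOpen_interior hχ
      (hsm.mono interior_subset)
  have h2 := (hD.contMDiff.contMDiff (σ := ((χ : A → ℝ) • extend E w : Π q : A, TangentSpace 𝓘(ℝ, E) q))
    (by simpa using h1.contMDiffOn)).contMDiffAt (x := p) univ_mem
  refine h2.congr_of_eventuallyEq ?_
  filter_upwards [χ.eventuallyEq_one.eventually_nhds, eventually_eventually_nhds.2 hs] with q hq hqs
  have : D (extend E w) q = D ((χ : A → ℝ) • extend E w : Π q : A, TangentSpace 𝓘(ℝ, E) q) q := by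
    refine (cov_congr ((hsm.contMDiffAt hqs).of_le (by simp)) ?_).symm
    filter_upwards [hq] with r hr
    simp [hr]
  simp only [this]

theorem SmoothAlong.clm {k : ℕ∞ω} {L : Π y : M, TangentSpace 𝓘(ℝ, E) (f y) →L[ℝ] TangentSpace 𝓘(ℝ, E) (f y)}
    (hL : ContMDiffAt 𝓘(ℝ, G) (𝓘(ℝ, E).prod 𝓘(ℝ, E →L[ℝ] E)) k
      (fun y ↦ Bundle.TotalSpace.mk' (E →L[ℝ] E)
      (E := fun p ↦ TangentSpace 𝓘(ℝ, E) p →L[ℝ] TangentSpace 𝓘(ℝ, E) p) (f y) (L y)) x)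
    (hV : SmoothAlong G k f V x) : SmoothAlong G k f (fun y ↦ L y (V y)) x :=
  ContMDiffAt.clm_bundle_apply (F₁ := E) (F₂ := E) (E₁ := (TangentSpace 𝓘(ℝ, E) : A → Type _))
    (E₂ := (TangentSpace 𝓘(ℝ, E) : A → Type _)) hL hV

theorem SmoothAlong.cov_extend (hD : CovariantDerivative.ContMDiffCovariantDerivative D ∞)
    (w : TangentSpace 𝓘(ℝ, E) (f x)) (hU : SmoothAlong G ∞ f U x) :
    SmoothAlong G ∞ f (fun y ↦ D (extend E w) (f y) (U y)) x :=
  SmoothAlong.clm (ContMDiffAt.comp x (contMDiffAt_cov_extend hD w) hU.base) hU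

theorem SmoothAlong.covAlong (hD : CovariantDerivative.ContMDiffCovariantDerivative D ∞)
    (hV : SmoothAlong G ∞ f V x) (hX : CMDiffAt ∞ (T% X) x) :
    SmoothAlong G ∞ f (fun y ↦ covAlong f D V y (X y)) x := by
  refine SmoothAlong.induction (x := x) (k := ∞) le_rfl hV.base
    (P := fun V ↦ SmoothAlong G ∞ f (fun y ↦ LightlikeGeometry.covAlong f D V y (X y)) x) ?_ ?_ ?_ ?_ hV
  · intro V W _ _ h hP
    refine hP.congr ?_
    filter_upwards [h.eventually_nhds] with y hy
    exact covAlong_congr hy _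
  · intro V W hV hW hP hP'
    refine (hP.add hP').congr ?_
    filter_upwards [hV.eventually, hW.eventually] with y h1 h2
    exact covAlong_add h1 h2 _
  · intro h V hh hV hP
    refine ((hP.smul hh).add (hV.smul (contMDiffAt_mvfderiv hh hX (m := ∞) (by simp) le_rfl))).congr ?_
    filter_upwards [hV.eventually, hh.eventually_one] with y h1 h2
    exact covAlong_smul h2 h1 _
  · intro w
    have hf := hV.base
    refine SmoothAlong.congr (SmoothAlong.cov_extend hD w
      (smoothAlong_mfderiv hf hX (m := ∞) (by simp) le_rfl)) ?_
    have h1 := (contMDiffAt_iff_contMDiffAt_nhds (n := 1) (by simp)).1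
      ((smooth_extend (k := ∞) w le_rfl).of_le (by simp))
    filter_upwards [hf.continuousAt.eventually h1,
      (contMDiffAt_iff_contMDiffAt_nhds (n := 1) (by simp)).1 (hf.of_le (by simp))] with y h1 h2
    exact covAlong_comp h1 h2 _

/-- The second covariant derivative of the field `extend E w` at `p`. -/
def secondCov (D : CovariantDerivative 𝓘(ℝ, E) E (TangentSpace 𝓘(ℝ, E) : A → Type _)) (p : A)
    (w c : TangentSpace 𝓘(ℝ, E) p) : TangentSpace 𝓘(ℝ, E) p →L[ℝ] TangentSpace 𝓘(ℝ, E) p :=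
  D (fun q ↦ D (extend E w) q (extend E c q)) p - D (extend E w) p ∘L D (extend E c) p

theorem contMDiffAt_cov_extend_extend (hD : CovariantDerivative.ContMDiffCovariantDerivative D ∞)
    {p : A} (w c : TangentSpace 𝓘(ℝ, E) p) :
    CMDiffAt ∞ (T% (fun q ↦ D (extend E w) q (extend E c q) : Π q : A, TangentSpace 𝓘(ℝ, E) q)) p :=
  SmoothAlong.cov_extend (f := (id : A → A)) (x := p) hD w (smooth_extend c le_rfl)

theorem secondCov_add (hD : CovariantDerivative.ContMDiffCovariantDerivative D ∞)
    {p : A} (w c d : TangentSpace 𝓘(ℝ, E) p) :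
    secondCov D p w (c + d) = secondCov D p w c + secondCov D p w d := by
  have hc := (contMDiffAt_cov_extend_extend hD w c).of_le (m := 1) (by simp)
  have hd := (contMDiffAt_cov_extend_extend hD w d).of_le (m := 1) (by simp)
  have h1 : D (fun q ↦ D (extend E w) q (extend E (c + d) q)) p =
      D (fun q ↦ D (extend E w) q (extend E c q)) p +
      D (fun q ↦ D (extend E w) q (extend E d q)) p := by
    rw [← D.isCovariantDerivativeOnUniv.add (hc.mdifferentiableAt (by simp))
      (hd.mdifferentiableAt (by simp))]
    refine cov_congr (hc.add_section hd) ?_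
    filter_upwards [extend_add c d] with q hq
    simp [hq]
  ext a
  simp only [secondCov, h1, cov_extend_add, add_apply, sub_apply, ContinuousLinearMap.comp_apply,
    map_add]
  abel

theorem secondCov_smul (hD : CovariantDerivative.ContMDiffCovariantDerivative D ∞)
    {p : A} (r : ℝ) (w c : TangentSpace 𝓘(ℝ, E) p) :
    secondCov D p w (r • c) = r • secondCov D p w c := by
  have hc := (contMDiffAt_cov_extend_extend hD w c).of_le (m := 1) (by simp)
  have h1 : D (fun q ↦ D (extend E w) q (extend E (r • c) q)) p =
      r • D (fun q ↦ D (extend E w) q (extend E c q)) p := by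
    rw [← D.isCovariantDerivativeOnUniv.smul_const r (hc.mdifferentiableAt (by simp))]
    refine cov_congr hc.const_smul_section ?_
    filter_upwards [extend_smul r c] with q hq
    simp [hq]
  ext a
  simp only [secondCov, h1, cov_extend_smul, smul_apply, sub_apply, ContinuousLinearMap.comp_apply,
    map_smul, smul_sub]

/-- Product rule for the endomorphism field D(extend w) applied to U. The second derivative enters
only through the value U x, which makes `secondCov` the quantity whose antisymmetrisation is the
curvature. -/
theorem covAlong_cov_extend (hD : CovariantDerivative.ContMDiffCovariantDerivative D ∞)
    (w : TangentSpace 𝓘(ℝ, E) (f x)) (hU : SmoothAlong G ∞ f U x) (v : TangentSpace 𝓘(ℝ, G) x) :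
    covAlong f D (fun y ↦ D (extend E w) (f y) (U y)) x v =
      secondCov D (f x) w (U x) (mfderiv 𝓘(ℝ, G) 𝓘(ℝ, E) f x v) +
        D (extend E w) (f x) (covAlong f D U x v) := by
  have key : ∀ {U : Π y : M, TangentSpace 𝓘(ℝ, E) (f y)}, SmoothAlong G ∞ f U x →
      SmoothAlong G 1 f (fun y ↦ D (extend E w) (f y) (U y)) x :=
    fun h ↦ (SmoothAlong.cov_extend hD w h).of_le (by simp)
  refine SmoothAlong.induction (x := x) (k := ∞) le_rfl hU.base
    (P := fun U ↦ LightlikeGeometry.covAlong f D (fun y ↦ D (extend E w) (f y) (U y)) x v =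
      secondCov D (f x) w (U x) (mfderiv 𝓘(ℝ, G) 𝓘(ℝ, E) f x v) +
        D (extend E w) (f x) (LightlikeGeometry.covAlong f D U x v)) ?_ ?_ ?_ ?_ hU
  · intro V W _ _ h hP
    rw [covAlong_congr h, h.self_of_nhds, ← hP]
    refine covAlong_congr ?_ v
    filter_upwards [h] with y hy
    rw [hy]
  · intro V W hV hW hP hP'
    simp only [map_add]
    rw [covAlong_add (key hV) (key hW), covAlong_add (hV.of_le (by simp)) (hW.of_le (by simp)), hP, hP',
      secondCov_add hD, map_add, add_apply]
    abel
  · intro h V hh hV hP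
    simp only [map_smul]
    rw [covAlong_smul (hh.of_le (by simp)) (key hV),
      covAlong_smul (hh.of_le (by simp)) (hV.of_le (by simp)), hP, secondCov_smul hD, map_add, map_smul,
      map_smul, smul_apply, smul_add]
    abel
  · intro c
    have hf := hU.base.of_le (m := 1) (by simp)
    refine (covAlong_comp (Y := fun q ↦ D (extend E w) q (extend E c q))
      ((contMDiffAt_cov_extend_extend hD w c).of_le (by simp)) hf v).trans ?_
    rw [covAlong_comp (smooth_extend c (by simp)) hf]
    simp [secondCov]

/-- The Hessian of the function `u` at `p` with respect to `D`. -/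
def hessCov (D : CovariantDerivative 𝓘(ℝ, E) E (TangentSpace 𝓘(ℝ, E) : A → Type _)) (u : A → ℝ)
    (p : A) (c : TangentSpace 𝓘(ℝ, E) p) : TangentSpace 𝓘(ℝ, E) p →L[ℝ] ℝ :=
  mvfderiv 𝓘(ℝ, E) (fun q ↦ mvfderiv 𝓘(ℝ, E) u q (extend E c q)) p
    - mvfderiv 𝓘(ℝ, E) u p ∘L D (extend E c) p

theorem hessCov_add {u : A → ℝ} {p : A} (hu : ContMDiffAt 𝓘(ℝ, E) 𝓘(ℝ, ℝ) ∞ u p)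
    (c d : TangentSpace 𝓘(ℝ, E) p) :
    hessCov D u p (c + d) = hessCov D u p c + hessCov D u p d := by
  have hs : ∀ c : TangentSpace 𝓘(ℝ, E) p,
      MDiffAt (fun q ↦ mvfderiv 𝓘(ℝ, E) u q (extend E c q)) p := fun c ↦
    (contMDiffAt_mvfderiv hu (smooth_extend c le_rfl) (m := ∞) (by simp) le_rfl).mdifferentiableAt
      (by simp)
  have h1 : mvfderiv 𝓘(ℝ, E) (fun q ↦ mvfderiv 𝓘(ℝ, E) u q (extend E (c + d) q)) p =
      mvfderiv 𝓘(ℝ, E) (fun q ↦ mvfderiv 𝓘(ℝ, E) u q (extend E c q)) p +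
      mvfderiv 𝓘(ℝ, E) (fun q ↦ mvfderiv 𝓘(ℝ, E) u q (extend E d q)) p := by
    rw [← mvfderiv_add (hs c) (hs d)]
    refine mvfderiv_congr ?_
    filter_upwards [extend_add c d] with q hq
    simp [hq]
  ext a
  simp only [hessCov, h1, cov_extend_add, add_apply, sub_apply, ContinuousLinearMap.comp_apply,
    map_add]
  ring

theorem hessCov_smul {u : A → ℝ} {p : A} (hu : ContMDiffAt 𝓘(ℝ, E) 𝓘(ℝ, ℝ) ∞ u p) (r : ℝ)
    (c : TangentSpace 𝓘(ℝ, E) p) :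
    hessCov D u p (r • c) = r • hessCov D u p c := by
  have hs : MDiffAt (fun q ↦ mvfderiv 𝓘(ℝ, E) u q (extend E c q)) p :=
    (contMDiffAt_mvfderiv hu (smooth_extend c le_rfl) (m := ∞) (by simp) le_rfl).mdifferentiableAt
      (by simp)
  have h1 : mvfderiv 𝓘(ℝ, E) (fun q ↦ mvfderiv 𝓘(ℝ, E) u q (extend E (r • c) q)) p =
      r • mvfderiv 𝓘(ℝ, E) (fun q ↦ mvfderiv 𝓘(ℝ, E) u q (extend E c q)) p := by
    have := mvfderiv_smul (mdifferentiableAt_const (c := r)) hs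
    rw [mvfderiv_const] at this
    refine Eq.trans (mvfderiv_congr ?_) (this.trans (by ext; simp))
    filter_upwards [extend_smul r c] with q hq
    simp [hq]
  ext a
  simp only [hessCov, h1, cov_extend_smul, smul_apply, sub_apply, ContinuousLinearMap.comp_apply,
    map_smul, smul_sub]

theorem contMDiffAt_mvfderiv_along {u : A → ℝ} (hu : ContMDiffAt 𝓘(ℝ, E) 𝓘(ℝ, ℝ) ∞ u (f x))
    (hU : SmoothAlong G ∞ f U x) :
    ContMDiffAt 𝓘(ℝ, G) 𝓘(ℝ, ℝ) ∞ (fun y ↦ mvfderiv 𝓘(ℝ, E) u (f y) (U y)) x := by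
  refine SmoothAlong.induction (x := x) (k := ∞) le_rfl hU.base
    (P := fun U ↦ ContMDiffAt 𝓘(ℝ, G) 𝓘(ℝ, ℝ) ∞ (fun y ↦ mvfderiv 𝓘(ℝ, E) u (f y) (U y)) x)
    ?_ ?_ ?_ ?_ hU
  · intro V W _ _ h hP
    refine hP.congr_of_eventuallyEq ?_
    filter_upwards [h] with y hy
    rw [hy]
  · intro V W hV hW hP hP'
    simp only [map_add]
    exact hP.add hP'
  · intro h V hh hV hP
    simp only [map_smul]
    exact hh.smul hP
  · intro c
    exact ContMDiffAt.comp x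
      (contMDiffAt_mvfderiv hu (smooth_extend c le_rfl) (m := ∞) (by simp) le_rfl) hU.base

theorem mvfderiv_mvfderiv_along {u : A → ℝ} (hu : ContMDiffAt 𝓘(ℝ, E) 𝓘(ℝ, ℝ) ∞ u (f x))
    (hU : SmoothAlong G ∞ f U x) (v : TangentSpace 𝓘(ℝ, G) x) :
    mvfderiv 𝓘(ℝ, G) (fun y ↦ mvfderiv 𝓘(ℝ, E) u (f y) (U y)) x v =
      hessCov D u (f x) (U x) (mfderiv 𝓘(ℝ, G) 𝓘(ℝ, E) f x v) +
        mvfderiv 𝓘(ℝ, E) u (f x) (covAlong f D U x v) := by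
  have key : ∀ {U : Π y : M, TangentSpace 𝓘(ℝ, E) (f y)}, SmoothAlong G ∞ f U x →
      MDiffAt (fun y ↦ mvfderiv 𝓘(ℝ, E) u (f y) (U y)) x :=
    fun h ↦ (contMDiffAt_mvfderiv_along hu h).mdifferentiableAt (by simp)
  refine SmoothAlong.induction (x := x) (k := ∞) le_rfl hU.base
    (P := fun U ↦ mvfderiv 𝓘(ℝ, G) (fun y ↦ mvfderiv 𝓘(ℝ, E) u (f y) (U y)) x v =
      hessCov D u (f x) (U x) (mfderiv 𝓘(ℝ, G) 𝓘(ℝ, E) f x v) +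
        mvfderiv 𝓘(ℝ, E) u (f x) (covAlong f D U x v)) ?_ ?_ ?_ ?_ hU
  · intro V W _ _ h hP
    rw [covAlong_congr h, h.self_of_nhds, ← hP]
    refine congr($(mvfderiv_congr ?_) v)
    filter_upwards [h] with y hy
    rw [hy]
  · intro V W hV hW hP hP'
    simp only [map_add]
    rw [mvfderiv_fun_add (key hV) (key hW), covAlong_add (hV.of_le (by simp)) (hW.of_le (by simp)),
      add_apply, hP, hP', hessCov_add hu, map_add, add_apply]
    ring
  · intro h V hh hV hP
    simp only [map_smul]
    rw [mvfderiv_fun_smul (hh.mdifferentiableAt (by simp)) (key hV),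
      covAlong_smul (hh.of_le (by simp)) (hV.of_le (by simp)), add_apply, smul_apply, hP,
      hessCov_smul hu, map_add, map_smul, map_smul, smul_apply]
    simp only [ContinuousLinearMap.smulRight_apply, smul_eq_mul]
    ring
  · intro c
    have hf := hU.base.of_le (m := 1) (by simp)
    refine (mvfderiv_comp_apply (g := fun q ↦ mvfderiv 𝓘(ℝ, E) u q (extend E c q)) x
      ((contMDiffAt_mvfderiv hu (smooth_extend c le_rfl) (m := ∞) (by simp) le_rfl).mdifferentiableAt
      (by simp)) (hf.mdifferentiableAt (by simp)) v).trans ?_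
    rw [covAlong_comp (smooth_extend c (by simp)) hf]
    simp [hessCov]

/-- `D` has vanishing torsion. -/
def IsTorsionFree (D : CovariantDerivative 𝓘(ℝ, E) E (TangentSpace 𝓘(ℝ, E) : A → Type _)) : Prop :=
  ∀ (X Y : Π p : A, TangentSpace 𝓘(ℝ, E) p) (p : A),
    MDiffAt (T% X) p → MDiffAt (T% Y) p →
      D Y p (X p) - D X p (Y p) = VectorField.mlieBracket 𝓘(ℝ, E) X Y p

/-- The antisymmetric part is a bracket acting on u minus the torsion-free expression of the same
bracket. -/
theorem hessCov_symm (hT : IsTorsionFree D) {u : A → ℝ} {p : A}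
    (hu : ContMDiffAt 𝓘(ℝ, E) 𝓘(ℝ, ℝ) ∞ u p) (c d : TangentSpace 𝓘(ℝ, E) p) :
    hessCov D u p c d = hessCov D u p d c := by
  have : CompleteSpace E := FiniteDimensional.complete ℝ E
  have h1 := mvfderiv_mlieBracket hu (smooth_extend d le_rfl) (smooth_extend c le_rfl)
  rw [← hT _ _ _ ((smooth_extend (k := 1) d (by simp)).mdifferentiableAt (by simp))
    ((smooth_extend (k := 1) c (by simp)).mdifferentiableAt (by simp))] at h1
  simp only [extend_apply_self, map_sub] at h1
  simp only [hessCov, sub_apply, ContinuousLinearMap.comp_apply]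
  linarith

/-- The functions obtained by composing the chart with linear forms already separate tangent
vectors. -/
theorem eq_zero_of_mvfderiv_eq_zero {p : A} {w : TangentSpace 𝓘(ℝ, E) p}
    (h : ∀ u : A → ℝ, ContMDiffAt 𝓘(ℝ, E) 𝓘(ℝ, ℝ) ∞ u p → mvfderiv 𝓘(ℝ, E) u p w = 0) : w = 0 := by
  have hinv := isInvertible_mfderiv_extChartAt (I := 𝓘(ℝ, E)) (mem_extChartAt_source (I := 𝓘(ℝ, E)) p)
  have hc : ContMDiffAt 𝓘(ℝ, E) 𝓘(ℝ, E) ∞ (extChartAt 𝓘(ℝ, E) p) p := contMDiffAt_extChartAt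
  obtain ⟨e, he⟩ := hinv
  have h0 : mfderiv 𝓘(ℝ, E) 𝓘(ℝ, E) (extChartAt 𝓘(ℝ, E) p) p w = 0 := by
    refine (Module.forall_dual_apply_eq_zero_iff ℝ (V := E) _).1 fun l ↦ ?_
    have hl : ContMDiff 𝓘(ℝ, E) 𝓘(ℝ, ℝ) ∞ (LinearMap.toContinuousLinearMap l) :=
      ContinuousLinearMap.contMDiff _
    have := h _ (hl.contMDiffAt.comp p hc)
    rw [mvfderiv_comp_apply p (hl.contMDiffAt.mdifferentiableAt (by simp))
      (hc.mdifferentiableAt (by simp))] at this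
    simp only [mvfderiv, mfderiv_eq_fderiv, ContinuousLinearMap.fderiv] at this
    exact this
  rw [← he] at h0
  exact e.map_eq_zero_iff.1 h0

/-- Both sides are tested on functions u near f x. The bracket formula for u ∘ f produces Hessians
of u, which are symmetric and cancel; no extension of X or Y to the ambient manifold is involved. -/
theorem torsion_along [CompleteSpace G] (hT : IsTorsionFree D)
    (hf : ContMDiffAt 𝓘(ℝ, G) 𝓘(ℝ, E) ∞ f x)
    (hX : CMDiffAt ∞ (T% X) x) (hY : CMDiffAt ∞ (T% Y) x) :
    covAlong f D (fun y ↦ mfderiv 𝓘(ℝ, G) 𝓘(ℝ, E) f y (Y y)) x (X x) -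
      covAlong f D (fun y ↦ mfderiv 𝓘(ℝ, G) 𝓘(ℝ, E) f y (X y)) x (Y x) =
      mfderiv 𝓘(ℝ, G) 𝓘(ℝ, E) f x (mlieBracket 𝓘(ℝ, G) X Y x) := by
  rw [← sub_eq_zero]
  refine eq_zero_of_mvfderiv_eq_zero fun u hu ↦ ?_
  have huf : ContMDiffAt 𝓘(ℝ, G) 𝓘(ℝ, ℝ) ∞ (u ∘ f) x := hu.comp x hf
  have comp : ∀ {y : M}, ContMDiffAt 𝓘(ℝ, G) 𝓘(ℝ, E) 1 f y → ContMDiffAt 𝓘(ℝ, E) 𝓘(ℝ, ℝ) 1 u (f y) →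
      ∀ v, mvfderiv 𝓘(ℝ, G) (u ∘ f) y v = mvfderiv 𝓘(ℝ, E) u (f y) (mfderiv 𝓘(ℝ, G) 𝓘(ℝ, E) f y v) :=
    fun h1 h2 v ↦ mvfderiv_comp_apply _ (h2.mdifferentiableAt (by simp)) (h1.mdifferentiableAt (by simp)) v
  have ev : ∀ᶠ y in 𝓝 x, ∀ v, mvfderiv 𝓘(ℝ, G) (u ∘ f) y v =
      mvfderiv 𝓘(ℝ, E) u (f y) (mfderiv 𝓘(ℝ, G) 𝓘(ℝ, E) f y v) := by
    filter_upwards [(contMDiffAt_iff_contMDiffAt_nhds (n := 1) (by simp)).1 (hf.of_le (by simp)),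
      hf.continuousAt.eventually hu.eventually_one] with y h1 h2 using comp h1 h2
  have L := mvfderiv_mlieBracket huf hX hY
  have dd : ∀ {W : Π y : M, TangentSpace 𝓘(ℝ, G) y}, CMDiffAt ∞ (T% W) x → ∀ v,
      mvfderiv 𝓘(ℝ, G) (fun y ↦ mvfderiv 𝓘(ℝ, G) (u ∘ f) y (W y)) x v =
      hessCov D u (f x) (mfderiv 𝓘(ℝ, G) 𝓘(ℝ, E) f x (W x)) (mfderiv 𝓘(ℝ, G) 𝓘(ℝ, E) f x v) +
        mvfderiv 𝓘(ℝ, E) u (f x)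
          (covAlong f D (fun y ↦ mfderiv 𝓘(ℝ, G) 𝓘(ℝ, E) f y (W y)) x v) := by
    intro W hW v
    rw [← mvfderiv_mvfderiv_along hu (smoothAlong_mfderiv hf hW (m := ∞) (by simp) le_rfl)]
    refine congr($(mvfderiv_congr ?_) v)
    filter_upwards [ev] with y hy using hy _
  rw [dd hX, dd hY, ev.self_of_nhds, hessCov_symm hT hu] at L
  rw [map_sub, map_sub, L]
  ring

theorem secondCov_add_left (hD : CovariantDerivative.ContMDiffCovariantDerivative D ∞)
    {p : A} (w w' c : TangentSpace 𝓘(ℝ, E) p) :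
    secondCov D p (w + w') c = secondCov D p w c + secondCov D p w' c := by
  have hc := (contMDiffAt_cov_extend_extend hD w c).of_le (m := 1) (by simp)
  have hd := (contMDiffAt_cov_extend_extend hD w' c).of_le (m := 1) (by simp)
  have ev : ∀ w : TangentSpace 𝓘(ℝ, E) p, ∀ᶠ q in 𝓝 p, CMDiffAt 1 (T% (extend E w)) q := fun w ↦
    (contMDiffAt_iff_contMDiffAt_nhds (by simp)).1 (smooth_extend w (by simp))
  have h1 : D (fun q ↦ D (extend E (w + w')) q (extend E c q)) p =
      D (fun q ↦ D (extend E w) q (extend E c q)) p +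
      D (fun q ↦ D (extend E w') q (extend E c q)) p := by
    rw [← D.isCovariantDerivativeOnUniv.add (hc.mdifferentiableAt (by simp))
      (hd.mdifferentiableAt (by simp))]
    refine cov_congr (hc.add_section hd) ?_
    filter_upwards [(extend_add w w').eventually_nhds, ev w, ev w'] with q hq hw hw'
    rw [cov_congr (hw.add_section hw') hq, D.isCovariantDerivativeOnUniv.add
      (hw.mdifferentiableAt (by simp)) (hw'.mdifferentiableAt (by simp))]
    simp
  ext a
  simp only [secondCov, h1, cov_extend_add, add_apply, sub_apply, ContinuousLinearMap.comp_apply]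
  abel

theorem secondCov_smul_left (hD : CovariantDerivative.ContMDiffCovariantDerivative D ∞)
    {p : A} (r : ℝ) (w c : TangentSpace 𝓘(ℝ, E) p) :
    secondCov D p (r • w) c = r • secondCov D p w c := by
  have hc := (contMDiffAt_cov_extend_extend hD w c).of_le (m := 1) (by simp)
  have ev : ∀ w : TangentSpace 𝓘(ℝ, E) p, ∀ᶠ q in 𝓝 p, CMDiffAt 1 (T% (extend E w)) q := fun w ↦
    (contMDiffAt_iff_contMDiffAt_nhds (by simp)).1 (smooth_extend w (by simp))
  have h1 : D (fun q ↦ D (extend E (r • w)) q (extend E c q)) p =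
      r • D (fun q ↦ D (extend E w) q (extend E c q)) p := by
    rw [← D.isCovariantDerivativeOnUniv.smul_const r (hc.mdifferentiableAt (by simp))]
    refine cov_congr hc.const_smul_section ?_
    filter_upwards [(extend_smul r w).eventually_nhds, ev w] with q hq hw
    rw [cov_congr hw.const_smul_section hq, D.isCovariantDerivativeOnUniv.smul_const r
      (hw.mdifferentiableAt (by simp))]
    simp
  ext a
  simp only [secondCov, h1, cov_extend_smul, smul_apply, sub_apply, ContinuousLinearMap.comp_apply,
    smul_sub]

/-- Vanishing torsion replaces the bracket by covariant derivatives. What is left is linear in all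
three vectors, which is the tensoriality of the curvature. -/
theorem curvatureAt_eq (hT : IsTorsionFree D) {p : A} (a b w : TangentSpace 𝓘(ℝ, E) p) :
    curvatureAt (fun Y q v ↦ D Y q v) p a b w = secondCov D p w b a - secondCov D p w a b := by
  simp only [curvatureAt, curvature]
  rw [← hT _ _ _ ((smooth_extend (k := 1) a (by simp)).mdifferentiableAt (by simp))
    ((smooth_extend (k := 1) b (by simp)).mdifferentiableAt (by simp))]
  simp only [extend_apply_self, secondCov, sub_apply, ContinuousLinearMap.comp_apply, map_sub]
  abel

/-- The curvature of the connection induced along `f` is the curvature of `D`. -/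
theorem curvature_along [CompleteSpace G] (hD : CovariantDerivative.ContMDiffCovariantDerivative D ∞)
    (hT : IsTorsionFree D) (hV : SmoothAlong G ∞ f V x)
    (hX : CMDiffAt ∞ (T% X) x) (hY : CMDiffAt ∞ (T% Y) x) :
    covAlong f D (fun y ↦ covAlong f D V y (Y y)) x (X x) -
      covAlong f D (fun y ↦ covAlong f D V y (X y)) x (Y x) -
      covAlong f D V x (mlieBracket 𝓘(ℝ, G) X Y x) =
    curvatureAt (fun Y q v ↦ D Y q v) (f x) (mfderiv 𝓘(ℝ, G) 𝓘(ℝ, E) f x (X x))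
      (mfderiv 𝓘(ℝ, G) 𝓘(ℝ, E) f x (Y x)) (V x) := by
  rw [curvatureAt_eq hT]
  have sm : ∀ {V : Π y : M, TangentSpace 𝓘(ℝ, E) (f y)} {Z : Π y : M, TangentSpace 𝓘(ℝ, G) y},
      SmoothAlong G ∞ f V x → CMDiffAt ∞ (T% Z) x →
      SmoothAlong G 1 f (fun y ↦ LightlikeGeometry.covAlong f D V y (Z y)) x :=
    fun h h' ↦ (SmoothAlong.covAlong hD h h').of_le (by simp)
  refine SmoothAlong.induction (x := x) (k := ∞) le_rfl hV.base
    (P := fun V ↦ LightlikeGeometry.covAlong f D (fun y ↦ covAlong f D V y (Y y)) x (X x) -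
      LightlikeGeometry.covAlong f D (fun y ↦ covAlong f D V y (X y)) x (Y x) -
      LightlikeGeometry.covAlong f D V x (mlieBracket 𝓘(ℝ, G) X Y x) =
      secondCov D (f x) (V x) (mfderiv 𝓘(ℝ, G) 𝓘(ℝ, E) f x (Y x))
        (mfderiv 𝓘(ℝ, G) 𝓘(ℝ, E) f x (X x)) -
      secondCov D (f x) (V x) (mfderiv 𝓘(ℝ, G) 𝓘(ℝ, E) f x (X x))
        (mfderiv 𝓘(ℝ, G) 𝓘(ℝ, E) f x (Y x))) ?_ ?_ ?_ ?_ hV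
  · intro V W _ _ h hP
    have h1 : ∀ (Z : Π y : M, TangentSpace 𝓘(ℝ, G) y) (v : TangentSpace 𝓘(ℝ, G) x),
        LightlikeGeometry.covAlong f D (fun y ↦ covAlong f D W y (Z y)) x v =
        LightlikeGeometry.covAlong f D (fun y ↦ covAlong f D V y (Z y)) x v := fun Z v ↦ by
      refine covAlong_congr ?_ v
      filter_upwards [h.eventually_nhds] with y hy
      exact covAlong_congr hy _
    rw [h1, h1, covAlong_congr h, h.self_of_nhds]
    exact hP
  · intro V W hV hW hP hP'
    have h1 : ∀ {Z : Π y : M, TangentSpace 𝓘(ℝ, G) y} (v : TangentSpace 𝓘(ℝ, G) x), CMDiffAt ∞ (T% Z) x →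
        LightlikeGeometry.covAlong f D (fun y ↦ covAlong f D (fun y ↦ V y + W y) y (Z y)) x v =
        LightlikeGeometry.covAlong f D (fun y ↦ covAlong f D V y (Z y)) x v +
        LightlikeGeometry.covAlong f D (fun y ↦ covAlong f D W y (Z y)) x v := fun v hZ ↦ by
      rw [← covAlong_add (sm hV hZ) (sm hW hZ)]
      refine covAlong_congr ?_ v
      filter_upwards [hV.eventually, hW.eventually] with y hy hy'
      exact covAlong_add hy hy' _
    rw [h1 _ hX, h1 _ hY, covAlong_add (hV.of_le (by simp)) (hW.of_le (by simp)),
      secondCov_add_left hD, secondCov_add_left hD, add_apply, add_apply]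
    refine Eq.trans ?_ ((congrArg₂ (· + ·) hP hP').trans ?_)
    · abel
    · abel
  · intro h V hh hV hP
    -- Leibniz rule applied twice to hV. After antisymmetrisation the mixed first-order terms
    -- cancel, and the second derivatives of h cancel against [X,Y]h.
    have h1 : ∀ {Z : Π y : M, TangentSpace 𝓘(ℝ, G) y} (v : TangentSpace 𝓘(ℝ, G) x), CMDiffAt ∞ (T% Z) x →
        LightlikeGeometry.covAlong f D (fun y ↦ covAlong f D (fun y ↦ h y • V y) y (Z y)) x v =
        h x • LightlikeGeometry.covAlong f D (fun y ↦ covAlong f D V y (Z y)) x v +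
        mvfderiv 𝓘(ℝ, G) h x v • LightlikeGeometry.covAlong f D V x (Z x) +
        (mvfderiv 𝓘(ℝ, G) h x (Z x) • LightlikeGeometry.covAlong f D V x v +
        mvfderiv 𝓘(ℝ, G) (fun y ↦ mvfderiv 𝓘(ℝ, G) h y (Z y)) x v • V x) := fun {Z} v hZ ↦ by
      have hdh : ContMDiffAt 𝓘(ℝ, G) 𝓘(ℝ, ℝ) 1 (fun y ↦ mvfderiv 𝓘(ℝ, G) h y (Z y)) x :=
        (contMDiffAt_mvfderiv hh hZ (m := ∞) (by simp) le_rfl).of_le (by simp)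
      have hh1 := hh.of_le (m := 1) (by simp)
      have hV1 := hV.of_le (m := 1) (by simp)
      rw [← covAlong_smul hh1 (sm hV hZ), ← covAlong_smul hdh hV1,
        ← covAlong_add ((sm hV hZ).smul hh1) (hV1.smul hdh)]
      refine covAlong_congr ?_ v
      filter_upwards [hV.eventually, hh.eventually_one] with y hy hy'
      exact covAlong_smul hy' hy _
    rw [h1 _ hX, h1 _ hY, covAlong_smul (hh.of_le (by simp)) (hV.of_le (by simp)),
      mvfderiv_mlieBracket hh hX hY, secondCov_smul_left hD, secondCov_smul_left hD, smul_apply,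
      smul_apply, ← smul_sub, ← hP]
    module
  · intro w
    have hf := hV.base
    -- For a chart-constant field, the terms D(extend w) applied to derivatives of df X and df Y are
    -- absorbed by the bracket term through `torsion_along`.
    have h1 : ∀ {Z : Π y : M, TangentSpace 𝓘(ℝ, G) y} (v : TangentSpace 𝓘(ℝ, G) x), CMDiffAt ∞ (T% Z) x →
        LightlikeGeometry.covAlong f D
          (fun y ↦ covAlong f D (fun y ↦ extend E w (f y)) y (Z y)) x v =
        secondCov D (f x) w (mfderiv 𝓘(ℝ, G) 𝓘(ℝ, E) f x (Z x)) (mfderiv 𝓘(ℝ, G) 𝓘(ℝ, E) f x v) +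
        D (extend E w) (f x)
          (covAlong f D (fun y ↦ mfderiv 𝓘(ℝ, G) 𝓘(ℝ, E) f y (Z y)) x v) := fun {Z} v hZ ↦ by
      rw [← covAlong_cov_extend hD w (smoothAlong_mfderiv hf hZ (m := ∞) (by simp) le_rfl)]
      refine covAlong_congr ?_ v
      have h1 := (contMDiffAt_iff_contMDiffAt_nhds (n := 1) (by simp)).1
        ((smooth_extend (k := ∞) w le_rfl).of_le (by simp))
      filter_upwards [hf.continuousAt.eventually h1,
        (contMDiffAt_iff_contMDiffAt_nhds (n := 1) (by simp)).1 (hf.of_le (by simp))] with y h1 h2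
      exact covAlong_comp h1 h2 _
    rw [h1 _ hX, h1 _ hY, covAlong_comp (smooth_extend w (by simp)) (hf.of_le (by simp)),
      ← torsion_along hT hf hX hY, map_sub]
    simp only [extend_apply_self]
    abel

end Second

/-! ### Metric compatibility and parallel φ along a map. -/

section Metric

variable {E : Type*} [NormedAddCommGroup E] [NormedSpace ℝ E] [FiniteDimensional ℝ E]
  {A : Type*} [TopologicalSpace A] [T2Space A] [ChartedSpace E A] [IsManifold 𝓘(ℝ, E) ∞ A]
  {G : Type*} [NormedAddCommGroup G] [NormedSpace ℝ G]
  {M : Type*} [TopologicalSpace M] [ChartedSpace G M] [IsManifold 𝓘(ℝ, G) ∞ M]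
  {f : M → A} {x : M} {k : ℕ∞ω} {V W : Π y : M, TangentSpace 𝓘(ℝ, E) (f y)}
  {D : CovariantDerivative 𝓘(ℝ, E) E (TangentSpace 𝓘(ℝ, E) : A → Type _)}

namespace AlmostContactBMetric

variable (S : AlmostContactBMetric E A)

theorem contMDiffAt_g (hk : k ≤ ∞) (hV : SmoothAlong G k f V x) (hW : SmoothAlong G k f W x) :
    ContMDiffAt 𝓘(ℝ, G) 𝓘(ℝ, ℝ) k (fun y ↦ S.g (f y) (V y) (W y)) x := by
  have : ContMDiffAt 𝓘(ℝ, G) (𝓘(ℝ, E).prod 𝓘(ℝ, ℝ)) k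
      (fun m ↦ Bundle.TotalSpace.mk' ℝ (E := Bundle.Trivial A ℝ) (f m) (S.g (f m) (V m) (W m))) x := by
    apply ContMDiffAt.clm_bundle_apply₂ (F₁ := E) (F₂ := E)
      (E₁ := (TangentSpace 𝓘(ℝ, E) : A → Type _)) (E₂ := (TangentSpace 𝓘(ℝ, E) : A → Type _))
    · exact ContMDiffAt.comp x ((S.g_smooth.contMDiffAt).of_le hk) hV.base
    · exact hV
    · exact hW
  exact (Bundle.contMDiffAt_totalSpace.1 this).2

theorem contMDiffAt_eta (hk : k ≤ ∞) (hV : SmoothAlong G k f V x) :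
    ContMDiffAt 𝓘(ℝ, G) 𝓘(ℝ, ℝ) k (fun y ↦ S.eta (f y) (V y)) x := by
  have : ContMDiffAt 𝓘(ℝ, G) (𝓘(ℝ, E).prod 𝓘(ℝ, ℝ)) k
      (fun m ↦ Bundle.TotalSpace.mk' ℝ (E := Bundle.Trivial A ℝ) (f m) (S.eta (f m) (V m))) x := by
    apply ContMDiffAt.clm_bundle_apply (F₁ := E) (E₁ := (TangentSpace 𝓘(ℝ, E) : A → Type _))
    · exact ContMDiffAt.comp x ((S.eta_smooth.contMDiffAt).of_le hk) hV.base
    · exact hV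
  exact (Bundle.contMDiffAt_totalSpace.1 this).2

theorem smoothAlong_phi (hk : k ≤ ∞) (hV : SmoothAlong G k f V x) :
    SmoothAlong G k f (fun y ↦ S.phi (f y) (V y)) x :=
  SmoothAlong.clm (ContMDiffAt.comp x ((S.phi_smooth.contMDiffAt).of_le hk) hV.base) hV

theorem smoothAlong_xi (hk : k ≤ ∞) (hf : ContMDiffAt 𝓘(ℝ, G) 𝓘(ℝ, E) k f x) :
    SmoothAlong G k f (fun y ↦ S.xi (f y)) x :=
  SmoothAlong.comp (S.xi_smooth.contMDiffAt.of_le hk) hf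

/-- The connection induced along `f` is compatible with the metric. -/
theorem metric_along (hD : IsLeviCivita (fun p x y ↦ S.g p x y) D)
    (hV : SmoothAlong G 1 f V x) (hW : SmoothAlong G 1 f W x) (v : TangentSpace 𝓘(ℝ, G) x) :
    mvfderiv 𝓘(ℝ, G) (fun y ↦ S.g (f y) (V y) (W y)) x v =
      S.g (f x) (covAlong f D V x v) (W x) + S.g (f x) (V x) (covAlong f D W x v) := by
  have one : (1 : ℕ∞ω) ≤ ∞ := by simp
  have md : ∀ {V W : Π y : M, TangentSpace 𝓘(ℝ, E) (f y)}, SmoothAlong G 1 f V x →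
      SmoothAlong G 1 f W x → MDiffAt (fun y ↦ S.g (f y) (V y) (W y)) x := fun hV hW ↦
    (S.contMDiffAt_g one hV hW).mdifferentiableAt (by simp)
  have hf := hV.base
  have fin : ∀ a : TangentSpace 𝓘(ℝ, E) (f x),
      SmoothAlong G 1 f (fun y ↦ extend E a (f y)) x := fun a ↦
    SmoothAlong.comp (smooth_extend _ one) hf
  have symmcase : ∀ {V W : Π y : M, TangentSpace 𝓘(ℝ, E) (f y)},
      mvfderiv 𝓘(ℝ, G) (fun y ↦ S.g (f y) (V y) (W y)) x v =
        S.g (f x) (covAlong f D V x v) (W x) + S.g (f x) (V x) (covAlong f D W x v) →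
      mvfderiv 𝓘(ℝ, G) (fun y ↦ S.g (f y) (W y) (V y)) x v =
        S.g (f x) (covAlong f D W x v) (V x) + S.g (f x) (W x) (covAlong f D V x v) := by
    intro V W h
    simp only [fun y ↦ S.g_symm (f y) (W y) (V y)]
    rw [h, S.g_symm _ (W x), S.g_symm _ (V x), add_comm]
  have reduce : ∀ {W : Π y : M, TangentSpace 𝓘(ℝ, E) (f y)}, SmoothAlong G 1 f W x →
      (∀ a : TangentSpace 𝓘(ℝ, E) (f x),
        mvfderiv 𝓘(ℝ, G) (fun y ↦ S.g (f y) (extend E a (f y)) (W y)) x v =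
        S.g (f x) (covAlong f D (fun y ↦ extend E a (f y)) x v) (W x) +
          S.g (f x) (extend E a (f x)) (covAlong f D W x v)) →
      ∀ V, SmoothAlong G 1 f V x →
      mvfderiv 𝓘(ℝ, G) (fun y ↦ S.g (f y) (V y) (W y)) x v =
        S.g (f x) (covAlong f D V x v) (W x) + S.g (f x) (V x) (covAlong f D W x v) := by
    intro W hW hconst V hV
    refine SmoothAlong.induction (x := x) (k := 1) one hf
      (P := fun V ↦ mvfderiv 𝓘(ℝ, G) (fun y ↦ S.g (f y) (V y) (W y)) x v =
        S.g (f x) (covAlong f D V x v) (W x) + S.g (f x) (V x) (covAlong f D W x v))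
      ?_ ?_ ?_ hconst hV
    · intro V V' _ _ h hP
      rw [covAlong_congr h, h.self_of_nhds, ← hP]
      refine congr($(mvfderiv_congr ?_) v)
      filter_upwards [h] with y hy
      rw [hy]
    · intro V V' hV hV' hP hP'
      simp only [map_add, add_apply]
      rw [mvfderiv_fun_add (md hV hW) (md hV' hW), covAlong_add hV hV', add_apply, hP, hP',
        map_add, add_apply]
      ring
    · intro h V hh hV hP
      simp only [map_smul, smul_apply]
      rw [mvfderiv_fun_smul (hh.mdifferentiableAt (by simp)) (md hV hW), covAlong_smul hh hV,
        add_apply, smul_apply, hP, map_add, add_apply, map_smul, map_smul]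
      simp only [ContinuousLinearMap.smulRight_apply, smul_eq_mul, smul_apply]
      ring
  -- Reduce the first argument to chart-constant fields, exchange the arguments by symmetry, and
  -- reduce the other one. For two restricted fields the claim is the ambient metric condition.
  refine reduce hW (fun a ↦ symmcase (reduce (fin a) (fun b ↦ ?_) W hW)) V hV
  have hg : MDiffAt (fun q ↦ S.g q (extend E b q) (extend E a q)) (f x) :=
    (S.contMDiffAt_g (f := (id : A → A)) one (smooth_extend b one)
      (smooth_extend a one)).mdifferentiableAt (by simp)
  refine (mvfderiv_comp_apply x hg (hf.mdifferentiableAt (by simp)) v).trans ?_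
  rw [covAlong_comp (smooth_extend b one) hf, covAlong_comp (smooth_extend a one) hf]
  exact hD.metric _ _ _ _ ((smooth_extend b one).mdifferentiableAt (by simp))
    ((smooth_extend a one).mdifferentiableAt (by simp))

/-- `φ` is parallel along `f`. -/
theorem phi_along (hF0 : S.IsF0 D) (hV : SmoothAlong G 1 f V x) (v : TangentSpace 𝓘(ℝ, G) x) :
    covAlong f D (fun y ↦ S.phi (f y) (V y)) x v = S.phi (f x) (covAlong f D V x v) := by
  have one : (1 : ℕ∞ω) ≤ ∞ := by simp
  have hf := hV.base
  refine SmoothAlong.induction (x := x) (k := 1) one hf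
    (P := fun V ↦ covAlong f D (fun y ↦ S.phi (f y) (V y)) x v = S.phi (f x) (covAlong f D V x v))
    ?_ ?_ ?_ ?_ hV
  · intro V V' _ _ h hP
    rw [covAlong_congr h, ← hP]
    refine covAlong_congr ?_ v
    filter_upwards [h] with y hy
    rw [hy]
  · intro V V' hV hV' hP hP'
    simp only [map_add]
    rw [covAlong_add (S.smoothAlong_phi one hV) (S.smoothAlong_phi one hV'), covAlong_add hV hV',
      map_add, hP, hP']
  · intro h V hh hV hP
    simp only [map_smul]
    rw [covAlong_smul hh (S.smoothAlong_phi one hV), covAlong_smul hh hV, map_add, map_smul,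
      map_smul, hP]
  · intro a
    rw [covAlong_comp (smooth_extend a one) hf]
    refine (covAlong_comp (Y := fun q ↦ S.phi q (extend E a q))
      (S.smoothAlong_phi (f := (id : A → A)) one (smooth_extend a one)) hf v).trans ?_
    rw [← sub_eq_zero]
    exact S.g_nondegenerate _ _ fun z ↦ hF0 _ _ z _ ((smooth_extend a one).mdifferentiableAt (by simp))

end AlmostContactBMetric

end Metric

/-! ### Linear algebra: curvature-like tensors determined by totally real sectional curvatures. -/

/-- An almost contact structure with a B-metric on a vector space. -/
structure ContactBMetricSpace (V : Type*) [AddCommGroup V] [Module ℝ V] where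
  phi : V →ₗ[ℝ] V
  xi : V
  eta : V →ₗ[ℝ] ℝ
  g : V →ₗ[ℝ] V →ₗ[ℝ] ℝ
  g_symm : ∀ x y, g x y = g y x
  g_nondegenerate : ∀ x, (∀ y, g x y = 0) → x = 0
  phi_sq : ∀ x, phi (phi x) = -x + eta x • xi
  eta_xi : eta xi = 1
  g_phi : ∀ x y, g (phi x) (phi y) = -g x y + eta x * eta y

namespace ContactBMetricSpace

variable {V : Type*} [AddCommGroup V] [Module ℝ V] (B : ContactBMetricSpace V)

theorem xi_ne_zero : B.xi ≠ 0 := fun h ↦ by simpa [h] using B.eta_xi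

/-- The formula for φ² gives φ²ξ = 0. Evaluated at φξ it makes φξ a multiple of ξ, with a
coefficient whose square is zero. -/
theorem phi_xi : B.phi B.xi = 0 := by
  have h1 : B.phi (B.phi B.xi) = 0 := by rw [B.phi_sq, B.eta_xi]; simp
  have h2 := B.phi_sq (B.phi B.xi)
  rw [h1, map_zero] at h2
  have h3 : B.phi B.xi = B.eta (B.phi B.xi) • B.xi := by
    rwa [eq_comm, neg_add_eq_zero] at h2
  have h4 : B.eta (B.phi B.xi) * B.eta (B.phi B.xi) = 0 := by
    have := congrArg B.phi h3
    rw [h1, map_smul] at this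
    have := congrArg B.eta this
    simpa using this.symm
  rw [h3, mul_self_eq_zero.1 h4, zero_smul]

theorem eta_phi (x : V) : B.eta (B.phi x) = 0 := by
  have h1 := congrArg B.phi (B.phi_sq x)
  rw [B.phi_sq, map_add, map_smul, B.phi_xi, map_neg, smul_zero, add_zero, add_eq_left] at h1
  exact (smul_eq_zero.1 h1).resolve_right B.xi_ne_zero

theorem g_xi (x : V) : B.g x B.xi = B.eta x := by
  have := B.g_phi x B.xi
  rw [B.phi_xi, map_zero, B.eta_xi] at this
  linarith

theorem g_xi' (x : V) : B.g B.xi x = B.eta x := by rw [B.g_symm, g_xi]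

theorem g_phi_left (x y : V) : B.g (B.phi x) y = B.g x (B.phi y) := by
  have := B.g_phi x (B.phi y)
  rw [B.phi_sq, map_add, map_smul, B.g_xi, B.eta_phi, B.eta_phi, map_neg] at this
  simp at this
  exact this

theorem ext_g {x y : V} (h : ∀ w, B.g x w = B.g y w) : x = y :=
  sub_eq_zero.1 (B.g_nondegenerate _ fun w ↦ by rw [map_sub, LinearMap.sub_apply, h, sub_self])

/-- `R` has the symmetries of the curvature tensor of a metric connection with parallel `φ`. -/
structure IsCurvatureLike (R : V →ₗ[ℝ] V →ₗ[ℝ] V →ₗ[ℝ] V) : Prop where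
  antisymm : ∀ x y z, R x y z = -R y x z
  bianchi : ∀ x y z, R x y z + R y z x + R z x y = 0
  skew : ∀ x y z w, B.g (R x y z) w = -B.g (R x y w) z
  phi_right : ∀ x y z, R x y (B.phi z) = B.phi (R x y z)

namespace IsCurvatureLike

variable {B} {R R' : V →ₗ[ℝ] V →ₗ[ℝ] V →ₗ[ℝ] V}

theorem add (hR : B.IsCurvatureLike R) (hR' : B.IsCurvatureLike R') : B.IsCurvatureLike (R + R') where
  antisymm x y z := by simp only [LinearMap.add_apply, hR.antisymm x y, hR'.antisymm x y]; abel
  bianchi x y z := by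
    simp only [LinearMap.add_apply]
    refine Eq.trans ?_ ((congrArg₂ (· + ·) (hR.bianchi x y z) (hR'.bianchi x y z)).trans (add_zero 0))
    abel
  skew x y z w := by
    simp only [LinearMap.add_apply, map_add, hR.skew x y z w, hR'.skew x y z w]; ring
  phi_right x y z := by simp only [LinearMap.add_apply, map_add, hR.phi_right, hR'.phi_right]

theorem smul (hR : B.IsCurvatureLike R) (c : ℝ) : B.IsCurvatureLike (c • R) where
  antisymm x y z := by simp only [LinearMap.smul_apply, hR.antisymm x y, smul_neg]
  bianchi x y z := by
    simp only [LinearMap.smul_apply, ← smul_add, hR.bianchi, smul_zero]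
  skew x y z w := by
    simp only [LinearMap.smul_apply, map_smul, hR.skew x y z w, smul_neg]
  phi_right x y z := by simp only [LinearMap.smul_apply, map_smul, hR.phi_right]

/-- φ kills R(x,y)ξ because φξ = 0, and η kills it by skew-symmetry; the formula for φ² then leaves
nothing. -/
theorem xi_right (hR : B.IsCurvatureLike R) (x y : V) : R x y B.xi = 0 := by
  have h1 := hR.phi_right x y B.xi
  rw [B.phi_xi, map_zero] at h1
  have h2 := B.phi_sq (R x y B.xi)
  have h3 := hR.skew x y B.xi B.xi
  rw [B.g_xi] at h3
  rw [← h1, map_zero, show B.eta (R x y B.xi) = 0 by linarith] at h2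
  simpa using h2.symm

theorem pair_symm (hR : B.IsCurvatureLike R) (x y z w : V) :
    B.g (R x y z) w = B.g (R z w x) y := by
  have b : ∀ x y z w, B.g (R x y z) w + B.g (R y z x) w + B.g (R z x y) w = 0 := fun x y z w ↦ by
    rw [← LinearMap.add_apply, ← LinearMap.add_apply, ← map_add, ← map_add, hR.bianchi]; simp
  have a : ∀ x y z w, B.g (R x y z) w = - B.g (R y x z) w := fun x y z w ↦ by
    rw [hR.antisymm]; simp
  linarith [b x y z w, b y z w x, b z w x y, b w x y z, hR.skew x y z w, hR.skew y z x w,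
    hR.skew z x y w, hR.skew z w y x, hR.skew w y z x, hR.skew w x z y, hR.skew x z w y,
    a x y z w, a y z x w, a z x y w, a z w x y, a w x y z, a w y x z, a x z w y, a y w z x,
    hR.skew z w x y, hR.skew y z w x, hR.skew w y x z, hR.skew y w z x, hR.skew x z y w]

/-- Pair symmetry gives R(φx,y) = R(x,φy). The Bianchi identity then shows that the defect R(φx,y)z
- φR(x,y)z changes sign under a cyclic permutation of x, y, z. Three such permutations return it to
its own negative. -/
theorem phi_left (hR : B.IsCurvatureLike R) (x y z : V) : R (B.phi x) y z = B.phi (R x y z) := by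
  have h1 : ∀ x y z, R (B.phi x) y z = R x (B.phi y) z := fun x y z ↦ B.ext_g fun w ↦ by
    rw [hR.pair_symm, hR.phi_right, B.g_phi_left, ← hR.pair_symm]
  have key : ∀ x y z, R (B.phi x) y z - B.phi (R x y z) =
      -(R (B.phi z) x y - B.phi (R z x y)) := fun x y z ↦ by
    have b := hR.bianchi (B.phi x) y z
    rw [hR.phi_right, ← h1] at b
    have b' := congrArg B.phi (hR.bianchi x y z)
    simp only [map_add, map_zero] at b'
    rw [← sub_eq_zero, ← sub_eq_zero.2 (b.trans b'.symm)]
    abel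
  have h2 : R (B.phi x) y z - B.phi (R x y z) = -(R (B.phi x) y z - B.phi (R x y z)) := by
    conv_lhs => rw [key, key, key]
    simp
  have h3 : (2 : ℝ) • (R (B.phi x) y z - B.phi (R x y z)) = 0 := by
    rw [two_smul]
    exact add_eq_zero_iff_eq_neg.2 h2
  exact sub_eq_zero.1 ((smul_eq_zero.1 h3).resolve_left two_ne_zero)

theorem phi_mid (hR : B.IsCurvatureLike R) (x y z : V) : R x (B.phi y) z = B.phi (R x y z) := by
  rw [hR.antisymm, hR.phi_left, hR.antisymm x, map_neg]

theorem xi_left (hR : B.IsCurvatureLike R) (x y : V) : R B.xi x y = 0 :=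
  B.ext_g fun w ↦ by
    rw [hR.pair_symm, hR.xi_right]
    simp

end IsCurvatureLike
/-- Composition of `R` with `φ`. -/
def phiComp (R : V →ₗ[ℝ] V →ₗ[ℝ] V →ₗ[ℝ] V) : V →ₗ[ℝ] V →ₗ[ℝ] V →ₗ[ℝ] V :=
  R.compr₂ (LinearMap.llcomp ℝ V V V B.phi)

@[simp] theorem phiComp_apply (R : V →ₗ[ℝ] V →ₗ[ℝ] V →ₗ[ℝ] V) (x y z : V) :
    B.phiComp R x y z = B.phi (R x y z) := rfl

theorem IsCurvatureLike.phiComp {B : ContactBMetricSpace V} {R : V →ₗ[ℝ] V →ₗ[ℝ] V →ₗ[ℝ] V}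
    (hR : B.IsCurvatureLike R) : B.IsCurvatureLike (B.phiComp R) where
  antisymm x y z := by simp only [phiComp_apply, hR.antisymm x y, map_neg]
  bianchi x y z := by simp only [phiComp_apply, ← map_add, hR.bianchi, map_zero]
  skew x y z w := by
    simp only [phiComp_apply]
    rw [B.g_phi_left, hR.skew, hR.phi_right]
  phi_right x y z := by simp only [phiComp_apply, hR.phi_right]

/-- The component of `x` in the kernel of `η`. -/
def hor : V →ₗ[ℝ] V := LinearMap.id - B.eta.smulRight B.xi

theorem hor_apply (x : V) : B.hor x = x - B.eta x • B.xi := rfl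

/-- The model of the curvature tensors of constant totally real sectional curvatures. -/
def modelCurvature : V →ₗ[ℝ] V →ₗ[ℝ] V →ₗ[ℝ] V :=
  LinearMap.mk₂ ℝ (fun x y ↦ (B.g (B.hor y)).smulRight (B.hor x) - (B.g (B.hor x)).smulRight (B.hor y)
      - (B.g (B.phi y)).smulRight (B.phi x) + (B.g (B.phi x)).smulRight (B.phi y))
    (fun x x' y ↦ by ext z; simp; module) (fun c x y ↦ by ext z; simp; module)
    (fun x y y' ↦ by ext z; simp; module) (fun c x y ↦ by ext z; simp; module)

theorem g_hor (x y : V) : B.g (B.hor x) y = B.g x y - B.eta x * B.eta y := by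
  simp [hor_apply, g_xi']

theorem modelCurvature_apply (x y z : V) : B.modelCurvature x y z =
    (B.g y z - B.eta y * B.eta z) • B.hor x - (B.g x z - B.eta x * B.eta z) • B.hor y
      - B.g y (B.phi z) • B.phi x + B.g x (B.phi z) • B.phi y := by
  rw [← g_hor, ← g_hor, ← g_phi_left, ← g_phi_left]
  rfl

/-- On ker η, regarded as complex through φ, with h = g - i g(·,φ·), the model is h(y,z)x - h(x,z)y:
the complex form of constant curvature. -/
theorem isCurvatureLike_modelCurvature : B.IsCurvatureLike B.modelCurvature where
  antisymm x y z := by simp only [modelCurvature_apply]; module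
  bianchi x y z := by
    simp only [modelCurvature_apply]
    rw [B.g_symm z x, B.g_symm z y, B.g_symm y x, ← B.g_phi_left x y, ← B.g_phi_left y z,
      ← B.g_phi_left z x, B.g_symm (B.phi x), B.g_symm (B.phi y), B.g_symm (B.phi z)]
    module
  skew x y z w := by
    simp only [modelCurvature_apply, map_sub, map_add, map_smul, LinearMap.add_apply,
      LinearMap.sub_apply, LinearMap.smul_apply, smul_eq_mul, g_hor, B.g_phi_left]
    ring
  phi_right x y z := by
    simp only [modelCurvature_apply, map_sub, map_add, map_smul, B.phi_sq, B.eta_phi, B.hor_apply,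
      B.phi_xi, B.g_xi, map_neg]
    module

/-- A complex structure for which `g` is a Norden metric has a complex orthonormal basis. -/
theorem exists_complex_orthonormal [FiniteDimensional ℝ V] (J : V →ₗ[ℝ] V) (hJ : ∀ x, J (J x) = -x)
    (g : V →ₗ[ℝ] V →ₗ[ℝ] ℝ) (hs : ∀ x y, g x y = g y x) (hn : ∀ x, (∀ y, g x y = 0) → x = 0)
    (hg : ∀ x y, g (J x) (J y) = -g x y) :
    ∃ (m : ℕ) (e : Fin m → V), (∀ i j, g (e i) (e j) = if i = j then 1 else 0) ∧
      (∀ i j, g (e i) (J (e j)) = 0) ∧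
      ∀ x, ∃ a b : Fin m → ℝ, x = ∑ i, a i • e i + J (∑ i, b i • e i) := by
  have hgJ : ∀ x y, g (J x) y = g x (J y) := fun x y ↦ by
    have := hg x (J y)
    rw [hJ, map_neg] at this
    linarith
  let F := Complex.liftAux (A := Module.End ℝ V) J (by ext x; simp [hJ])
  let _ : Module ℂ V := Module.compHom V F.toRingHom
  have sm : ∀ (z : ℂ) (x : V), z • x = z.re • x + z.im • J x := fun z x ↦ by
    change F z x = _
    simp only [F, Complex.liftAux_apply]
    simp [Module.algebraMap_end_apply]
  have : IsScalarTower ℝ ℂ V := ⟨fun r z x ↦ by simp [sm, smul_smul]⟩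
  have : Module.Finite ℂ V := Module.Finite.of_restrictScalars_finite ℝ ℂ V
  -- Since J is g-symmetric, g - i g(·,J·) is complex bilinear (not sesquilinear) and symmetric, so
  -- it can be diagonalised.
  let h : LinearMap.BilinForm ℂ V := LinearMap.mk₂ ℂ (fun x y ↦ (⟨g x y, -g x (J y)⟩ : ℂ))
    (fun x x' y ↦ by apply Complex.ext <;> simp; ring)
    (fun c x y ↦ by apply Complex.ext <;> simp [sm, hgJ, hJ]; ring)
    (fun x x' y ↦ by apply Complex.ext <;> simp; ring)
    (fun c x y ↦ by apply Complex.ext <;> simp [sm, hJ]; ring)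
  have happ : ∀ x y, h x y = ⟨g x y, -g x (J y)⟩ := fun _ _ ↦ rfl
  have hsymm : LinearMap.IsSymm h := ⟨fun x y ↦ by
    simp only [happ, RingHom.id_apply]
    rw [← hgJ, hs x y, hs (J x)]⟩
  have : Invertible (2 : ℂ) := invertibleOfNonzero two_ne_zero
  obtain ⟨v, hv⟩ := LinearMap.BilinForm.exists_orthogonal_basis hsymm
  have hv0 : ∀ i, h (v i) (v i) ≠ 0 := fun i hi ↦ v.ne_zero i <| hn _ fun y ↦ by
    have : h (v i) y = 0 := by
      rw [← v.sum_repr y, map_sum]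
      refine Finset.sum_eq_zero fun j _ ↦ ?_
      rw [map_smul]
      by_cases hij : i = j
      · rw [← hij, hi, smul_zero]
      · rw [hv hij, smul_zero]
    exact congrArg Complex.re this
  -- Square roots exist in ℂ, so all diagonal entries become +1 and no signature appears. The real
  -- and imaginary parts of h(eᵢ,eⱼ) = δᵢⱼ are the two asserted relations.
  choose c hc using fun i ↦ IsAlgClosed.exists_eq_mul_self (h (v i) (v i))⁻¹
  have hc0 : ∀ i, c i ≠ 0 := fun i hi ↦ hv0 i (by simpa [hi] using hc i)
  have he : ∀ i j, h (c i • v i) (c j • v j) = if i = j then 1 else 0 := fun i j ↦ by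
    rw [map_smul, LinearMap.map_smul₂]
    split_ifs with hij
    · rw [← hij, smul_eq_mul, smul_eq_mul, ← mul_assoc, ← hc, inv_mul_cancel₀ (hv0 i)]
    · rw [hv hij, smul_zero, smul_zero]
  refine ⟨_, fun i ↦ c i • v i, fun i j ↦ ?_, fun i j ↦ ?_, fun x ↦
    ⟨fun i ↦ (v.repr x i / c i).re, fun i ↦ (v.repr x i / c i).im, ?_⟩⟩
  · have := congrArg Complex.re (he i j)
    rw [happ] at this
    simpa [apply_ite Complex.re] using this
  · have := congrArg Complex.im (he i j)
    rw [happ] at this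
    simpa [apply_ite Complex.im] using this
  · rw [map_sum, ← Finset.sum_add_distrib]
    conv_lhs => rw [← v.sum_repr x]
    refine Finset.sum_congr rfl fun i _ ↦ ?_
    rw [map_smul, ← sm, smul_smul, div_mul_cancel₀ _ (hc0 i)]

/-- The real span W of a complex orthonormal basis of ker η is totally real and g is positive
definite on it, while V = ℝξ + W + φW. Polarisation kills R on W, and φ-linearity together with
R(ξ,·) = 0 and R(·,·)ξ = 0 extends this to V. -/
theorem IsCurvatureLike.eq_zero_of_sectional [FiniteDimensional ℝ V] {B : ContactBMetricSpace V}
    {R : V →ₗ[ℝ] V →ₗ[ℝ] V →ₗ[ℝ] V} (hR : B.IsCurvatureLike R)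
    (h : ∀ x y, B.eta x = 0 → B.eta y = 0 → B.g x x * B.g y y - B.g x y ^ 2 ≠ 0 →
      (∀ a ∈ Submodule.span ℝ {x, y}, ∀ b ∈ Submodule.span ℝ {x, y}, B.g (B.phi a) b = 0) →
      B.g (R x y y) x = 0 ∧ B.g (R x y y) (B.phi x) = 0) : R = 0 := by
  let K := LinearMap.ker B.eta
  have hK : ∀ x, x ∈ K ↔ B.eta x = 0 := fun x ↦ LinearMap.mem_ker
  let J : K →ₗ[ℝ] K := B.phi.restrict fun x _ ↦ (hK _).2 (B.eta_phi x)
  obtain ⟨m, e, he1, he2, he3⟩ := exists_complex_orthonormal (V := K) J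
    (fun x ↦ Subtype.ext (by simp [J, B.phi_sq, (hK _).1 x.2]))
    ((B.g.domRestrict₁₂ K K)) (fun x y ↦ B.g_symm _ _) (fun x hx ↦ Subtype.ext <|
      B.g_nondegenerate _ fun y ↦ by
        have h1 := hx ⟨B.hor y, by simp [hK, hor_apply, B.eta_xi]⟩
        simpa [hor_apply, B.g_xi, (hK _).1 x.2, LinearMap.domRestrict₁₂_apply] using h1)
    (fun x y ↦ by simp [J, B.g_phi, (hK _).1 x.2, LinearMap.domRestrict₁₂_apply])
  let W := Submodule.span ℝ (Set.range fun i ↦ (e i : V))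
  have hWK : ∀ x ∈ W, B.eta x = 0 := fun x hx ↦ by
    refine (Submodule.span_le (p := K)).2 ?_ hx
    rintro _ ⟨i, rfl⟩
    exact (e i).2
  have hWe : ∀ x ∈ W, ∃ a : Fin m → ℝ, x = ∑ i, a i • (e i : V) := fun x hx ↦ by
    obtain ⟨a, rfl⟩ := (Submodule.mem_span_range_iff_exists_fun ℝ).1 hx
    exact ⟨a, rfl⟩
  have he1' : ∀ i j, B.g (e i) (e j) = if i = j then 1 else 0 := he1
  have he2' : ∀ i j, B.g (e i) (B.phi (e j)) = 0 := he2
  have hW1 : ∀ x ∈ W, ∀ y ∈ W, B.g (B.phi x) y = 0 := fun x hx y hy ↦ by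
    obtain ⟨a, rfl⟩ := hWe x hx
    obtain ⟨b, rfl⟩ := hWe y hy
    simp [B.g_phi_left, he2']
  have hW2 : ∀ x ∈ W, B.g x x = 0 → x = 0 := fun x hx h0 ↦ by
    obtain ⟨a, rfl⟩ := hWe x hx
    simp only [map_sum, map_smul, LinearMap.sum_apply, LinearMap.smul_apply, he1', smul_eq_mul,
      mul_ite, mul_one, mul_zero, Finset.sum_ite_eq', Finset.mem_univ, if_true] at h0
    rw [Finset.sum_eq_zero_iff_of_nonneg fun i _ ↦ mul_self_nonneg _] at h0
    exact Finset.sum_eq_zero fun i hi ↦ by rw [mul_self_eq_zero.1 (h0 i hi), zero_smul]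
  have hdec : ∀ x, ∃ a ∈ W, ∃ b ∈ W, x = B.eta x • B.xi + a + B.phi b := fun x ↦ by
    obtain ⟨a, b, hab⟩ := he3 ⟨B.hor x, by simp [hK, hor_apply, B.eta_xi]⟩
    have hmem : ∀ a : Fin m → ℝ, ∑ i, a i • (e i : V) ∈ W := fun a ↦
      Submodule.sum_mem _ fun i _ ↦ Submodule.smul_mem _ _ (Submodule.subset_span ⟨i, rfl⟩)
    refine ⟨_, hmem a, _, hmem b, ?_⟩
    have hab' : B.hor x = ∑ i, a i • (e i : V) + B.phi (∑ i, b i • (e i : V)) := by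
      simpa [J] using congrArg Subtype.val hab
    rw [add_assoc, ← hab', hor_apply, add_sub_cancel]
  have self : ∀ (T : V →ₗ[ℝ] V →ₗ[ℝ] V →ₗ[ℝ] V), B.IsCurvatureLike T → ∀ x z, T x x z = 0 := by
    intro T hT x z
    have h3 : (2 : ℝ) • T x x z = 0 := by
      rw [two_smul]
      exact add_eq_zero_iff_eq_neg.2 (hT.antisymm x x z)
    exact (smul_eq_zero.1 h3).resolve_left two_ne_zero
  -- The hypothesis speaks only of nondegenerate planes. By definiteness, a degenerate pair in W is
  -- linearly dependent: if g(x,x) ≠ 0, the vector g(x,x)y - g(x,y)x is null and hence zero.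
  have hsec : ∀ x ∈ W, ∀ y ∈ W, B.g (R x y y) x = 0 ∧ B.g (R x y y) (B.phi x) = 0 := by
    intro x hx y hy
    by_cases hi : B.g x x * B.g y y - B.g x y ^ 2 = 0
    · by_cases hx0 : B.g x x = 0
      · simp [hW2 x hx hx0]
      · have hz := hW2 (B.g x x • y - B.g x y • x)
          (W.sub_mem (W.smul_mem _ hy) (W.smul_mem _ hx)) (by
            simp only [map_sub, map_smul, LinearMap.sub_apply, LinearMap.smul_apply, smul_eq_mul]
            rw [B.g_symm y x]
            linear_combination B.g x x * hi)
        have hR0 : B.g x x • R x y y = 0 := by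
          rw [← LinearMap.smul_apply, ← map_smul, sub_eq_zero.1 hz, map_smul, LinearMap.smul_apply,
            self R hR, smul_zero]
        rw [(smul_eq_zero.1 hR0).resolve_left hx0]
        simp
    · have hsub : Submodule.span ℝ {x, y} ≤ W := Submodule.span_le.2 (by
        rintro z (rfl | rfl) <;> assumption)
      exact h x y (hWK x hx) (hWK y hy) hi fun a ha b hb ↦ hW1 a (hsub ha) b (hsub hb)
  -- Classical polarisation: T becomes antisymmetric in its second and third arguments, hence, with
  -- the first antisymmetry, invariant under cyclic permutations, and the Bianchi identity gives 3T
  -- = 0. It is stated for general T because it serves for both R and φR.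
  have pol : ∀ T : V →ₗ[ℝ] V →ₗ[ℝ] V →ₗ[ℝ] V, B.IsCurvatureLike T →
      (∀ x ∈ W, ∀ y ∈ W, B.g (T x y y) x = 0) →
      ∀ x ∈ W, ∀ y ∈ W, ∀ z ∈ W, ∀ w ∈ W, B.g (T x y z) w = 0 := by
    intro T hT hs
    have anti : ∀ x y z w, B.g (T x y z) w = - B.g (T y x z) w := fun x y z w ↦ by
      rw [hT.antisymm]; simp
    have h1 : ∀ x ∈ W, ∀ y ∈ W, ∀ w ∈ W, B.g (T x y y) w = 0 := fun x hx y hy w hw ↦ by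
      have a1 := hs (x + w) (W.add_mem hx hw) y hy
      simp only [map_add, LinearMap.add_apply] at a1
      linarith [hs x hx y hy, hs w hw y hy, hT.pair_symm w y y x, anti y x w y, hT.skew x y w y]
    have h2 : ∀ x ∈ W, ∀ y ∈ W, ∀ z ∈ W, ∀ w ∈ W, B.g (T x y z) w = -B.g (T x z y) w :=
      fun x hx y hy z hz w hw ↦ by
        have a1 := h1 x hx (y + z) (W.add_mem hy hz) w hw
        simp only [map_add, LinearMap.add_apply] at a1
        linarith [h1 x hx y hy w hw, h1 x hx z hz w hw]
    intro x hx y hy z hz w hw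
    have b : B.g (T x y z) w + B.g (T y z x) w + B.g (T z x y) w = 0 := by
      rw [← LinearMap.add_apply, ← LinearMap.add_apply, ← map_add, ← map_add, hT.bianchi]; simp
    linarith [h2 x hx y hy z hz w hw, h2 y hy z hz x hx w hw, anti x z y w, anti y x z w]
  -- A test vector has components along ξ, W and φW: skew-symmetry and R(·,·)ξ = 0 handle ξ,
  -- polarisation of R handles W, and that of φR handles φW.
  have hW : ∀ x ∈ W, ∀ y ∈ W, ∀ z ∈ W, R x y z = 0 := by
    intro x hx y hy z hz
    refine B.ext_g fun v ↦ ?_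
    obtain ⟨a, ha, b, hb, hv⟩ := hdec v
    have h1 := pol R hR (fun x hx y hy ↦ (hsec x hx y hy).1) x hx y hy z hz a ha
    have h2 := pol _ hR.phiComp (fun x hx y hy ↦ by
      rw [phiComp_apply, B.g_phi_left]
      exact (hsec x hx y hy).2) x hx y hy z hz b hb
    rw [phiComp_apply, B.g_phi_left] at h2
    rw [hv, map_add, map_add, map_smul, h1, h2, hR.skew, hR.xi_right]
    simp
  have hW' : ∀ x ∈ W, ∀ y ∈ W, ∀ z, R x y z = 0 := by
    intro x hx y hy z
    obtain ⟨a, ha, b, hb, hv⟩ := hdec z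
    rw [hv, map_add, map_add, map_smul, hR.xi_right, hR.phi_right, hW x hx y hy a ha,
      hW x hx y hy b hb]
    simp
  have hW'' : ∀ x ∈ W, ∀ y z, R x y z = 0 := by
    intro x hx y z
    obtain ⟨a, ha, b, hb, hv⟩ := hdec y
    rw [hv, map_add, map_add, map_smul, LinearMap.add_apply, LinearMap.add_apply,
      LinearMap.smul_apply, hR.antisymm x B.xi, hR.xi_left, hR.phi_mid, hW' x hx a ha,
      hW' x hx b hb]
    simp
  ext x y z
  obtain ⟨a, ha, b, hb, hv⟩ := hdec x
  rw [hv, map_add, map_add, map_smul, LinearMap.add_apply, LinearMap.add_apply,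
    LinearMap.add_apply, LinearMap.add_apply, LinearMap.smul_apply, LinearMap.smul_apply,
    hR.xi_left, hR.phi_left, hW'' a ha, hW'' b hb]
  simp

/-- A curvature-like map with totally real sectional curvatures `ν` and `ν'`. -/
theorem IsCurvatureLike.eq_model [FiniteDimensional ℝ V] {B : ContactBMetricSpace V}
    {R : V →ₗ[ℝ] V →ₗ[ℝ] V →ₗ[ℝ] V} (hR : B.IsCurvatureLike R) {ν ν' : ℝ}
    (h : ∀ x y, B.eta x = 0 → B.eta y = 0 → B.g x x * B.g y y - B.g x y ^ 2 ≠ 0 →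
      (∀ a ∈ Submodule.span ℝ {x, y}, ∀ b ∈ Submodule.span ℝ {x, y}, B.g (B.phi a) b = 0) →
      B.g (R x y y) x / (B.g x x * B.g y y - B.g x y ^ 2) = ν ∧
        B.g (R x y y) (B.phi x) / (B.g x x * B.g y y - B.g x y ^ 2) = ν') (x y z : V) :
    R x y z = ν • B.modelCurvature x y z - ν' • B.phi (B.modelCurvature x y z) := by
  -- On a totally real plane A(x,y)y = g(y,y)x - g(x,y)y is orthogonal to φx, and φA(x,y)y pairs
  -- with φx to minus the Gram determinant. Hence R - νA + ν'φA has both curvatures zero; the sign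
  -- comes from φ being an anti-isometry on ker η.
  have hT : B.IsCurvatureLike (R + ((-ν) • B.modelCurvature + ν' • B.phiComp B.modelCurvature)) :=
    hR.add ((B.isCurvatureLike_modelCurvature.smul _).add
      (B.isCurvatureLike_modelCurvature.phiComp.smul _))
  have h0 := hT.eq_zero_of_sectional fun x y hx hy hd ht ↦ by
    have hA : B.modelCurvature x y y = B.g y y • x - B.g x y • y := by
      have t1 : B.g y (B.phi y) = 0 := by
        rw [← B.g_phi_left]; exact ht _ (Submodule.subset_span (by simp)) _ (Submodule.subset_span (by simp))
      have t2 : B.g x (B.phi y) = 0 := by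
        rw [← B.g_phi_left]; exact ht _ (Submodule.subset_span (by simp)) _ (Submodule.subset_span (by simp))
      simp [modelCurvature_apply, hor_apply, hx, hy, t1, t2]
    have t3 : B.g x (B.phi x) = 0 := by
      rw [← B.g_phi_left]; exact ht _ (Submodule.subset_span (by simp)) _ (Submodule.subset_span (by simp))
    have t4 : B.g y (B.phi x) = 0 := by
      rw [B.g_symm]; exact ht _ (Submodule.subset_span (by simp)) _ (Submodule.subset_span (by simp))
    obtain ⟨h1, h2⟩ := h x y hx hy hd ht
    rw [div_eq_iff hd] at h1 h2
    simp only [LinearMap.add_apply, LinearMap.smul_apply, phiComp_apply, hA, map_add, map_sub,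
      map_smul, LinearMap.sub_apply, smul_eq_mul, h1, h2, t3, t4, B.g_phi, B.g_phi_left, hx, hy]
    rw [B.g_symm y x]
    constructor <;> ring
  have h1 : (R + ((-ν) • B.modelCurvature + ν' • B.phiComp B.modelCurvature)) x y z = 0 := by
    rw [h0]; rfl
  simp only [LinearMap.add_apply, LinearMap.smul_apply, phiComp_apply] at h1
  rw [← sub_eq_zero, ← h1]
  module

end ContactBMetricSpace

/-! ### The curvature tensor of the ambient manifold. -/

section AmbientCurvature

variable {E : Type*} [NormedAddCommGroup E] [NormedSpace ℝ E] [FiniteDimensional ℝ E]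
  {A : Type*} [TopologicalSpace A] [T2Space A] [ChartedSpace E A] [IsManifold 𝓘(ℝ, E) ∞ A]
  {G : Type*} [NormedAddCommGroup G] [NormedSpace ℝ G]
  {M : Type*} [TopologicalSpace M] [ChartedSpace G M] [IsManifold 𝓘(ℝ, G) ∞ M]
  {f : M → A} {x : M} {V W : Π y : M, TangentSpace 𝓘(ℝ, E) (f y)}
  {X Y : Π y : M, TangentSpace 𝓘(ℝ, G) y}
  {D D' : CovariantDerivative 𝓘(ℝ, E) E (TangentSpace 𝓘(ℝ, E) : A → Type _)}

instance (p : A) : FiniteDimensional ℝ (TangentSpace 𝓘(ℝ, E) p) :=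
  inferInstanceAs (FiniteDimensional ℝ E)

/-- The curvature tensor of a smooth connection at `p`, as a trilinear map. -/
def curvatureTensor (hD : CovariantDerivative.ContMDiffCovariantDerivative D ∞) (p : A) :
    TangentSpace 𝓘(ℝ, E) p →ₗ[ℝ] TangentSpace 𝓘(ℝ, E) p →ₗ[ℝ] TangentSpace 𝓘(ℝ, E) p →ₗ[ℝ]
      TangentSpace 𝓘(ℝ, E) p :=
  LinearMap.mk₂ ℝ (fun a b ↦
    { toFun := fun w ↦ secondCov D p w b a - secondCov D p w a b
      map_add' := fun w w' ↦ by
        simp only [secondCov_add_left hD, add_apply]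
        abel
      map_smul' := fun c w ↦ by
        simp only [secondCov_smul_left hD, smul_apply, RingHom.id_apply, smul_sub] })
    (fun a a' b ↦ by ext w; simp [secondCov_add hD]; abel)
    (fun c a b ↦ by ext w; simp [secondCov_smul hD, smul_sub])
    (fun a b b' ↦ by ext w; simp [secondCov_add hD]; abel)
    (fun c a b ↦ by ext w; simp [secondCov_smul hD, smul_sub])

theorem curvatureTensor_apply (hD : CovariantDerivative.ContMDiffCovariantDerivative D ∞)
    (hT : IsTorsionFree D) (p : A) (a b w : TangentSpace 𝓘(ℝ, E) p) :
    curvatureTensor hD p a b w = curvatureAt (fun Y q v ↦ D Y q v) p a b w :=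
  (curvatureAt_eq hT a b w).symm

/-- When the brackets are written as differences of covariant derivatives, the cyclic sum of
curvatures is the Jacobi sum of the extended fields. -/
theorem curvatureAt_bianchi (hD : CovariantDerivative.ContMDiffCovariantDerivative D ∞)
    (hT : IsTorsionFree D) (p : A) (a b c : TangentSpace 𝓘(ℝ, E) p) :
    curvatureAt (fun Y q v ↦ D Y q v) p a b c + curvatureAt (fun Y q v ↦ D Y q v) p b c a +
      curvatureAt (fun Y q v ↦ D Y q v) p c a b = 0 := by
  have : CompleteSpace E := FiniteDimensional.complete ℝ E
  have ev : ∀ w : TangentSpace 𝓘(ℝ, E) p, ∀ᶠ q in 𝓝 p, CMDiffAt 1 (T% (extend E w)) q := fun w ↦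
    (contMDiffAt_iff_contMDiffAt_nhds (by simp)).1 (smooth_extend w (by simp))
  have key : ∀ a b : TangentSpace 𝓘(ℝ, E) p, ∀ᶠ q in 𝓝 p,
      D (extend E b) q (extend E a q) - D (extend E a) q (extend E b q) =
        mlieBracket 𝓘(ℝ, E) (extend E a) (extend E b) q := fun a b ↦ by
    filter_upwards [ev a, ev b] with q h1 h2
    exact hT _ _ _ (h1.mdifferentiableAt (by simp)) (h2.mdifferentiableAt (by simp))
  have s1 : ∀ a b : TangentSpace 𝓘(ℝ, E) p,
      CMDiffAt 1 (T% (fun q ↦ D (extend E b) q (extend E a q) : Π q : A, TangentSpace 𝓘(ℝ, E) q)) p :=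
    fun a b ↦ (contMDiffAt_cov_extend_extend hD b a).of_le (by simp)
  have key2 : ∀ a b c : TangentSpace 𝓘(ℝ, E) p,
      D (fun q ↦ D (extend E c) q (extend E b q)) p a - D (fun q ↦ D (extend E b) q (extend E c q)) p a
        - D (extend E a) p (mlieBracket 𝓘(ℝ, E) (extend E b) (extend E c) p) =
      mlieBracket 𝓘(ℝ, E) (extend E a) (mlieBracket 𝓘(ℝ, E) (extend E b) (extend E c)) p := by
    intro a b c
    have h1 := ((s1 b c).sub_section (s1 c b))
    have h0 : CMDiffAt 1 (T% (mlieBracket 𝓘(ℝ, E) (extend E b) (extend E c))) p := by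
      refine h1.congr_of_eventuallyEq ?_
      filter_upwards [key b c] with q hq
      simp [← hq]
    have e1 : D (mlieBracket 𝓘(ℝ, E) (extend E b) (extend E c)) p +
        D (fun q ↦ D (extend E b) q (extend E c q)) p = D (fun q ↦ D (extend E c) q (extend E b q)) p := by
      rw [← D.isCovariantDerivativeOnUniv.add (h0.mdifferentiableAt (by simp))
        ((s1 c b).mdifferentiableAt (by simp))]
      refine cov_congr (s1 b c) ?_
      filter_upwards [key b c] with q hq
      simp [← hq]
    rw [← hT _ _ _ ((smooth_extend (k := 1) a (by simp)).mdifferentiableAt (by simp))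
      (h0.mdifferentiableAt (by simp)), ← e1]
    simp
  have hM : IsManifold 𝓘(ℝ, E) (minSmoothness ℝ 3) A :=
    IsManifold.of_le (n := ∞) (by simpa using natCast_le_infty 3)
  have s2 : ∀ a : TangentSpace 𝓘(ℝ, E) p, CMDiffAt (minSmoothness ℝ 2) (T% (extend E a)) p :=
    fun a ↦ (smooth_extend a le_rfl).of_le (by simpa using natCast_le_infty 2)
  have J := leibniz_identity_mlieBracket_apply (s2 a) (s2 b) (s2 c)
  rw [mlieBracket_swap_apply (W := extend E c) (V := mlieBracket 𝓘(ℝ, E) (extend E a) (extend E b)),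
    ← key2, ← key2, ← key2, mlieBracket_swap_apply (V := extend E a) (W := extend E c),
    map_neg] at J
  simp only [curvatureAt, curvature, extend_apply_self]
  rw [← sub_eq_zero] at J
  rw [← J]
  abel

namespace AlmostContactBMetric

variable (S : AlmostContactBMetric E A)

/-- The structure on the tangent space at `p`. -/
def pt (p : A) : ContactBMetricSpace (TangentSpace 𝓘(ℝ, E) p) where
  phi := S.phi p
  xi := S.xi p
  eta := S.eta p
  g := ContinuousLinearMap.coeLM ℝ ∘ₗ (S.g p : TangentSpace 𝓘(ℝ, E) p →ₗ[ℝ] _)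
  g_symm := S.g_symm p
  g_nondegenerate := S.g_nondegenerate p
  phi_sq := S.phi_sq p
  eta_xi := S.eta_xi p
  g_phi := S.g_phi p

theorem phi_xi (p : A) : S.phi p (S.xi p) = 0 := (S.pt p).phi_xi

theorem eta_phi (p : A) (v : TangentSpace 𝓘(ℝ, E) p) : S.eta p (S.phi p v) = 0 := (S.pt p).eta_phi v

theorem g_xi (p : A) (v : TangentSpace 𝓘(ℝ, E) p) : S.g p v (S.xi p) = S.eta p v := (S.pt p).g_xi v

theorem g_xi' (p : A) (v : TangentSpace 𝓘(ℝ, E) p) : S.g p (S.xi p) v = S.eta p v := (S.pt p).g_xi' v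

theorem g_phi_left (p : A) (v w : TangentSpace 𝓘(ℝ, E) p) :
    S.g p (S.phi p v) w = S.g p v (S.phi p w) := (S.pt p).g_phi_left v w

/-- `ξ` is parallel along `f`. -/
theorem xi_along (hD : IsLeviCivita (fun p x y ↦ S.g p x y) D) (hF0 : S.IsF0 D)
    (hf : ContMDiffAt 𝓘(ℝ, G) 𝓘(ℝ, E) 1 f x) (v : TangentSpace 𝓘(ℝ, G) x) :
    covAlong f D (fun y ↦ S.xi (f y)) x v = 0 := by
  have hs := S.smoothAlong_xi (k := 1) (by simp) hf
  have h1 := S.phi_along hF0 hs v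
  have h2 := S.metric_along hD hs hs v
  simp only [S.phi_xi] at h1
  have h0 : covAlong f D (fun y ↦ (0 : TangentSpace 𝓘(ℝ, E) (f y))) x v = 0 := by
    simpa using covAlong_const_smul (D := D) 0 hs v
  rw [h0] at h1
  simp only [S.g_xi, S.g_xi', S.eta_xi, mvfderiv_const, zero_apply] at h2
  have h3 := S.phi_sq (f x) (covAlong f D (fun y ↦ S.xi (f y)) x v)
  rw [← h1, show S.eta (f x) (covAlong f D (fun y ↦ S.xi (f y)) x v) = 0 by linarith] at h3
  simpa using h3.symm

/-- `η` is parallel along `f`. -/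
theorem eta_along (hD : IsLeviCivita (fun p x y ↦ S.g p x y) D) (hF0 : S.IsF0 D)
    (hV : SmoothAlong G 1 f V x) (v : TangentSpace 𝓘(ℝ, G) x) :
    mvfderiv 𝓘(ℝ, G) (fun y ↦ S.eta (f y) (V y)) x v = S.eta (f x) (covAlong f D V x v) := by
  have := S.metric_along hD hV (S.smoothAlong_xi (k := 1) (by simp) hV.base) v
  rw [S.xi_along hD hF0 hV.base, map_zero, add_zero] at this
  simpa only [S.g_xi] using this

/-- Differentiate the function g(V,W) twice and antisymmetrise: XY - YX - [X,Y] annihilates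
functions, and the products of first derivatives cancel. -/
theorem curvature_skew_along [CompleteSpace G] (hD : IsLeviCivita (fun p x y ↦ S.g p x y) D)
    (hV : SmoothAlong G ∞ f V x) (hW : SmoothAlong G ∞ f W x)
    (hX : CMDiffAt ∞ (T% X) x) (hY : CMDiffAt ∞ (T% Y) x) :
    S.g (f x) (curvatureAt (fun Y q v ↦ D Y q v) (f x) (mfderiv 𝓘(ℝ, G) 𝓘(ℝ, E) f x (X x))
      (mfderiv 𝓘(ℝ, G) 𝓘(ℝ, E) f x (Y x)) (V x)) (W x) =
    - S.g (f x) (curvatureAt (fun Y q v ↦ D Y q v) (f x) (mfderiv 𝓘(ℝ, G) 𝓘(ℝ, E) f x (X x))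
      (mfderiv 𝓘(ℝ, G) 𝓘(ℝ, E) f x (Y x)) (W x)) (V x) := by
  have hs := hD.smooth
  have second : ∀ {Z : Π y : M, TangentSpace 𝓘(ℝ, G) y}, CMDiffAt ∞ (T% Z) x →
      ∀ v : TangentSpace 𝓘(ℝ, G) x,
      mvfderiv 𝓘(ℝ, G) (fun y ↦ mvfderiv 𝓘(ℝ, G) (fun y ↦ S.g (f y) (V y) (W y)) y (Z y)) x v =
      S.g (f x) (covAlong f D (fun y ↦ covAlong f D V y (Z y)) x v) (W x) +
        S.g (f x) (covAlong f D V x (Z x)) (covAlong f D W x v) +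
      (S.g (f x) (covAlong f D V x v) (covAlong f D W x (Z x)) +
        S.g (f x) (V x) (covAlong f D (fun y ↦ covAlong f D W y (Z y)) x v)) := by
    intro Z hZ v
    have s1 := (SmoothAlong.covAlong hs hV hZ).of_le (m := 1) (by simp)
    have s2 := (SmoothAlong.covAlong hs hW hZ).of_le (m := 1) (by simp)
    have hV1 := hV.of_le (m := 1) (by simp)
    have hW1 := hW.of_le (m := 1) (by simp)
    have ev : ∀ᶠ y in 𝓝 x, mvfderiv 𝓘(ℝ, G) (fun y ↦ S.g (f y) (V y) (W y)) y (Z y) =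
        S.g (f y) (covAlong f D V y (Z y)) (W y) + S.g (f y) (V y) (covAlong f D W y (Z y)) := by
      filter_upwards [hV.eventually, hW.eventually] with y h1 h2
      exact S.metric_along hD h1 h2 _
    rw [mvfderiv_congr ev, mvfderiv_fun_add
      ((S.contMDiffAt_g (by simp) s1 hW1).mdifferentiableAt (by simp))
      ((S.contMDiffAt_g (by simp) hV1 s2).mdifferentiableAt (by simp)), add_apply,
      S.metric_along hD s1 hW1, S.metric_along hD hV1 s2]
  have L := mvfderiv_mlieBracket (S.contMDiffAt_g le_rfl hV hW) hX hY
  rw [second hX, second hY, S.metric_along hD (hV.of_le (by simp)) (hW.of_le (by simp))] at L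
  rw [← curvature_along hs hD.torsion_free hV hX hY, ← curvature_along hs hD.torsion_free hW hX hY]
  rw [S.g_symm _ _ (V x)]
  simp only [map_sub, sub_apply]
  linarith

theorem curvature_phi_along [CompleteSpace G] (hD : IsLeviCivita (fun p x y ↦ S.g p x y) D)
    (hF0 : S.IsF0 D) (hV : SmoothAlong G ∞ f V x)
    (hX : CMDiffAt ∞ (T% X) x) (hY : CMDiffAt ∞ (T% Y) x) :
    curvatureAt (fun Y q v ↦ D Y q v) (f x) (mfderiv 𝓘(ℝ, G) 𝓘(ℝ, E) f x (X x))
      (mfderiv 𝓘(ℝ, G) 𝓘(ℝ, E) f x (Y x)) (S.phi (f x) (V x)) =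
    S.phi (f x) (curvatureAt (fun Y q v ↦ D Y q v) (f x) (mfderiv 𝓘(ℝ, G) 𝓘(ℝ, E) f x (X x))
      (mfderiv 𝓘(ℝ, G) 𝓘(ℝ, E) f x (Y x)) (V x)) := by
  have hs := hD.smooth
  have second : ∀ {Z : Π y : M, TangentSpace 𝓘(ℝ, G) y}, CMDiffAt ∞ (T% Z) x →
      ∀ v : TangentSpace 𝓘(ℝ, G) x,
      covAlong f D (fun y ↦ covAlong f D (fun y ↦ S.phi (f y) (V y)) y (Z y)) x v =
      S.phi (f x) (covAlong f D (fun y ↦ covAlong f D V y (Z y)) x v) := by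
    intro Z hZ v
    rw [← S.phi_along hF0 ((SmoothAlong.covAlong hs hV hZ).of_le (by simp))]
    refine covAlong_congr ?_ v
    filter_upwards [hV.eventually] with y h1
    exact S.phi_along hF0 h1 _
  rw [← curvature_along hs hD.torsion_free hV hX hY,
    ← curvature_along hs hD.torsion_free (S.smoothAlong_phi le_rfl hV) hX hY, second hX, second hY,
    S.phi_along hF0 (hV.of_le (by simp)), map_sub, map_sub]

theorem isCurvatureLike (hD : IsLeviCivita (fun p x y ↦ S.g p x y) D) (hF0 : S.IsF0 D) (p : A) :
    (S.pt p).IsCurvatureLike (curvatureTensor hD.smooth p) where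
  antisymm x y z := by
    change secondCov D p z y x - secondCov D p z x y = -(secondCov D p z x y - secondCov D p z y x)
    abel
  bianchi x y z := by
    simp only [curvatureTensor_apply hD.smooth hD.torsion_free]
    exact curvatureAt_bianchi hD.smooth hD.torsion_free p x y z
  skew x y z w := by
    have : CompleteSpace E := FiniteDimensional.complete ℝ E
    simp only [curvatureTensor_apply hD.smooth hD.torsion_free]
    have := S.curvature_skew_along (f := (id : A → A)) hD (smooth_extend z le_rfl)
      (smooth_extend w le_rfl) (smooth_extend x le_rfl) (smooth_extend y le_rfl)
    simp only [mfderiv_id, id, extend_apply_self] at this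
    exact this
  phi_right x y z := by
    have : CompleteSpace E := FiniteDimensional.complete ℝ E
    simp only [curvatureTensor_apply hD.smooth hD.torsion_free]
    have := S.curvature_phi_along (f := (id : A → A)) hD hF0 (smooth_extend z le_rfl)
      (smooth_extend x le_rfl) (smooth_extend y le_rfl)
    simp only [mfderiv_id, id, extend_apply_self] at this
    exact this

/-- The associated metric is built from parallel tensors, so it is parallel for D as well, and
nondegenerate. The difference of two torsion-free connections compatible with it is symmetric and
skew, hence zero by Koszul's cyclic argument. -/
theorem cov_extend_eq (hD : IsLeviCivita (fun p x y ↦ S.g p x y) D) (hD' : IsLeviCivita S.assoc D')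
    (hF0 : S.IsF0 D) {p : A} (u : TangentSpace 𝓘(ℝ, E) p) :
    D (extend E u) p = D' (extend E u) p := by
  have sm : ∀ u : TangentSpace 𝓘(ℝ, E) p, SmoothAlong E 1 (id : A → A) (extend E u : Π q : A, TangentSpace 𝓘(ℝ, E) q) p :=
    fun u ↦ smooth_extend u (by simp)
  have md : ∀ u : TangentSpace 𝓘(ℝ, E) p, MDiffAt (T% (extend E u)) p :=
    fun u ↦ (sm u).mdifferentiableAt (by simp)
  have cov : ∀ u v : TangentSpace 𝓘(ℝ, E) p, covAlong (id : A → A) D (extend E u : Π q : A, TangentSpace 𝓘(ℝ, E) q) p v = D (extend E u) p v :=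
    fun u v ↦ by
      have := covAlong_comp (f := (id : A → A)) (x := p) (D := D) (sm u) contMDiffAt_id v
      simpa using this
  have met : ∀ u w v : TangentSpace 𝓘(ℝ, E) p,
      mvfderiv 𝓘(ℝ, E) (fun q ↦ S.assoc q (extend E u q) (extend E w q)) p v =
      S.assoc p (D (extend E u) p v) w + S.assoc p u (D (extend E w) p v) := fun u w v ↦ by
    have m1 := S.metric_along hD (sm u) (S.smoothAlong_phi (by simp) (sm w)) v
    have m2 := S.eta_along hD hF0 (sm u) v
    have m3 := S.eta_along hD hF0 (sm w) v
    rw [S.phi_along hF0 (sm w)] at m1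
    simp only [cov, id, extend_apply_self] at m1 m2 m3
    have d1 : MDiffAt (fun q ↦ S.g q (extend E u q) (S.phi q (extend E w q))) p :=
      (S.contMDiffAt_g (f := (id : A → A)) (k := 1) (by simp) (sm u)
        (S.smoothAlong_phi (by simp) (sm w))).mdifferentiableAt (by simp)
    have d2 : ∀ u : TangentSpace 𝓘(ℝ, E) p, MDiffAt (fun q ↦ S.eta q (extend E u q)) p := fun u ↦
      (S.contMDiffAt_eta (f := (id : A → A)) (k := 1) (by simp) (sm u)).mdifferentiableAt (by simp)
    have d3 : MDiffAt (fun q ↦ S.eta q (extend E u q) * S.eta q (extend E w q)) p := (d2 u).mul (d2 w)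
    simp only [assoc]
    rw [mvfderiv_fun_add d1 d3, add_apply, m1, mvfderiv_fun_mul (d2 u) (d2 w)]
    simp [m2, m3]
    ring
  have d1 : ∀ u v w : TangentSpace 𝓘(ℝ, E) p,
      S.assoc p (D (extend E u) p v - D' (extend E u) p v) w +
      S.assoc p u (D (extend E w) p v - D' (extend E w) p v) = 0 := fun u v w ↦ by
    have h1 := met u w v
    rw [hD'.metric _ _ _ _ (md u) (md w)] at h1
    simp only [assoc, extend_apply_self, map_sub, sub_apply] at h1 ⊢
    linarith
  have d2 : ∀ u v : TangentSpace 𝓘(ℝ, E) p, D (extend E u) p v - D' (extend E u) p v =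
      D (extend E v) p u - D' (extend E v) p u := fun u v ↦ by
    have h1 := hD.torsion_free _ _ _ (md u) (md v)
    rw [← hD'.torsion_free _ _ _ (md u) (md v)] at h1
    simp only [extend_apply_self] at h1
    rw [← sub_eq_zero] at h1 ⊢
    rw [← neg_zero, ← h1]
    abel
  have symm : ∀ a b : TangentSpace 𝓘(ℝ, E) p, S.assoc p a b = S.assoc p b a := fun a b ↦ by
    simp only [assoc]
    rw [← S.g_phi_left, S.g_symm, mul_comm]
  have nondeg : ∀ a : TangentSpace 𝓘(ℝ, E) p, (∀ b, S.assoc p a b = 0) → a = 0 := fun a ha ↦ by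
    have h1 : S.eta p a = 0 := by simpa [assoc, S.phi_xi, S.eta_xi] using ha (S.xi p)
    have h2 : S.phi p a = 0 := S.g_nondegenerate _ _ fun b ↦ by
      rw [S.g_phi_left]
      simpa [assoc, h1] using ha b
    simpa [h1, h2] using (S.phi_sq p a).symm
  ext v
  refine sub_eq_zero.1 (nondeg _ fun w ↦ ?_)
  have e1 := d1 u v w
  have e2 := d1 v w u
  have e3 := d1 w u v
  rw [symm u, d2 w v] at e1
  rw [symm v, d2 u w] at e2
  rw [symm w, d2 v u] at e3
  linarith

theorem curvatureAt_assoc (hD : IsLeviCivita (fun p x y ↦ S.g p x y) D) (hD' : IsLeviCivita S.assoc D')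
    (hF0 : S.IsF0 D) (p : A) (a b c : TangentSpace 𝓘(ℝ, E) p) :
    curvatureAt (fun Y q v ↦ D' Y q v) p a b c = curvatureAt (fun Y q v ↦ D Y q v) p a b c := by
  have key : ∀ {Y : Π q : A, TangentSpace 𝓘(ℝ, E) q} {q : A}, CMDiffAt 1 (T% Y) q → D' Y q = D Y q := by
    intro Y q hY
    ext v
    have h1 := covAlong_comp (f := (id : A → A)) (x := q) (D := D) hY contMDiffAt_id v
    have h2 := covAlong_comp (f := (id : A → A)) (x := q) (D := D') hY contMDiffAt_id v
    -- `covAlong` involves the connection only through chart-constant fields, so agreement on those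
    -- implies agreement on all C¹ fields.
    simp only [covAlong, S.cov_extend_eq hD hD' hF0] at h1 h2
    simpa using h2.symm.trans h1
  have sec : ∀ c b : TangentSpace 𝓘(ℝ, E) p, secondCov D' p c b = secondCov D p c b := fun c b ↦ by
    have h1 := (contMDiffAt_cov_extend_extend hD.smooth c b).of_le (m := 1) (by simp)
    have h2 : D' (fun q ↦ D' (extend E c) q (extend E b q)) p =
        D (fun q ↦ D (extend E c) q (extend E b q)) p := by
      rw [← key h1]
      refine cov_congr h1 ?_
      filter_upwards [(contMDiffAt_iff_contMDiffAt_nhds (n := 1) (by simp)).1 (smooth_extend c (by simp))]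
        with q hq
      rw [key hq]
    simp only [secondCov, h2, S.cov_extend_eq hD hD' hF0]
  rw [curvatureAt_eq hD.torsion_free, curvatureAt_eq hD'.torsion_free, sec, sec]

/-- The curvature tensor of an `F₀`-manifold with pointwise constant totally real sectional
curvatures. -/
theorem curvatureAt_eq_model (hD : IsLeviCivita (fun p x y ↦ S.g p x y) D)
    (hD' : IsLeviCivita S.assoc D') (hF0 : S.IsF0 D) {ν ν' : A → ℝ}
    (hν : S.HasTotallyRealSectionalCurvatures D D' ν ν') (p : A) (x y z : TangentSpace 𝓘(ℝ, E) p) :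
    curvatureAt (fun Y q v ↦ D Y q v) p x y z =
      ν p • (S.pt p).modelCurvature x y z - ν' p • S.phi p ((S.pt p).modelCurvature x y z) := by
  rw [← curvatureTensor_apply hD.smooth hD.torsion_free]
  refine (S.isCurvatureLike hD hF0 p).eq_model (fun x y hx hy hd ht ↦ ?_) x y z
  obtain ⟨h1, h2⟩ := hν p x y ⟨hd, ht, (S.g_xi p x).trans hx, (S.g_xi p y).trans hy⟩
  rw [S.curvatureAt_assoc hD hD' hF0] at h2
  simp only [curvatureTensor_apply hD.smooth hD.torsion_free]
  refine ⟨h1, ?_⟩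
  rw [← h2]
  congr 1
  -- With η(x) = 0 the associated metric paired with x is g(·,φx), the form of the second curvature
  -- expected by `eq_model`.
  have hx' : S.eta p x = 0 := hx
  rw [assoc, hx', mul_zero, add_zero]
  rfl

end AlmostContactBMetric

end AmbientCurvature

/-! ### The normalised radical frame ζ, φ̄ζ, N₀ and the projection to TM. -/

section Frame

variable {E : Type*} [NormedAddCommGroup E] [NormedSpace ℝ E] [FiniteDimensional ℝ E]
  {A : Type*} [TopologicalSpace A] [T2Space A] [ChartedSpace E A] [IsManifold 𝓘(ℝ, E) ∞ A]
  {G : Type*} [NormedAddCommGroup G] [NormedSpace ℝ G] [FiniteDimensional ℝ G]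
  {M : Type*} [TopologicalSpace M] [ChartedSpace G M] [IsManifold 𝓘(ℝ, G) ∞ M]
  {S : AlmostContactBMetric E A}
  {D : CovariantDerivative 𝓘(ℝ, E) E (TangentSpace 𝓘(ℝ, E) : A → Type _)}

/-- The lightlike transversal vector `ξ̄ - ζ / 2` of a radical vector `ζ` with `η̄(ζ) = 1`. -/
def nullVec (H : HalfLightlike G M S.g) (ζ : Π x : M, TangentSpace 𝓘(ℝ, G) x) (x : M) :
    TangentSpace 𝓘(ℝ, E) (H.f x) :=
  S.xi (H.f x) - (1 / 2 : ℝ) • H.df x (ζ x)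

/-- The image under `φ` of the radical field `ζ`. -/
def phiRad (H : HalfLightlike G M S.g) (ζ : Π x : M, TangentSpace 𝓘(ℝ, G) x) (x : M) :
    TangentSpace 𝓘(ℝ, E) (H.f x) :=
  S.phi (H.f x) (H.df x (ζ x))

/-- The radical field `ζ` normalised by `η̄(ζ) = 1` of a screen totally umbilical ascreen radical
screen transversal submanifold, together with its umbilicity function `F`. -/
structure UmbilicalFrame (H : HalfLightlike G M S.g)
    (D : CovariantDerivative 𝓘(ℝ, E) E (TangentSpace 𝓘(ℝ, E) : A → Type _))
    (ζ : Π x : M, TangentSpace 𝓘(ℝ, G) x) (F : M → ℝ) : Prop where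
  mem_rad : ∀ x, ζ x ∈ H.rad x
  eta_zeta : ∀ x, etaBar H x (ζ x) = 1
  smooth : ∀ x, CMDiffAt ∞ (T% ζ) x
  eta_screen : ∀ x, ∀ s ∈ H.screen x, etaBar H x s = 0
  screenTrans_eq : ∀ x, H.screenTrans x = Submodule.span ℝ {phiRad H ζ x}
  ltr_eq : ∀ x, H.ltr x = Submodule.span ℝ {nullVec H ζ x}
  smooth_fun : ∀ x, ContMDiffAt 𝓘(ℝ, G) 𝓘(ℝ, ℝ) ∞ F x
  umbilical : ∀ x (v : TangentSpace 𝓘(ℝ, G) x) (Y : Π x : M, TangentSpace 𝓘(ℝ, G) x),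
    CMDiffAt ∞ (T% Y) x →
      S.g (H.f x) (H.df x (H.nabla D (fun y ↦ H.P y (Y y)) x v)) (nullVec H ζ x) =
        F x * H.gM x v (Y x)

instance (x : M) : FiniteDimensional ℝ (TangentSpace 𝓘(ℝ, G) x) :=
  inferInstanceAs (FiniteDimensional ℝ G)

theorem eq_etaBar_smul {H : HalfLightlike G M S.g} {x : M} {z v : TangentSpace 𝓘(ℝ, G) x}
    (hz : z ∈ H.rad x) (hz1 : etaBar H x z = 1) (hv : v ∈ H.rad x) : v = etaBar H x v • z := by
  have hne : (⟨z, hz⟩ : H.rad x) ≠ 0 := fun h ↦ by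
    have h0 : z = 0 := congrArg Subtype.val h
    simp [h0, etaBar] at hz1
  obtain ⟨c, hc⟩ := (finrank_eq_one_iff_of_nonzero' _ hne).1 (H.rank_radical x) ⟨v, hv⟩
  have hc' : c • z = v := congrArg Subtype.val hc
  have : etaBar H x v = c := by
    rw [etaBar] at hz1
    rw [← hc', etaBar, map_smul, map_smul, hz1, smul_eq_mul, mul_one]
  rw [this, hc']

namespace UmbilicalFrame

variable {H : HalfLightlike G M S.g} {ζ : Π x : M, TangentSpace 𝓘(ℝ, G) x} {F : M → ℝ}
  {x : M} {X Y W : Π y : M, TangentSpace 𝓘(ℝ, G) y}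

theorem g_zeta (K : UmbilicalFrame H D ζ F) (x : M) (v : TangentSpace 𝓘(ℝ, G) x) :
    S.g (H.f x) (H.df x (ζ x)) (H.df x v) = 0 := K.mem_rad x v

theorem g_zeta' (K : UmbilicalFrame H D ζ F) (x : M) (v : TangentSpace 𝓘(ℝ, G) x) :
    S.g (H.f x) (H.df x v) (H.df x (ζ x)) = 0 := by rw [S.g_symm, K.g_zeta]

theorem g_phiRad (K : UmbilicalFrame H D ζ F) (x : M) (v : TangentSpace 𝓘(ℝ, G) x) :
    S.g (H.f x) (phiRad H ζ x) (H.df x v) = 0 := by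
  have h1 : phiRad H ζ x ∈ H.screenTrans x := by
    rw [K.screenTrans_eq]; exact Submodule.mem_span_singleton_self _
  have h2 : phiRad H ζ x ∈ normalSpace (G := G) S.g H.f x := by
    rw [← H.normal_eq]; exact Submodule.mem_sup_right h1
  exact h2 v

theorem g_phiRad' (K : UmbilicalFrame H D ζ F) (x : M) (v : TangentSpace 𝓘(ℝ, G) x) :
    S.g (H.f x) (H.df x v) (phiRad H ζ x) = 0 := by rw [S.g_symm, K.g_phiRad]

theorem eta_zeta' (K : UmbilicalFrame H D ζ F) (x : M) : S.eta (H.f x) (H.df x (ζ x)) = 1 :=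
  K.eta_zeta x

theorem g_phiRad_phiRad (K : UmbilicalFrame H D ζ F) (x : M) :
    S.g (H.f x) (phiRad H ζ x) (phiRad H ζ x) = 1 := by
  rw [phiRad, S.g_phi, K.g_zeta, K.eta_zeta']; norm_num

theorem g_nullVec (K : UmbilicalFrame H D ζ F) (x : M) (v : TangentSpace 𝓘(ℝ, G) x) :
    S.g (H.f x) (H.df x v) (nullVec H ζ x) = etaBar H x v := by
  rw [nullVec, map_sub, map_smul, K.g_zeta', S.g_xi, etaBar]; simp

theorem g_nullVec' (K : UmbilicalFrame H D ζ F) (x : M) (v : TangentSpace 𝓘(ℝ, G) x) :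
    S.g (H.f x) (nullVec H ζ x) (H.df x v) = etaBar H x v := by
  rw [S.g_symm, K.g_nullVec]

theorem eta_nullVec (K : UmbilicalFrame H D ζ F) (x : M) :
    S.eta (H.f x) (nullVec H ζ x) = 1 / 2 := by
  rw [nullVec, map_sub, map_smul, K.eta_zeta', S.eta_xi]; norm_num

theorem g_nullVec_nullVec (K : UmbilicalFrame H D ζ F) (x : M) :
    S.g (H.f x) (nullVec H ζ x) (nullVec H ζ x) = 0 := by
  conv_lhs => arg 2; rw [nullVec]
  rw [map_sub, map_smul, K.g_nullVec', S.g_xi, K.eta_nullVec, K.eta_zeta]; norm_num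

theorem g_phiRad_nullVec (K : UmbilicalFrame H D ζ F) (x : M) :
    S.g (H.f x) (phiRad H ζ x) (nullVec H ζ x) = 0 := by
  rw [nullVec, map_sub, map_smul, K.g_phiRad, S.g_xi, phiRad, S.eta_phi]; simp

theorem g_nullVec_phiRad (K : UmbilicalFrame H D ζ F) (x : M) :
    S.g (H.f x) (nullVec H ζ x) (phiRad H ζ x) = 0 := by rw [S.g_symm, K.g_phiRad_nullVec]

theorem phi_nullVec (x : M) :
    S.phi (H.f x) (nullVec H ζ x) = -(1 / 2 : ℝ) • phiRad H ζ x := by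
  rw [nullVec, map_sub, map_smul, S.phi_xi, phiRad]; module

theorem rad_eq (K : UmbilicalFrame H D ζ F) {v : TangentSpace 𝓘(ℝ, G) x} (hv : v ∈ H.rad x) :
    v = etaBar H x v • ζ x := eq_etaBar_smul (K.mem_rad x) (K.eta_zeta x) hv

theorem P_eq (K : UmbilicalFrame H D ζ F) (x : M) (v : TangentSpace 𝓘(ℝ, G) x) :
    H.P x v = v - etaBar H x v • ζ x := by
  have h1 : v - H.P x v ∈ H.rad x := Submodule.sub_projection_mem (H.screen_isCompl x) v
  have h2 : H.P x v ∈ H.screen x := Submodule.projection_apply_mem (H.screen_isCompl x) v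
  have h3 := K.rad_eq h1
  have h4 : etaBar H x (v - H.P x v) = etaBar H x v := by
    have := K.eta_screen x _ h2
    rw [etaBar] at this ⊢
    rw [map_sub, map_sub, this, sub_zero, etaBar]
  rw [h4] at h3
  rw [← h3, sub_sub_cancel]

/-- Pairing with ζ detects the coefficient of N₀ and pairing with φ̄ζ that of φ̄ζ, so the sum map is
injective; codimension two makes it surjective. -/
theorem exists_decomposition (K : UmbilicalFrame H D ζ F) (w : TangentSpace 𝓘(ℝ, E) (H.f x)) :
    ∃ (t : TangentSpace 𝓘(ℝ, G) x) (b c : ℝ),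
      w = H.df x t + b • phiRad H ζ x + c • nullVec H ζ x := by
  let L : TangentSpace 𝓘(ℝ, G) x × (ℝ × ℝ) →ₗ[ℝ] TangentSpace 𝓘(ℝ, E) (H.f x) :=
    LinearMap.coprod (H.df x).toLinearMap (LinearMap.coprod
      (LinearMap.toSpanSingleton ℝ _ (phiRad H ζ x)) (LinearMap.toSpanSingleton ℝ _ (nullVec H ζ x)))
  have hL : ∀ t b c, L (t, (b, c)) = H.df x t + b • phiRad H ζ x + c • nullVec H ζ x :=
    fun t b c ↦ by simp [L, add_assoc]
  have inj : Function.Injective L := by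
    refine (injective_iff_map_eq_zero L).2 ?_
    rintro ⟨t, b, c⟩ h
    rw [hL] at h
    have h1 := congrArg (fun w ↦ S.g (H.f x) w (H.df x (ζ x))) h
    have h2 := congrArg (fun w ↦ S.g (H.f x) w (phiRad H ζ x)) h
    simp [K.g_zeta', K.g_phiRad, K.g_nullVec', K.eta_zeta] at h1
    simp [K.g_phiRad', K.g_phiRad_phiRad, K.g_nullVec_phiRad] at h2
    rw [h1, h2, zero_smul, zero_smul, add_zero, add_zero] at h
    have h3 : t = 0 := H.immersion x (h.trans (map_zero _).symm)
    rw [h1, h2, h3]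
    rfl
  have hfr : Module.finrank ℝ (TangentSpace 𝓘(ℝ, G) x × (ℝ × ℝ)) =
      Module.finrank ℝ (TangentSpace 𝓘(ℝ, E) (H.f x)) := by
    rw [Module.finrank_prod, Module.finrank_prod, Module.finrank_self]
    exact H.codim
  obtain ⟨⟨t, b, c⟩, h⟩ := (LinearMap.injective_iff_surjective_of_finrank_eq_finrank hfr).1 inj w
  exact ⟨t, b, c, by rw [← hL, h]⟩

theorem eq_zero_of_g (K : UmbilicalFrame H D ζ F) {w : TangentSpace 𝓘(ℝ, E) (H.f x)}
    (h1 : ∀ v, S.g (H.f x) w (H.df x v) = 0) (h2 : S.g (H.f x) w (phiRad H ζ x) = 0)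
    (h3 : S.g (H.f x) w (nullVec H ζ x) = 0) : w = 0 :=
  S.g_nondegenerate _ _ fun u ↦ by
    obtain ⟨t, b, c, rfl⟩ := K.exists_decomposition u
    simp [h1, h2, h3]

/-- The projection onto the image of `T_x M` along the transversal bundle. -/
def tang (H : HalfLightlike G M S.g) (ζ : Π x : M, TangentSpace 𝓘(ℝ, G) x) (x : M) :
    TangentSpace 𝓘(ℝ, E) (H.f x) →ₗ[ℝ] TangentSpace 𝓘(ℝ, E) (H.f x) where
  toFun w := w - S.g (H.f x) w (phiRad H ζ x) • phiRad H ζ x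
    - S.g (H.f x) w (H.df x (ζ x)) • nullVec H ζ x
  map_add' w w' := by simp only [map_add, add_apply]; module
  map_smul' c w := by
    simp only [map_smul, smul_apply, RingHom.id_apply, smul_eq_mul]; module

theorem tang_apply (w : TangentSpace 𝓘(ℝ, E) (H.f x)) :
    tang H ζ x w = w - S.g (H.f x) w (phiRad H ζ x) • phiRad H ζ x
      - S.g (H.f x) w (H.df x (ζ x)) • nullVec H ζ x := rfl

theorem tang_df (K : UmbilicalFrame H D ζ F) (t : TangentSpace 𝓘(ℝ, G) x) :
    tang H ζ x (H.df x t) = H.df x t := by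
  rw [tang_apply, K.g_phiRad', K.g_zeta']; simp

theorem tang_phiRad (K : UmbilicalFrame H D ζ F) : tang H ζ x (phiRad H ζ x) = 0 := by
  rw [tang_apply, K.g_phiRad_phiRad, K.g_phiRad]; simp

theorem tang_nullVec (K : UmbilicalFrame H D ζ F) : tang H ζ x (nullVec H ζ x) = 0 := by
  rw [tang_apply, K.g_nullVec_phiRad, K.g_nullVec', K.eta_zeta]; simp

theorem tang_xi (K : UmbilicalFrame H D ζ F) :
    tang H ζ x (S.xi (H.f x)) = (1 / 2 : ℝ) • H.df x (ζ x) := by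
  have : S.xi (H.f x) = nullVec H ζ x + (1 / 2 : ℝ) • H.df x (ζ x) := by rw [nullVec]; module
  rw [this, map_add, map_smul, K.tang_nullVec, K.tang_df, zero_add]

/-- The decomposition above ensures that the choice in `tangentialPart` meets its condition, and
`tang` kills the transversal bundle. The chosen vector is thus given by a linear formula. -/
theorem df_tangentialPart (K : UmbilicalFrame H D ζ F) (w : TangentSpace 𝓘(ℝ, E) (H.f x)) :
    H.df x (H.tangentialPart x w) = tang H ζ x w := by
  have hex : ∃ v, w - H.df x v ∈ H.tr x := by
    obtain ⟨t, b, c, hw⟩ := K.exists_decomposition w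
    refine ⟨t, ?_⟩
    rw [HalfLightlike.tr, K.screenTrans_eq, K.ltr_eq,
      show w - H.df x t = b • phiRad H ζ x + c • nullVec H ζ x by rw [hw]; abel]
    exact Submodule.add_mem_sup (Submodule.smul_mem _ _ (Submodule.mem_span_singleton_self _))
      (Submodule.smul_mem _ _ (Submodule.mem_span_singleton_self _))
  have h := Classical.epsilon_spec hex
  change w - H.df x (H.tangentialPart x w) ∈ H.tr x at h
  rw [HalfLightlike.tr, K.screenTrans_eq, K.ltr_eq, Submodule.mem_sup] at h
  obtain ⟨y, hy, z, hz, h⟩ := h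
  obtain ⟨b, rfl⟩ := Submodule.mem_span_singleton.1 hy
  obtain ⟨c, rfl⟩ := Submodule.mem_span_singleton.1 hz
  have h2 := congrArg (tang H ζ x) h
  rw [map_add, map_smul, map_smul, K.tang_phiRad, K.tang_nullVec, map_sub, K.tang_df, smul_zero,
    smul_zero, add_zero] at h2
  exact (sub_eq_zero.1 h2.symm).symm

theorem df_nabla (K : UmbilicalFrame H D ζ F) (Y : Π y : M, TangentSpace 𝓘(ℝ, G) y)
    (v : TangentSpace 𝓘(ℝ, G) x) :
    H.df x (H.nabla D Y x v) = tang H ζ x (covAlong H.f D (fun y ↦ H.df y (Y y)) x v) :=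
  K.df_tangentialPart _

/-! #### Smoothness -/

theorem smoothAlong_df {k : ℕ∞ω} (hY : CMDiffAt k (T% Y) x) (hk : k + 1 ≤ ∞) :
    SmoothAlong G k H.f (fun y ↦ H.df y (Y y)) x :=
  smoothAlong_mfderiv (H.smooth x) hY hk le_rfl

theorem smoothAlong_zeta (K : UmbilicalFrame H D ζ F) (x : M) :
    SmoothAlong G ∞ H.f (fun y ↦ H.df y (ζ y)) x := smoothAlong_df (K.smooth x) (by simp)

theorem smoothAlong_phiRad (K : UmbilicalFrame H D ζ F) (x : M) :
    SmoothAlong G ∞ H.f (phiRad H ζ) x := S.smoothAlong_phi le_rfl (K.smoothAlong_zeta x)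

theorem smoothAlong_nullVec (K : UmbilicalFrame H D ζ F) (x : M) :
    SmoothAlong G ∞ H.f (nullVec H ζ) x :=
  (S.smoothAlong_xi le_rfl (H.smooth x)).sub ((K.smoothAlong_zeta x).const_smul _)

theorem contMDiffAt_etaBar {k : ℕ∞ω} (hY : CMDiffAt k (T% Y) x) (hk : k + 1 ≤ ∞) :
    ContMDiffAt 𝓘(ℝ, G) 𝓘(ℝ, ℝ) k (fun y ↦ etaBar H y (Y y)) x :=
  S.contMDiffAt_eta (le_trans le_self_add hk) (smoothAlong_df hY hk)

theorem smooth_P (K : UmbilicalFrame H D ζ F) (hY : CMDiffAt ∞ (T% Y) x) :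
    CMDiffAt ∞ (T% (fun y ↦ H.P y (Y y) : Π y : M, TangentSpace 𝓘(ℝ, G) y)) x := by
  have h1 := hY.sub_section ((contMDiffAt_etaBar (H := H) hY (by simp)).smul_section (K.smooth x))
  refine h1.congr_of_eventuallyEq (Eventually.of_forall fun y ↦ ?_)
  simp [K.P_eq]

end UmbilicalFrame
end Frame

/-! ### Derivatives of the frame, Gauss formula and Gauss equation. -/

section FrameCurvature

variable {E : Type*} [NormedAddCommGroup E] [NormedSpace ℝ E] [FiniteDimensional ℝ E]
  {A : Type*} [TopologicalSpace A] [T2Space A] [ChartedSpace E A] [IsManifold 𝓘(ℝ, E) ∞ A]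
  {G : Type*} [NormedAddCommGroup G] [NormedSpace ℝ G] [FiniteDimensional ℝ G]
  {M : Type*} [TopologicalSpace M] [ChartedSpace G M] [IsManifold 𝓘(ℝ, G) ∞ M]
  {S : AlmostContactBMetric E A}
  {D D' : CovariantDerivative 𝓘(ℝ, E) E (TangentSpace 𝓘(ℝ, E) : A → Type _)}

namespace UmbilicalFrame

variable {H : HalfLightlike G M S.g} {ζ : Π x : M, TangentSpace 𝓘(ℝ, G) x} {F : M → ℝ}
  {x : M} {X Y W : Π y : M, TangentSpace 𝓘(ℝ, G) y}

theorem df_P (K : UmbilicalFrame H D ζ F) (x : M) (v : TangentSpace 𝓘(ℝ, G) x) :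
    H.df x (H.P x v) = H.df x v - etaBar H x v • H.df x (ζ x) := by
  rw [K.P_eq, map_sub, map_smul]

theorem etaBar_P (K : UmbilicalFrame H D ζ F) (x : M) (v : TangentSpace 𝓘(ℝ, G) x) :
    etaBar H x (H.P x v) = 0 :=
  K.eta_screen x _ (Submodule.projection_apply_mem (H.screen_isCompl x) v)

theorem eta_df_P (K : UmbilicalFrame H D ζ F) (x : M) (v : TangentSpace 𝓘(ℝ, G) x) :
    S.eta (H.f x) (H.df x (H.P x v)) = 0 := K.etaBar_P x v

theorem g_df_P (K : UmbilicalFrame H D ζ F) (x : M) (v w : TangentSpace 𝓘(ℝ, G) x) :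
    S.g (H.f x) (H.df x v) (H.df x (H.P x w)) = H.gM x v w := by
  rw [K.df_P, map_sub, map_smul, K.g_zeta', HalfLightlike.gM]; simp

theorem g_phi_df_P (K : UmbilicalFrame H D ζ F) (x : M) (v w : TangentSpace 𝓘(ℝ, G) x) :
    S.g (H.f x) (H.df x v) (S.phi (H.f x) (H.df x (H.P x w))) = gPhi H x v w := by
  have := K.g_phiRad' x v
  rw [phiRad] at this
  rw [K.df_P, map_sub, map_smul, map_sub, map_smul, this, gPhi]; simp

/-- The screen is φ̄-invariant: φ̄Pv is orthogonal to φ̄ζ since Pv is orthogonal to ζ and η̄(Pv) =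
0, and orthogonal to ζ since φ̄ζ is normal. -/
theorem tang_phi_df_P (K : UmbilicalFrame H D ζ F) (x : M) (v : TangentSpace 𝓘(ℝ, G) x) :
    tang H ζ x (S.phi (H.f x) (H.df x (H.P x v))) = S.phi (H.f x) (H.df x (H.P x v)) := by
  have h1 := K.g_phiRad' x (H.P x v)
  rw [phiRad, ← S.g_phi_left] at h1
  rw [tang_apply, h1, phiRad, S.g_phi, K.g_zeta', K.eta_df_P]; simp

theorem covAlong_nullVec' (K : UmbilicalFrame H D ζ F) (hD : IsLeviCivita (fun p x y ↦ S.g p x y) D)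
    (hF0 : S.IsF0 D) (x : M) (v : TangentSpace 𝓘(ℝ, G) x) :
    covAlong H.f D (nullVec H ζ) x v =
      -(1 / 2 : ℝ) • covAlong H.f D (fun y ↦ H.df y (ζ y)) x v := by
  have hf : ContMDiffAt 𝓘(ℝ, G) 𝓘(ℝ, E) 1 H.f x := (H.smooth x).of_le (by simp)
  have s1 := (K.smoothAlong_zeta x).of_le (m := 1) (by simp)
  change covAlong H.f D (fun y ↦ S.xi (H.f y) - (1 / 2 : ℝ) • H.df y (ζ y)) x v = _
  rw [covAlong_sub (S.smoothAlong_xi (by simp) hf) (s1.const_smul _), S.xi_along hD hF0 hf,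
    covAlong_const_smul _ s1]
  module

/-- The radical field is umbilical. -/
theorem covAlong_zeta (K : UmbilicalFrame H D ζ F) (hD : IsLeviCivita (fun p x y ↦ S.g p x y) D)
    (hF0 : S.IsF0 D) (x : M) (v : TangentSpace 𝓘(ℝ, G) x) :
    covAlong H.f D (fun y ↦ H.df y (ζ y)) x v = (2 * F x) • H.df x (H.P x v) := by
  have s1 := (K.smoothAlong_zeta x).of_le (m := 1) (by simp)
  have sN := (K.smoothAlong_nullVec x).of_le (m := 1) (by simp)
  set C := covAlong H.f D (fun y ↦ H.df y (ζ y)) x v with hC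
  -- The components of ∇̄ζ off the screen vanish because g(ζ,ζ) = 0, η̄(ζ) = 1 and g(ζ,φ̄ζ) = 0 are
  -- constant; the last counts twice, φ̄ being symmetric and parallel. N₀ is a combination of ξ̄ and
  -- ζ.
  have c1 : S.g (H.f x) C (H.df x (ζ x)) = 0 := by
    have h := S.metric_along hD s1 s1 v
    simp only [K.g_zeta, mvfderiv_const, zero_apply] at h
    rw [S.g_symm _ _ C, ← hC] at h
    linarith
  have c2 : S.eta (H.f x) C = 0 := by
    have h := S.eta_along hD hF0 s1 v
    simp only [K.eta_zeta', mvfderiv_const, zero_apply] at h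
    exact h.symm
  have c3 : S.g (H.f x) C (phiRad H ζ x) = 0 := by
    have h := S.metric_along hD s1 (S.smoothAlong_phi (by simp) s1) v
    rw [S.phi_along hF0 s1, ← S.g_phi_left _ _ C, S.g_symm _ _ C, ← hC] at h
    have h0 : ∀ y, S.g (H.f y) (H.df y (ζ y)) (S.phi (H.f y) (H.df y (ζ y))) = 0 :=
      fun y ↦ K.g_phiRad' y _
    simp only [h0, mvfderiv_const, zero_apply] at h
    rw [phiRad]
    linarith
  have c4 : S.g (H.f x) C (nullVec H ζ x) = 0 := by
    rw [nullVec, map_sub, map_smul, S.g_xi, c1, c2]; simp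
  -- Differentiating g(PY,N₀) = 0 turns umbilicity into g(∇̄_vN₀,PY) = -F g(v,Y); since ∇̄N₀ =
  -- -∇̄ζ/2, the factor for ζ is 2F.
  have c5 : ∀ w, S.g (H.f x) C (H.df x w) = 2 * F x * H.gM x v w := fun w ↦ by
    have hY : CMDiffAt ∞ (T% (extend G w : Π y : M, TangentSpace 𝓘(ℝ, G) y)) x :=
      smooth_extend w le_rfl
    have hu := K.umbilical x v _ hY
    have sP := smoothAlong_df (H := H) (K.smooth_P hY) (by simp)
    have h := S.metric_along hD (sP.of_le (by simp)) sN v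
    simp only [K.g_nullVec, K.etaBar_P, mvfderiv_const, zero_apply] at h
    rw [K.df_nabla, tang_apply, map_sub, map_sub, map_smul, map_smul, sub_apply, sub_apply, smul_apply,
      smul_apply, K.g_phiRad_nullVec, K.g_nullVec_nullVec, smul_zero, smul_zero, sub_zero, sub_zero] at hu
    rw [hu, K.covAlong_nullVec' hD hF0, ← hC, map_smul, S.g_symm _ _ C, extend_apply_self, K.df_P, map_sub,
      map_smul, c1, smul_zero, sub_zero, smul_eq_mul] at h
    linarith
  refine sub_eq_zero.1 (K.eq_zero_of_g (fun w ↦ ?_) ?_ ?_)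
  · rw [map_sub, map_smul, sub_apply, smul_apply, c5, S.g_symm _ _ (H.df x w), K.g_df_P,
      HalfLightlike.gM, HalfLightlike.gM, S.g_symm _ _ (H.df x w), smul_eq_mul, sub_self]
  · rw [map_sub, map_smul, sub_apply, smul_apply, c3, K.g_phiRad']; simp
  · rw [map_sub, map_smul, sub_apply, smul_apply, c4, K.g_nullVec, K.etaBar_P]; simp

theorem covAlong_nullVec (K : UmbilicalFrame H D ζ F) (hD : IsLeviCivita (fun p x y ↦ S.g p x y) D)
    (hF0 : S.IsF0 D) (x : M) (v : TangentSpace 𝓘(ℝ, G) x) :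
    covAlong H.f D (nullVec H ζ) x v = -F x • H.df x (H.P x v) := by
  rw [K.covAlong_nullVec' hD hF0, K.covAlong_zeta hD hF0]; module

theorem covAlong_phiRad (K : UmbilicalFrame H D ζ F) (hD : IsLeviCivita (fun p x y ↦ S.g p x y) D)
    (hF0 : S.IsF0 D) (x : M) (v : TangentSpace 𝓘(ℝ, G) x) :
    covAlong H.f D (phiRad H ζ) x v = (2 * F x) • S.phi (H.f x) (H.df x (H.P x v)) := by
  have := S.phi_along hF0 ((K.smoothAlong_zeta x).of_le (m := 1) (by simp)) v
  rw [K.covAlong_zeta hD hF0, map_smul] at this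
  exact this

/-- The Gauss formula. -/
theorem df_nabla_eq (K : UmbilicalFrame H D ζ F) (hD : IsLeviCivita (fun p x y ↦ S.g p x y) D)
    (hF0 : S.IsF0 D) (hY : SmoothAlong G 1 H.f (fun y ↦ H.df y (Y y)) x)
    (v : TangentSpace 𝓘(ℝ, G) x) :
    H.df x (H.nabla D Y x v) = covAlong H.f D (fun y ↦ H.df y (Y y)) x v +
      (2 * F x * H.gM x (Y x) v) • nullVec H ζ x + (2 * F x * gPhi H x (Y x) v) • phiRad H ζ x := by
  have h1 := S.metric_along hD hY ((K.smoothAlong_zeta x).of_le (by simp)) v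
  -- The transversal components of ∇̄_vY come from differentiating g(Y,ζ) = 0 and g(Y,φ̄ζ) = 0.
  have h2 := S.metric_along hD hY ((K.smoothAlong_phiRad x).of_le (by simp)) v
  rw [K.covAlong_zeta hD hF0, map_smul, K.g_df_P] at h1
  rw [K.covAlong_phiRad hD hF0, map_smul, K.g_phi_df_P] at h2
  simp only [K.g_zeta', K.g_phiRad', mvfderiv_const, zero_apply, smul_eq_mul] at h1 h2
  rw [K.df_nabla, tang_apply, show S.g (H.f x) (covAlong H.f D (fun y ↦ H.df y (Y y)) x v)
    (H.df x (ζ x)) = -(2 * F x * H.gM x (Y x) v) by linarith,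
    show S.g (H.f x) (covAlong H.f D (fun y ↦ H.df y (Y y)) x v)
    (phiRad H ζ x) = -(2 * F x * gPhi H x (Y x) v) by linarith]
  module

theorem contMDiffAt_gM (hX : CMDiffAt ∞ (T% X) x) (hY : CMDiffAt ∞ (T% Y) x) :
    ContMDiffAt 𝓘(ℝ, G) 𝓘(ℝ, ℝ) ∞ (fun y ↦ H.gM y (X y) (Y y)) x :=
  S.contMDiffAt_g le_rfl (smoothAlong_df hX (by simp)) (smoothAlong_df hY (by simp))

theorem contMDiffAt_gPhi (hX : CMDiffAt ∞ (T% X) x) (hY : CMDiffAt ∞ (T% Y) x) :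
    ContMDiffAt 𝓘(ℝ, G) 𝓘(ℝ, ℝ) ∞ (fun y ↦ gPhi H y (X y) (Y y)) x :=
  S.contMDiffAt_g le_rfl (smoothAlong_df hX (by simp))
    (S.smoothAlong_phi le_rfl (smoothAlong_df hY (by simp)))

/-- Derivatives of the coefficients in the Gauss formula multiply N₀ or φ̄ζ and are killed by the
projection. Only ∇̄N₀ and ∇̄(φ̄ζ) contribute, giving -2F² and 4F². -/
theorem df_nabla_nabla (K : UmbilicalFrame H D ζ F) (hD : IsLeviCivita (fun p x y ↦ S.g p x y) D)
    (hF0 : S.IsF0 D) (hW : CMDiffAt ∞ (T% W) x) (hY : CMDiffAt ∞ (T% Y) x)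
    (v : TangentSpace 𝓘(ℝ, G) x) :
    H.df x (H.nabla D (fun y ↦ H.nabla D W y (Y y)) x v) =
      tang H ζ x (covAlong H.f D (fun y ↦ covAlong H.f D (fun y ↦ H.df y (W y)) y (Y y)) x v)
      - (2 * F x ^ 2 * H.gM x (W x) (Y x)) • H.df x (H.P x v)
      + (4 * F x ^ 2 * gPhi H x (W x) (Y x)) • S.phi (H.f x) (H.df x (H.P x v)) := by
  have sW := smoothAlong_df (H := H) hW (by simp)
  have ev : ∀ᶠ y in 𝓝 x, H.df y (H.nabla D W y (Y y)) =
      covAlong H.f D (fun y ↦ H.df y (W y)) y (Y y) +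
      (2 * F y * H.gM y (W y) (Y y)) • nullVec H ζ y +
      (2 * F y * gPhi H y (W y) (Y y)) • phiRad H ζ y := by
    filter_upwards [sW.eventually] with y hy
    exact K.df_nabla_eq hD hF0 hy _
  have c1 : ContMDiffAt 𝓘(ℝ, G) 𝓘(ℝ, ℝ) 1 (fun y ↦ 2 * F y * H.gM y (W y) (Y y)) x :=
    ((contMDiffAt_const.mul (K.smooth_fun x)).mul (contMDiffAt_gM hW hY)).of_le (by simp)
  have c2 : ContMDiffAt 𝓘(ℝ, G) 𝓘(ℝ, ℝ) 1 (fun y ↦ 2 * F y * gPhi H y (W y) (Y y)) x :=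
    ((contMDiffAt_const.mul (K.smooth_fun x)).mul (contMDiffAt_gPhi hW hY)).of_le (by simp)
  have sN := (K.smoothAlong_nullVec x).of_le (m := 1) (by simp)
  have sZ := (K.smoothAlong_phiRad x).of_le (m := 1) (by simp)
  have sC := (SmoothAlong.covAlong hD.smooth sW hY).of_le (m := 1) (by simp)
  rw [K.df_nabla, covAlong_congr ev, covAlong_add (sC.add (sN.smul c1)) (sZ.smul c2),
    covAlong_add sC (sN.smul c1), covAlong_smul c1 sN, covAlong_smul c2 sZ,
    K.covAlong_nullVec hD hF0, K.covAlong_phiRad hD hF0]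
  simp only [map_add, map_smul, K.tang_nullVec, K.tang_phiRad, K.tang_df, K.tang_phi_df_P]
  module

/-- The Gauss equation. -/
theorem df_curvature (K : UmbilicalFrame H D ζ F) (hD : IsLeviCivita (fun p x y ↦ S.g p x y) D)
    (hF0 : S.IsF0 D) (hX : CMDiffAt ∞ (T% X) x) (hY : CMDiffAt ∞ (T% Y) x) (hW : CMDiffAt ∞ (T% W) x) :
    H.df x (curvature (H.nabla D) X Y W x) =
      tang H ζ x (curvatureAt (fun Y q v ↦ D Y q v) (H.f x) (H.df x (X x)) (H.df x (Y x))
        (H.df x (W x)))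
      - (2 * F x ^ 2 * H.gM x (W x) (Y x)) • H.df x (H.P x (X x))
      + (2 * F x ^ 2 * H.gM x (W x) (X x)) • H.df x (H.P x (Y x))
      + (4 * F x ^ 2 * gPhi H x (W x) (Y x)) • S.phi (H.f x) (H.df x (H.P x (X x)))
      - (4 * F x ^ 2 * gPhi H x (W x) (X x)) • S.phi (H.f x) (H.df x (H.P x (Y x))) := by
  have : CompleteSpace G := FiniteDimensional.complete ℝ G
  have h := curvature_along hD.smooth hD.torsion_free (smoothAlong_df (H := H) hW (by simp)) hX hY
  change _ = curvatureAt _ (H.f x) (H.df x (X x)) (H.df x (Y x)) (H.df x (W x)) at h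
  rw [← h, curvature, map_sub, map_sub, K.df_nabla_nabla hD hF0 hW hY, K.df_nabla_nabla hD hF0 hW hX,
    K.df_nabla, map_sub, map_sub]
  module

theorem covAlong_covAlong_nullVec (K : UmbilicalFrame H D ζ F)
    (hD : IsLeviCivita (fun p x y ↦ S.g p x y) D)
    (hF0 : S.IsF0 D) (hY : CMDiffAt ∞ (T% Y) x) (v : TangentSpace 𝓘(ℝ, G) x) :
    covAlong H.f D (fun y ↦ covAlong H.f D (nullVec H ζ) y (Y y)) x v =
      -F x • (covAlong H.f D (fun y ↦ H.df y (Y y)) x v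
        - S.eta (H.f x) (covAlong H.f D (fun y ↦ H.df y (Y y)) x v) • H.df x (ζ x))
      + (2 * F x ^ 2 * etaBar H x (Y x)) • H.df x (H.P x v)
      - mvfderiv 𝓘(ℝ, G) F x v • H.df x (H.P x (Y x)) := by
  have sY := (smoothAlong_df (H := H) hY (by simp)).of_le (m := 1) (by simp)
  have sZ := (K.smoothAlong_zeta x).of_le (m := 1) (by simp)
  have c1 := (contMDiffAt_etaBar (H := H) hY (by simp)).of_le (m := 1) (by simp)
  have sF := (K.smooth_fun x).of_le (m := 1) (by simp)
  have e : ∀ᶠ y in 𝓝 x, covAlong H.f D (nullVec H ζ) y (Y y) =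
      -(F y • (H.df y (Y y) - etaBar H y (Y y) • H.df y (ζ y))) := Eventually.of_forall fun y ↦ by
    rw [K.covAlong_nullVec hD hF0, K.df_P, neg_smul]
  have de := S.eta_along hD hF0 sY v
  change mvfderiv 𝓘(ℝ, G) (fun y ↦ etaBar H y (Y y)) x v = _ at de
  rw [covAlong_congr e, covAlong_neg ((sY.sub (sZ.smul c1)).smul sF), covAlong_smul sF (sY.sub (sZ.smul c1)),
    covAlong_sub sY (sZ.smul c1), covAlong_smul c1 sZ, de, K.covAlong_zeta hD hF0, ← K.df_P]
  module

/-- The curvature of the pulled-back connection applied to N₀, from ∇̄_vN₀ = -F Pv. The second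
derivatives of the fields cancel by vanishing torsion; the terms in F² come from differentiating ζ
inside P. -/
theorem curvatureAt_nullVec (K : UmbilicalFrame H D ζ F)
    (hD : IsLeviCivita (fun p x y ↦ S.g p x y) D)
    (hF0 : S.IsF0 D) (u v : TangentSpace 𝓘(ℝ, G) x) :
    curvatureAt (fun Y q v ↦ D Y q v) (H.f x) (H.df x u) (H.df x v) (nullVec H ζ x) =
      mvfderiv 𝓘(ℝ, G) F x v • H.df x (H.P x u) - mvfderiv 𝓘(ℝ, G) F x u • H.df x (H.P x v)
      + (2 * F x ^ 2) • (etaBar H x v • H.df x (H.P x u) - etaBar H x u • H.df x (H.P x v)) := by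
  have : CompleteSpace G := FiniteDimensional.complete ℝ G
  have hX : CMDiffAt ∞ (T% (extend G u : Π y : M, TangentSpace 𝓘(ℝ, G) y)) x := smooth_extend u le_rfl
  have hY : CMDiffAt ∞ (T% (extend G v : Π y : M, TangentSpace 𝓘(ℝ, G) y)) x := smooth_extend v le_rfl
  have h := curvature_along hD.smooth hD.torsion_free (K.smoothAlong_nullVec x) hX hY
  change _ = curvatureAt _ (H.f x) (H.df x (extend G u x)) (H.df x (extend G v x)) (nullVec H ζ x) at h
  have t := torsion_along hD.torsion_free (H.smooth x) hX hY
  change covAlong H.f D (fun y ↦ H.df y (extend G v y)) x (extend G u x) -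
    covAlong H.f D (fun y ↦ H.df y (extend G u y)) x (extend G v x) = H.df x _ at t
  have t2 : etaBar H x (mlieBracket 𝓘(ℝ, G) (extend G u) (extend G v) x) =
      S.eta (H.f x) (covAlong H.f D (fun y ↦ H.df y (extend G v y)) x (extend G u x)) -
      S.eta (H.f x) (covAlong H.f D (fun y ↦ H.df y (extend G u y)) x (extend G v x)) := by
    rw [etaBar, ← t, map_sub]
  rw [K.covAlong_covAlong_nullVec hD hF0 hX, K.covAlong_covAlong_nullVec hD hF0 hY,
    K.covAlong_nullVec hD hF0, K.df_P x (mlieBracket _ _ _ _), t2, ← t] at h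
  simp only [extend_apply_self] at h
  rw [← h]
  module

end UmbilicalFrame
end FrameCurvature

/-- A real endomorphism with `J³ = -J` has trace zero. -/
theorem trace_eq_zero_of_cube_eq_neg {V : Type*} [AddCommGroup V] [Module ℝ V] [FiniteDimensional ℝ V]
    (J : V →ₗ[ℝ] V) (hJ : ∀ x, J (J (J x)) = -J x) : LinearMap.trace ℝ V J = 0 := by
  have hf : ∀ w, J.baseChange ℂ (J.baseChange ℂ (J.baseChange ℂ w)) = -J.baseChange ℂ w := by
    intro w
    induction w with
    | zero => simp
    | tmul z x => simp [hJ, TensorProduct.tmul_neg]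
    | add w w' h h' => simp only [map_add, h, h', neg_add]
  have h1 := Module.End.trace_eq_sum_roots_charpoly_of_splits
    (IsAlgClosed.splits (J.baseChange ℂ).charpoly)
  rw [LinearMap.trace_baseChange] at h1
  -- After complexification the eigenvalues satisfy μ³ = -μ, so they are 0 or ±i. The trace is real
  -- and equals a sum of imaginary numbers.
  have h2 : ∀ μ ∈ (J.baseChange ℂ).charpoly.roots, μ.re = 0 := fun μ hμ ↦ by
    have hr := Polynomial.isRoot_of_mem_roots hμ
    obtain ⟨v, hv⟩ := ((Module.End.hasEigenvalue_iff_isRoot_charpoly _ _).2 hr).exists_hasEigenvector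
    have h3 := hf v
    have ha := hv.apply_eq_smul
    simp only [ha, map_smul, smul_smul, ← neg_smul] at h3
    have h4 : μ * μ * μ = -μ := by
      simpa using smul_left_injective ℂ hv.2 h3
    by_contra hre
    have hμ0 : μ ≠ 0 := fun h ↦ hre (by simp [h])
    have h5 : μ * μ = -1 := mul_right_cancel₀ hμ0 (by rw [h4]; ring)
    have e1 := congrArg Complex.re h5
    have e2 := congrArg Complex.im h5
    simp at e1 e2
    have h6 : μ.im = 0 := by
      have : μ.re * μ.im = 0 := by linarith
      exact (mul_eq_zero.1 this).resolve_left hre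
    rw [h6] at e1
    nlinarith [mul_self_nonneg μ.re]
  have h3 := congrArg Complex.re h1
  have h4 : ((J.baseChange ℂ).charpoly.roots.sum).re = 0 := by
    have h6 : ∀ s : Multiset ℂ, (∀ μ ∈ s, μ.re = 0) → s.sum.re = 0 := fun s ↦ by
      induction s using Multiset.induction_on with
      | empty => simp
      | cons a s ih =>
        intro h
        rw [Multiset.sum_cons, Complex.add_re, h a (Multiset.mem_cons_self _ _),
          ih fun μ hμ ↦ h μ (Multiset.mem_cons_of_mem hμ), add_zero]
    exact h6 _ h2
  rw [h4] at h3
  simpa using h3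

/-! ### The equations for F, and the curvature and Ricci tensors of the submanifold. -/

section FrameConsequences

variable {E : Type*} [NormedAddCommGroup E] [NormedSpace ℝ E] [FiniteDimensional ℝ E]
  {A : Type*} [TopologicalSpace A] [T2Space A] [ChartedSpace E A] [IsManifold 𝓘(ℝ, E) ∞ A]
  {G : Type*} [NormedAddCommGroup G] [NormedSpace ℝ G] [FiniteDimensional ℝ G]
  {M : Type*} [TopologicalSpace M] [ChartedSpace G M] [IsManifold 𝓘(ℝ, G) ∞ M]
  {S : AlmostContactBMetric E A}
  {D D' : CovariantDerivative 𝓘(ℝ, E) E (TangentSpace 𝓘(ℝ, E) : A → Type _)}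

theorem AlmostContactBMetric.modelCurvature_eq (p : A) (x y z : TangentSpace 𝓘(ℝ, E) p) :
    (S.pt p).modelCurvature x y z =
      (S.g p y z - S.eta p y * S.eta p z) • (x - S.eta p x • S.xi p)
      - (S.g p x z - S.eta p x * S.eta p z) • (y - S.eta p y • S.xi p)
      - S.g p y (S.phi p z) • S.phi p x + S.g p x (S.phi p z) • S.phi p y :=
  (S.pt p).modelCurvature_apply x y z

namespace UmbilicalFrame

variable {H : HalfLightlike G M S.g} {ζ : Π x : M, TangentSpace 𝓘(ℝ, G) x} {F : M → ℝ}
  {x : M} {X Y W : Π y : M, TangentSpace 𝓘(ℝ, G) y} {ν ν' : A → ℝ}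

theorem modelCurvature_nullVec (K : UmbilicalFrame H D ζ F) (u v : TangentSpace 𝓘(ℝ, G) x) :
    (S.pt (H.f x)).modelCurvature (H.df x u) (H.df x v) (nullVec H ζ x) =
      (1 / 2 : ℝ) • (etaBar H x v • H.df x (H.P x u) - etaBar H x u • H.df x (H.P x v)) := by
  rw [AlmostContactBMetric.modelCurvature_eq, phi_nullVec, map_smul, map_smul, K.g_phiRad', K.g_phiRad',
    K.g_nullVec, K.g_nullVec, K.eta_nullVec, K.df_P, K.df_P]
  simp only [etaBar]
  module

theorem P_zeta (K : UmbilicalFrame H D ζ F) (x : M) : H.P x (ζ x) = 0 := by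
  rw [K.P_eq, K.eta_zeta, one_smul, sub_self]

theorem P_of_etaBar (K : UmbilicalFrame H D ζ F) {v : TangentSpace 𝓘(ℝ, G) x} (hv : etaBar H x v = 0) :
    H.P x v = v := by rw [K.P_eq, hv, zero_smul, sub_zero]

/-- The endomorphism `φ ∘ P` of `T_x M`. -/
def phiTan (K : UmbilicalFrame H D ζ F) (x : M) :
    TangentSpace 𝓘(ℝ, G) x →ₗ[ℝ] TangentSpace 𝓘(ℝ, G) x where
  toFun v := H.tangentialPart x (S.phi (H.f x) (H.df x (H.P x v)))
  map_add' v w := H.immersion x <| by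
    change H.df x _ = H.df x _
    simp only [map_add, K.df_tangentialPart, K.tang_phi_df_P]
    rw [← map_add, K.df_P, K.df_P, K.df_P, etaBar, etaBar, etaBar, map_add, map_add]
    congr 1
    module
  map_smul' c v := H.immersion x <| by
    change H.df x _ = H.df x _
    simp only [map_smul, K.df_tangentialPart, K.tang_phi_df_P, RingHom.id_apply]
    rw [← map_smul, K.df_P, K.df_P, etaBar, etaBar, map_smul, map_smul, smul_eq_mul]
    congr 1
    module

theorem df_phiTan (K : UmbilicalFrame H D ζ F) (x : M) (v : TangentSpace 𝓘(ℝ, G) x) :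
    H.df x (K.phiTan x v) = S.phi (H.f x) (H.df x (H.P x v)) := by
  change H.df x (H.tangentialPart x _) = _
  rw [K.df_tangentialPart, K.tang_phi_df_P]

theorem etaBar_phiTan (K : UmbilicalFrame H D ζ F) (x : M) (v : TangentSpace 𝓘(ℝ, G) x) :
    etaBar H x (K.phiTan x v) = 0 := by
  rw [etaBar, K.df_phiTan, S.eta_phi]

theorem df_injective (H : HalfLightlike G M S.g) (x : M) : Function.Injective (H.df x) := H.immersion x

theorem phiTan_phiTan (K : UmbilicalFrame H D ζ F) (x : M) (v : TangentSpace 𝓘(ℝ, G) x) :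
    K.phiTan x (K.phiTan x v) = -H.P x v := df_injective H x <| by
  rw [K.df_phiTan, K.P_of_etaBar (K.etaBar_phiTan x v), K.df_phiTan, S.phi_sq, K.eta_df_P, map_neg]
  simp

theorem trace_phiTan (K : UmbilicalFrame H D ζ F) (x : M) :
    LinearMap.trace ℝ (TangentSpace 𝓘(ℝ, G) x) (K.phiTan x) = 0 :=
  trace_eq_zero_of_cube_eq_neg _ fun v ↦ by
    rw [K.phiTan_phiTan, K.P_of_etaBar (K.etaBar_phiTan x v)]

/-- On ker η̄ the operators a + bφ̄ and a - bφ̄ compose to a² + b². -/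
theorem eq_zero_of_smul_add_smul_phi_eq_zero {s : TangentSpace 𝓘(ℝ, G) x}
    (hs : etaBar H x s = 0) (hs0 : s ≠ 0) {a b : ℝ} (h : a • H.df x s + b • S.phi (H.f x) (H.df x s) = 0) : a = 0 ∧ b = 0 := by
  have hs' : S.eta (H.f x) (H.df x s) = 0 := hs
  have h1 := congrArg (S.phi (H.f x)) h
  rw [map_add, map_smul, map_smul, S.phi_sq, hs', map_zero] at h1
  have h2 : (a * a + b * b) • H.df x s = 0 := by
    have h3 := congrArg₂ (fun u v ↦ a • u - b • v) h h1
    simp only [smul_zero, sub_zero] at h3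
    rw [← h3]
    module
  have h0 : H.df x s ≠ 0 := fun h ↦ hs0 (df_injective H x (h.trans (map_zero _).symm))
  have h4 := (smul_eq_zero.1 h2).resolve_right h0
  constructor <;> nlinarith [mul_self_nonneg a, mul_self_nonneg b]

/-- Two evaluations of R̄(u,v)N₀ are compared, one from the frame and one from the model. For (s,ζ)
the coefficients of s and φ̄s give ν and ν̃. For (s,φ̄s) the model vanishes, as both vectors lie in
ker η̄, and dF(φ̄s)s - dF(s)φ̄s = 0 remains. -/
theorem main_equation (K : UmbilicalFrame H D ζ F) (hD : IsLeviCivita (fun p x y ↦ S.g p x y) D)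
    (hD' : IsLeviCivita S.assoc D') (hF0 : S.IsF0 D)
    (hν : S.HasTotallyRealSectionalCurvatures D D' ν ν') {s : TangentSpace 𝓘(ℝ, G) x}
    (hs : etaBar H x s = 0) (hs0 : s ≠ 0) :
    ν' (H.f x) = 0 ∧ ν (H.f x) = 2 * mvfderiv 𝓘(ℝ, G) F x (ζ x) + 4 * F x ^ 2 ∧
      mvfderiv 𝓘(ℝ, G) F x s = 0 := by
  have key : ∀ u v : TangentSpace 𝓘(ℝ, G) x, _ := fun u v ↦
    (K.curvatureAt_nullVec hD hF0 u v).symm.trans (S.curvatureAt_eq_model hD hD' hF0 hν _ _ _ _)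
  have k1 := key s (ζ x)
  have k2 := key s (K.phiTan x s)
  rw [K.modelCurvature_nullVec] at k1 k2
  rw [K.P_zeta, K.P_of_etaBar hs, K.eta_zeta, hs, map_zero] at k1
  rw [K.P_of_etaBar hs, K.P_of_etaBar (K.etaBar_phiTan x s), K.etaBar_phiTan, hs, K.df_phiTan,
    K.P_of_etaBar hs] at k2
  simp only [zero_smul, smul_zero, sub_zero, one_smul, map_smul, map_zero, add_zero] at k1 k2
  obtain ⟨h1, h2⟩ := eq_zero_of_smul_add_smul_phi_eq_zero hs hs0
    (a := mvfderiv 𝓘(ℝ, G) F x (ζ x) + 2 * F x ^ 2 - ν (H.f x) / 2)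
    (b := ν' (H.f x) / 2) (by
      rw [← sub_eq_zero] at k1
      rw [← k1]
      module)
  obtain ⟨h3, h4⟩ := eq_zero_of_smul_add_smul_phi_eq_zero hs hs0
    (a := mvfderiv 𝓘(ℝ, G) F x (K.phiTan x s))
    (b := -mvfderiv 𝓘(ℝ, G) F x s) (by
      rw [← k2]
      module)
  refine ⟨by linarith, by linarith, by linarith⟩

theorem gM_symm (x : M) (u v : TangentSpace 𝓘(ℝ, G) x) : H.gM x u v = H.gM x v u := S.g_symm _ _ _

theorem gPhi_symm (x : M) (u v : TangentSpace 𝓘(ℝ, G) x) : gPhi H x u v = gPhi H x v u := by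
  rw [gPhi, ← S.g_phi_left, S.g_symm, gPhi]

/-- The component along ζ arises from ξ̄ = N₀ + ζ/2, whose tangential part is ζ/2. -/
theorem tang_modelCurvature (K : UmbilicalFrame H D ζ F) (u v w : TangentSpace 𝓘(ℝ, G) x) :
    tang H ζ x ((S.pt (H.f x)).modelCurvature (H.df x u) (H.df x v) (H.df x w)) =
      (H.gM x v w - etaBar H x v * etaBar H x w) • H.df x (H.P x u)
      - (H.gM x u w - etaBar H x u * etaBar H x w) • H.df x (H.P x v)
      - gPhi H x v w • S.phi (H.f x) (H.df x (H.P x u))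
      + gPhi H x u w • S.phi (H.f x) (H.df x (H.P x v))
      + (1 / 2 * (H.gM x v w * etaBar H x u - H.gM x u w * etaBar H x v)) • H.df x (ζ x) := by
  have hp : ∀ u : TangentSpace 𝓘(ℝ, G) x, tang H ζ x (S.phi (H.f x) (H.df x u)) =
      S.phi (H.f x) (H.df x (H.P x u)) := fun u ↦ by
    have : H.df x u = H.df x (H.P x u) + etaBar H x u • H.df x (ζ x) := by rw [K.df_P]; module
    rw [this, map_add, map_add, map_smul, map_smul, K.tang_phi_df_P]
    have h := K.tang_phiRad (x := x)
    rw [phiRad] at h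
    rw [h, smul_zero, add_zero]
  rw [AlmostContactBMetric.modelCurvature_eq]
  simp only [map_add, map_sub, map_smul, hp, K.tang_df, K.tang_xi]
  simp only [K.df_P, HalfLightlike.gM, gPhi, etaBar, map_sub, map_smul]
  module

/-- The curvature tensor of the induced connection. -/
theorem df_curvature_eq (K : UmbilicalFrame H D ζ F) (hD : IsLeviCivita (fun p x y ↦ S.g p x y) D)
    (hD' : IsLeviCivita S.assoc D') (hF0 : S.IsF0 D)
    (hν : S.HasTotallyRealSectionalCurvatures D D' ν ν') (h0 : ν' (H.f x) = 0)
    (hX : CMDiffAt ∞ (T% X) x) (hY : CMDiffAt ∞ (T% Y) x) (hW : CMDiffAt ∞ (T% W) x) :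
    H.df x (curvature (H.nabla D) X Y W x) =
      ((ν (H.f x) - 2 * F x ^ 2) * H.gM x (Y x) (W x)
          - ν (H.f x) * etaBar H x (Y x) * etaBar H x (W x)) • H.df x (H.P x (X x))
      - ((ν (H.f x) - 2 * F x ^ 2) * H.gM x (X x) (W x)
          - ν (H.f x) * etaBar H x (X x) * etaBar H x (W x)) • H.df x (H.P x (Y x))
      + ((4 * F x ^ 2 - ν (H.f x)) * gPhi H x (Y x) (W x)) • S.phi (H.f x) (H.df x (H.P x (X x)))
      - ((4 * F x ^ 2 - ν (H.f x)) * gPhi H x (X x) (W x)) • S.phi (H.f x) (H.df x (H.P x (Y x)))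
      + (ν (H.f x) / 2 * (H.gM x (Y x) (W x) * etaBar H x (X x)
          - H.gM x (X x) (W x) * etaBar H x (Y x))) • H.df x (ζ x) := by
  rw [K.df_curvature hD hF0 hX hY hW, S.curvatureAt_eq_model hD hD' hF0 hν, h0, zero_smul, sub_zero,
    map_smul, K.tang_modelCurvature, gM_symm x (W x), gM_symm x (W x), gPhi_symm x (W x),
    gPhi_symm x (W x)]
  module

/-- `η̄` on `T_x M` as a linear form. -/
def etaBarLin (H : HalfLightlike G M S.g) (x : M) : TangentSpace 𝓘(ℝ, G) x →ₗ[ℝ] ℝ :=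
  (S.eta (H.f x) ∘L H.df x : TangentSpace 𝓘(ℝ, G) x →L[ℝ] ℝ)

theorem etaBarLin_apply (v : TangentSpace 𝓘(ℝ, G) x) : etaBarLin H x v = etaBar H x v := rfl

/-- The projection `P` as a linear map. -/
def PLin (H : HalfLightlike G M S.g) (ζ : Π x : M, TangentSpace 𝓘(ℝ, G) x) (x : M) :
    TangentSpace 𝓘(ℝ, G) x →ₗ[ℝ] TangentSpace 𝓘(ℝ, G) x :=
  LinearMap.id - (etaBarLin H x).smulRight (ζ x)

theorem PLin_apply (K : UmbilicalFrame H D ζ F) (v : TangentSpace 𝓘(ℝ, G) x) :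
    PLin H ζ x v = H.P x v := by
  rw [K.P_eq]; rfl

theorem trace_PLin (K : UmbilicalFrame H D ζ F) :
    LinearMap.trace ℝ (TangentSpace 𝓘(ℝ, G) x) (PLin H ζ x) = Module.finrank ℝ G - 1 := by
  rw [PLin, map_sub, LinearMap.trace_id, LinearMap.trace_smulRight, etaBarLin_apply, K.eta_zeta]
  rfl

/-- The linear form `g(·, w)` on `T_x M`. -/
def gLin (H : HalfLightlike G M S.g) (x : M) (w : TangentSpace 𝓘(ℝ, G) x) :
    TangentSpace 𝓘(ℝ, G) x →ₗ[ℝ] ℝ :=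
  (S.g (H.f x) (H.df x w) ∘L H.df x : TangentSpace 𝓘(ℝ, G) x →L[ℝ] ℝ)

theorem gLin_apply (v w : TangentSpace 𝓘(ℝ, G) x) : gLin H x w v = H.gM x v w := S.g_symm _ _ _

/-- The linear form `g(·, φ w)` on `T_x M`. -/
def gPhiLin (H : HalfLightlike G M S.g) (x : M) (w : TangentSpace 𝓘(ℝ, G) x) :
    TangentSpace 𝓘(ℝ, G) x →ₗ[ℝ] ℝ :=
  (S.g (H.f x) (S.phi (H.f x) (H.df x w)) ∘L H.df x : TangentSpace 𝓘(ℝ, G) x →L[ℝ] ℝ)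

theorem gPhiLin_apply (v w : TangentSpace 𝓘(ℝ, G) x) : gPhiLin H x w v = gPhi H x v w := S.g_symm _ _ _

theorem gM_P (K : UmbilicalFrame H D ζ F) (v w : TangentSpace 𝓘(ℝ, G) x) :
    H.gM x (H.P x v) w = H.gM x v w := by
  rw [gM_symm, HalfLightlike.gM, K.g_df_P, gM_symm]

theorem gPhi_phiTan (K : UmbilicalFrame H D ζ F) (v w : TangentSpace 𝓘(ℝ, G) x) :
    gPhi H x (K.phiTan x v) w = -H.gM x v w := by
  rw [gPhi, K.df_phiTan, S.g_phi, K.eta_df_P, zero_mul, add_zero, ← K.gM_P v w, HalfLightlike.gM]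

/-- The curvature tensor of the induced connection in the first argument. -/
def curvLin (K : UmbilicalFrame H D ζ F) (c : ℝ) (x : M) (v w : TangentSpace 𝓘(ℝ, G) x) :
    TangentSpace 𝓘(ℝ, G) x →ₗ[ℝ] TangentSpace 𝓘(ℝ, G) x :=
  ((c - 2 * F x ^ 2) * H.gM x v w - c * etaBar H x v * etaBar H x w) • PLin H ζ x
    - ((c - 2 * F x ^ 2) • (gLin H x w).smulRight (H.P x v)
      - (c * etaBar H x w) • (etaBarLin H x).smulRight (H.P x v))
    + ((4 * F x ^ 2 - c) * gPhi H x v w) • K.phiTan x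
    - (4 * F x ^ 2 - c) • (gPhiLin H x w).smulRight (K.phiTan x v)
    + ((c / 2 * H.gM x v w) • (etaBarLin H x).smulRight (ζ x)
      - (c / 2 * etaBar H x v) • (gLin H x w).smulRight (ζ x))

theorem curvatureAt_eq_curvLin (K : UmbilicalFrame H D ζ F)
    (hD : IsLeviCivita (fun p x y ↦ S.g p x y) D)
    (hD' : IsLeviCivita S.assoc D') (hF0 : S.IsF0 D)
    (hν : S.HasTotallyRealSectionalCurvatures D D' ν ν') (h0 : ν' (H.f x) = 0)
    (u v w : TangentSpace 𝓘(ℝ, G) x) :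
    curvatureAt (H.nabla D) x u v w = K.curvLin (ν (H.f x)) x v w u := by
  refine df_injective H x ?_
  rw [curvatureAt, K.df_curvature_eq hD hD' hF0 hν h0 (smooth_extend u le_rfl)
    (smooth_extend v le_rfl) (smooth_extend w le_rfl)]
  simp only [curvLin, extend_apply_self, LinearMap.add_apply, LinearMap.sub_apply,
    LinearMap.smul_apply, LinearMap.smulRight_apply, K.PLin_apply, gLin_apply, gPhiLin_apply,
    etaBarLin_apply, map_add, map_sub, map_smul, K.df_phiTan]
  module

/-- The Ricci tensor of the induced connection. -/
theorem ricciAt_eq (K : UmbilicalFrame H D ζ F) (hD : IsLeviCivita (fun p x y ↦ S.g p x y) D)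
    (hD' : IsLeviCivita S.assoc D') (hF0 : S.IsF0 D)
    (hν : S.HasTotallyRealSectionalCurvatures D D' ν ν') (h0 : ν' (H.f x) = 0)
    (v w : TangentSpace 𝓘(ℝ, G) x) :
    ricciAt (H.nabla D) x v w =
      ((Module.finrank ℝ G - 5 / 2) * ν (H.f x) - 2 * (Module.finrank ℝ G - 4) * F x ^ 2) * H.gM x v w
        - (Module.finrank ℝ G - 1) * ν (H.f x) * etaBar H x v * etaBar H x w := by
  -- Linearity selects the trace in `ricciAt` instead of its default value 0.
  have hlin : IsLinearMap ℝ (fun u : TangentSpace 𝓘(ℝ, G) x ↦ curvatureAt (H.nabla D) x u v w) := by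
    simp only [K.curvatureAt_eq_curvLin hD hD' hF0 hν h0]
    exact (K.curvLin (ν (H.f x)) x v w).isLinear
  have heq : hlin.mk' _ = K.curvLin (ν (H.f x)) x v w :=
    LinearMap.ext fun u ↦ K.curvatureAt_eq_curvLin hD hD' hF0 hν h0 u v w
  rw [ricciAt, dif_pos hlin, heq, curvLin]
  -- With m = dim M: P has trace m - 1, φ̄P has trace 0, and a rank-one map has as trace its form
  -- evaluated at its vector. As g(φ̄Pv,φ̄w) = -g(v,w), the φ̄-terms contribute 4F² - ν to the
  -- coefficient of g.
  simp only [map_add, map_sub, map_smul, LinearMap.trace_smulRight, K.trace_PLin, K.trace_phiTan,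
    gLin_apply, gPhiLin_apply, etaBarLin_apply, K.gM_P, K.gPhi_phiTan, K.etaBar_P, K.eta_zeta]
  have : H.gM x (ζ x) w = 0 := K.g_zeta x w
  rw [this]
  simp only [smul_eq_mul]
  ring

end UmbilicalFrame
end FrameConsequences

/-! ### Functions with zero differential on connected open sets. -/

section LocallyConstant

variable {G : Type*} [NormedAddCommGroup G] [NormedSpace ℝ G]
  {M : Type*} [TopologicalSpace M] [ChartedSpace G M] [IsManifold 𝓘(ℝ, G) ∞ M]

/-- In a chart, a small ball is convex and the function has zero derivative on it. -/
theorem eventually_eq_of_mvfderiv_eq_zero {h : M → ℝ} {V : Set M} (hV : IsOpen V)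
    (hh : ∀ x ∈ V, MDiffAt h x) (h0 : ∀ x ∈ V, mvfderiv 𝓘(ℝ, G) h x = 0) {x : M} (hx : x ∈ V) :
    ∀ᶠ y in 𝓝 x, h y = h x := by
  set e := extChartAt 𝓘(ℝ, G) x with he
  have ho : IsOpen (e.target ∩ e.symm ⁻¹' V) :=
    (continuousOn_extChartAt_symm x).isOpen_inter_preimage (isOpen_extChartAt_target x) hV
  have hmem : e x ∈ e.target ∩ e.symm ⁻¹' V :=
    ⟨mem_extChartAt_target x, by simpa [he] using hx⟩
  obtain ⟨r, hr, hball⟩ := Metric.isOpen_iff.1 ho _ hmem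
  have hd : ∀ z ∈ Metric.ball (e x) r, DifferentiableAt ℝ (h ∘ e.symm) z ∧
      fderiv ℝ (h ∘ e.symm) z = 0 := fun z hz ↦ by
    obtain ⟨hz1, hz2⟩ := hball hz
    have hs : MDifferentiableAt 𝓘(ℝ, G) 𝓘(ℝ, G) e.symm z :=
      ((contMDiffOn_extChartAt_symm (I := 𝓘(ℝ, G)) (n := ∞) x).contMDiffAt
        ((isOpen_extChartAt_target x).mem_nhds hz1)).mdifferentiableAt (by simp)
    have hc := (hh _ hz2).comp z hs
    refine ⟨hc.differentiableAt, ?_⟩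
    ext v
    have h1 := mvfderiv_comp_apply z (hh _ hz2) hs v
    rw [h0 _ hz2] at h1
    rw [← mfderiv_eq_fderiv]
    exact h1
  have hev : ∀ᶠ y in 𝓝 x, y ∈ e.source ∧ e y ∈ Metric.ball (e x) r :=
    Filter.Eventually.and (extChartAt_source_mem_nhds x)
      ((continuousAt_extChartAt x).eventually_mem (Metric.ball_mem_nhds _ hr))
  filter_upwards [hev] with y ⟨hy1, hy2⟩
  have := (convex_ball (e x) r).is_const_of_fderivWithin_eq_zero (𝕜 := ℝ) (f := h ∘ e.symm)
    (fun z hz ↦ (hd z hz).1.differentiableWithinAt)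
    (fun z hz ↦ by rw [fderivWithin_of_isOpen Metric.isOpen_ball hz, (hd z hz).2]) hy2
    (Metric.mem_ball_self hr)
  simpa [e.left_inv hy1, e.left_inv (mem_extChartAt_source x)] using this

theorem eq_of_mvfderiv_eq_zero {h : M → ℝ} {V : Set M} (hV : IsOpen V) (hc : IsPreconnected V)
    (hh : ∀ x ∈ V, MDiffAt h x) (h0 : ∀ x ∈ V, mvfderiv 𝓘(ℝ, G) h x = 0) {x y : M} (hx : x ∈ V)
    (hy : y ∈ V) : h y = h x := by
  by_contra hne
  have ev := fun z hz ↦ eventually_eq_of_mvfderiv_eq_zero hV hh h0 (x := z) hz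
  have o1 : IsOpen {z | z ∈ V ∧ h z = h x} := isOpen_iff_mem_nhds.2 fun z hz ↦ by
    filter_upwards [hV.mem_nhds hz.1, ev z hz.1] with w h1 h2 using ⟨h1, h2.trans hz.2⟩
  have o2 : IsOpen {z | z ∈ V ∧ h z ≠ h x} := isOpen_iff_mem_nhds.2 fun z hz ↦ by
    filter_upwards [hV.mem_nhds hz.1, ev z hz.1] with w h1 h2 using ⟨h1, h2.trans_ne hz.2⟩
  obtain ⟨z, -, hz1, hz2⟩ := hc _ _ o1 o2 (fun z hz ↦ by
    by_cases h : h z = h x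
    · exact Or.inl ⟨hz, h⟩
    · exact Or.inr ⟨hz, h⟩) ⟨x, hx, hx, rfl⟩ ⟨y, hy, hy, hne⟩
  exact hz2.2 hz1.2

end LocallyConstant

/-! ### Construction of the normalised frame from the geometric hypotheses. -/

section Ascreen

variable {E : Type*} [NormedAddCommGroup E] [NormedSpace ℝ E] [FiniteDimensional ℝ E]
  {A : Type*} [TopologicalSpace A] [T2Space A] [ChartedSpace E A] [IsManifold 𝓘(ℝ, E) ∞ A]
  {G : Type*} [NormedAddCommGroup G] [NormedSpace ℝ G] [FiniteDimensional ℝ G]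
  {M : Type*} [TopologicalSpace M] [ChartedSpace G M] [IsManifold 𝓘(ℝ, G) ∞ M]
  {S : AlmostContactBMetric E A}
  {D D' : CovariantDerivative 𝓘(ℝ, E) E (TangentSpace 𝓘(ℝ, E) : A → Type _)}
  {H : HalfLightlike G M S.g} {x : M}

/-- A section L of S(TM^⊥) with g(L,L) = ±1 equals φ̄r with r radical, and g(φ̄r,φ̄r) = η̄(r)²; so
η̄(r) ≠ 0 and r can be rescaled. -/
theorem exists_rad_eta_eq_one (hR : IsRSTHL H) (x : M) : ∃ z ∈ H.rad x, etaBar H x z = 1 := by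
  obtain ⟨U, -, hxU, L, ε, hε, -, hL⟩ := H.screenTrans_smooth x
  obtain ⟨h1, h2⟩ := hL x hxU
  have hmem : L x ∈ H.screenTrans x := by rw [h1]; exact Submodule.mem_span_singleton_self _
  rw [← hR x] at hmem
  obtain ⟨_, ⟨r, hr, rfl⟩, hL⟩ := hmem
  have hr0 : S.g (H.f x) (H.df x r) (H.df x r) = 0 := hr r
  have h3 : etaBar H x r ≠ 0 := fun h ↦ by
    have h' : S.eta (H.f x) (H.df x r) = 0 := h
    rw [← hL] at h2
    have h4 := S.g_phi (H.f x) (H.df x r) (H.df x r)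
    rw [hr0, h'] at h4
    have h5 : ε = 0 := by
      rw [← h2]
      simpa using h4
    rcases hε with h | h <;> rw [h] at h5 <;> norm_num at h5
  refine ⟨(etaBar H x r)⁻¹ • r, Submodule.smul_mem _ _ hr, ?_⟩
  have : etaBar H x ((etaBar H x r)⁻¹ • r) = (etaBar H x r)⁻¹ * etaBar H x r := by
    simp only [etaBar, map_smul, smul_eq_mul]
  rw [this, inv_mul_cancel₀ h3]

/-- Screen vectors are orthogonal to Rad(TM) and to ltr(TM), hence to ξ̄, and η̄ = ḡ(·,ξ̄). -/
theorem etaBar_screen (hA : IsAscreen H) (x : M) {s : TangentSpace 𝓘(ℝ, G) x} (hs : s ∈ H.screen x) :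
    etaBar H x s = 0 := by
  have hle : (H.rad x).map (H.df x).toLinearMap ⊔ H.ltr x ≤
      LinearMap.ker (S.g (H.f x) (H.df x s)).toLinearMap := by
    refine sup_le ?_ (Submodule.span_le.2 ?_)
    · rintro _ ⟨r, hr, rfl⟩
      exact (S.g_symm _ _ _).trans (hr s)
    · rintro N ⟨ξ, hN⟩
      exact (S.g_symm _ _ _).trans (hN.orthogonal_screen s hs)
  have h := hle (hA x)
  rw [LinearMap.mem_ker] at h
  exact (S.g_xi _ _).symm.trans h

/-- The radical field normalised by `η̄(ζ) = 1`. -/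
def radField (hR : IsRSTHL H) (x : M) : TangentSpace 𝓘(ℝ, G) x :=
  Classical.choose (exists_rad_eta_eq_one hR x)

theorem radField_mem (hR : IsRSTHL H) (x : M) : radField hR x ∈ H.rad x :=
  (Classical.choose_spec (exists_rad_eta_eq_one hR x)).1

theorem etaBar_radField (hR : IsRSTHL H) (x : M) : etaBar H x (radField hR x) = 1 :=
  (Classical.choose_spec (exists_rad_eta_eq_one hR x)).2

theorem screenTrans_eq_span (hR : IsRSTHL H) (x : M) :
    H.screenTrans x = Submodule.span ℝ {phiRad H (radField hR) x} := by
  have h1 : H.rad x = Submodule.span ℝ {radField hR x} := le_antisymm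
    (fun v hv ↦ Submodule.mem_span_singleton.2
      ⟨_, (eq_etaBar_smul (radField_mem hR x) (etaBar_radField hR x) hv).symm⟩)
    ((Submodule.span_singleton_le_iff_mem _ _).2 (radField_mem hR x))
  rw [← hR x, h1, Submodule.map_span, Submodule.map_span, Set.image_singleton, Set.image_singleton]
  rfl

/-- The coefficient 1/2 is forced by nullity: g(ξ̄ - cζ, ξ̄ - cζ) = 1 - 2c. -/
theorem isNullPairAt_nullVec (hR : IsRSTHL H) (hA : IsAscreen H) (x : M) :
    H.IsNullPairAt x (radField hR x) (nullVec H (radField hR) x) := by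
  have hm := radField_mem hR x
  have hη : S.eta (H.f x) (H.df x (radField hR x)) = 1 := etaBar_radField hR x
  have h0 : ∀ v, S.g (H.f x) (H.df x (radField hR x)) (H.df x v) = 0 := hm
  have h1 : ∀ v, S.g (H.f x) (nullVec H (radField hR) x) (H.df x v) = etaBar H x v := fun v ↦ by
    rw [nullVec, map_sub, map_smul, sub_apply, smul_apply, h0, S.g_xi', etaBar]; simp
  refine ⟨hm, (h1 _).trans hη, ?_, ?_, fun s hs ↦ (h1 s).trans (etaBar_screen hA x hs)⟩
  · conv_lhs => arg 2; rw [nullVec]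
    rw [map_sub, map_smul, h1, S.g_xi, nullVec, map_sub, map_smul, S.eta_xi, hη, etaBar, hη]
    norm_num
  · intro l hl
    rw [screenTrans_eq_span hR] at hl
    obtain ⟨c, rfl⟩ := Submodule.mem_span_singleton.1 hl
    have h2 : S.g (H.f x) (H.df x (radField hR x)) (phiRad H (radField hR) x) = 0 := by
      have h3 : phiRad H (radField hR) x ∈ normalSpace (G := G) S.g H.f x := by
        rw [← H.normal_eq, screenTrans_eq_span hR]
        exact Submodule.mem_sup_right (Submodule.mem_span_singleton_self _)
      rw [S.g_symm]
      exact h3 _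
    rw [nullVec, map_smul, map_sub, map_smul, sub_apply, smul_apply, h2, S.g_xi', phiRad, S.eta_phi]
    simp

/-- The lightlike transversal vector of a radical vector is determined by it. -/
theorem smul_eq_nullVec (hR : IsRSTHL H) (hA : IsAscreen H) {ξ : TangentSpace 𝓘(ℝ, G) x}
    {N : TangentSpace 𝓘(ℝ, E) (H.f x)} (h : H.IsNullPairAt x ξ N) :
    etaBar H x ξ • N = nullVec H (radField hR) x := by
  have hn := isNullPairAt_nullVec hR hA x
  set z := radField hR x with hz
  set N₀ := nullVec H (radField hR) x with hN₀
  set Z := phiRad H (radField hR) x with hZ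
  have hξ : ξ = etaBar H x ξ • z := eq_etaBar_smul (radField_mem hR x) (etaBar_radField hR x) h.mem_rad
  have p1 : S.g (H.f x) (etaBar H x ξ • N - N₀) (H.df x z) = 0 := by
    rw [map_sub, sub_apply, hn.pairing, map_smul, smul_apply, ← map_smul, ← map_smul, ← hξ, h.pairing,
      sub_self]
  -- The difference is orthogonal to ζ and to the screen, so it lies in Rad(TM) ⊕ S(TM^⊥). Pairing
  -- with φ̄ζ then removes the second component, and nullity of N and N₀ removes the first.
  have p2 : etaBar H x ξ • N - N₀ ∈ normalSpace (G := G) S.g H.f x := fun v ↦ by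
    change S.g (H.f x) _ (H.df x v) = 0
    have hv : v = H.P x v + (v - H.P x v) := by abel
    have hr0 : v - H.P x v ∈ H.rad x := Submodule.sub_projection_mem (H.screen_isCompl x) v
    have hr := eq_etaBar_smul (radField_mem hR x) (etaBar_radField hR x) hr0
    have hs : H.P x v ∈ H.screen x := Submodule.projection_apply_mem (H.screen_isCompl x) v
    rw [hv, hr, map_add, map_smul, map_add, map_smul, p1, map_sub, sub_apply, map_smul, smul_apply,
      h.orthogonal_screen _ hs, hn.orthogonal_screen _ hs]
    simp
  have hZm : Z ∈ H.screenTrans x := by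
    rw [screenTrans_eq_span hR]; exact Submodule.mem_span_singleton_self _
  have hZn : Z ∈ normalSpace (G := G) S.g H.f x := by
    rw [← H.normal_eq]; exact Submodule.mem_sup_right hZm
  have hZz : S.g (H.f x) Z (H.df x z) = 0 := hZn z
  have hη : S.eta (H.f x) (H.df x z) = 1 := etaBar_radField hR x
  have hzz : S.g (H.f x) (H.df x z) (H.df x z) = 0 := radField_mem hR x z
  have hZZ : S.g (H.f x) Z Z = 1 := by
    rw [hZ, phiRad, S.g_phi, ← hz, hzz, hη]; norm_num
  rw [← H.normal_eq, Submodule.mem_sup] at p2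
  obtain ⟨_, ⟨r, hr, rfl⟩, y, hy, hw⟩ := p2
  have hr' := eq_etaBar_smul (radField_mem hR x) (etaBar_radField hR x) hr
  rw [screenTrans_eq_span hR] at hy
  obtain ⟨b, rfl⟩ := Submodule.mem_span_singleton.1 hy
  change H.df x r + b • Z = _ at hw
  rw [hr', map_smul, ← hz] at hw
  have hb : b = 0 := by
    have h1 := congrArg (fun w ↦ S.g (H.f x) w Z) hw
    simp only [map_add, map_sub, map_smul, add_apply, sub_apply, smul_apply, hZZ,
      h.orthogonal_screenTrans _ hZm, hn.orthogonal_screenTrans _ hZm, S.g_symm _ _ Z, hZz] at h1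
    simpa using h1
  rw [hb, zero_smul, add_zero] at hw
  have ha : etaBar H x r = 0 := by
    have h1 : etaBar H x ξ • N = N₀ + etaBar H x r • H.df x z := by rw [hw]; abel
    have h2 := congrArg (fun w ↦ S.g (H.f x) w w) h1
    simp only [map_add, map_smul, add_apply, smul_apply, h.null, hn.null, hzz, hn.pairing,
      S.g_symm _ (H.df x z) N₀, smul_eq_mul] at h2
    linarith
  rw [ha, zero_smul] at hw
  exact sub_eq_zero.1 hw.symm

theorem ltr_eq_span (hR : IsRSTHL H) (hA : IsAscreen H) (x : M) :
    H.ltr x = Submodule.span ℝ {nullVec H (radField hR) x} := by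
  refine le_antisymm (Submodule.span_le.2 ?_) (Submodule.span_mono ?_)
  · rintro N ⟨ξ, hN⟩
    have h1 := smul_eq_nullVec hR hA hN
    have h2 : etaBar H x ξ ≠ 0 := fun h ↦ by
      have h3 := isNullPairAt_nullVec hR hA x
      rw [h, zero_smul] at h1
      simpa [← h1] using h3.pairing
    refine Submodule.mem_span_singleton.2 ⟨(etaBar H x ξ)⁻¹, ?_⟩
    rw [← h1, smul_smul, inv_mul_cancel₀ h2, one_smul]
  · rintro _ rfl
    exact ⟨_, isNullPairAt_nullVec hR hA x⟩

section Local

variable {U : Set M} {ξ : Π x : M, TangentSpace 𝓘(ℝ, G) x}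
  {N : Π x : M, TangentSpace 𝓘(ℝ, E) (H.f x)} {γ : M → ℝ}

theorem mu_ne_zero (hR : IsRSTHL H) (hA : IsAscreen H) (h : H.IsNullPairAt x (ξ x) (N x)) :
    mu H ξ x ≠ 0 := fun h0 ↦ by
  have h1 := smul_eq_nullVec hR hA h
  have h2 : etaBar H x (ξ x) = 0 := h0
  rw [h2, zero_smul] at h1
  simpa [← h1] using (isNullPairAt_nullVec hR hA x).pairing

theorem eq_mu_smul_radField (hR : IsRSTHL H) (h : H.IsNullPairAt x (ξ x) (N x)) :
    ξ x = mu H ξ x • radField hR x :=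
  eq_etaBar_smul (radField_mem hR x) (etaBar_radField hR x) h.mem_rad

theorem contMDiffAt_mu (hU : IsOpen U) (hξ : H.IsNullPairOn U ξ N) (hx : x ∈ U) :
    ContMDiffAt 𝓘(ℝ, G) 𝓘(ℝ, ℝ) ∞ (mu H ξ) x :=
  UmbilicalFrame.contMDiffAt_etaBar (hξ.1.contMDiffAt (hU.mem_nhds hx)) (by simp)

theorem smooth_radField (hR : IsRSTHL H) (hA : IsAscreen H) (hU : IsOpen U)
    (hξ : H.IsNullPairOn U ξ N) (hx : x ∈ U) : CMDiffAt ∞ (T% (radField hR)) x := by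
  have h1 := ((contMDiffAt_mu hU hξ hx).inv₀ (mu_ne_zero hR hA (hξ.2 x hx))).smul_section
    (hξ.1.contMDiffAt (hU.mem_nhds hx))
  refine h1.congr_of_eventuallyEq ?_
  filter_upwards [hU.mem_nhds hx] with y hy
  have h2 := eq_mu_smul_radField hR (hξ.2 y hy)
  have h3 : radField hR y = (mu H ξ y)⁻¹ • ξ y := by
    conv_rhs => rw [h2]
    rw [smul_smul, inv_mul_cancel₀ (mu_ne_zero hR hA (hξ.2 y hy)), one_smul]
  simp [h3]

/-- The form C scales with the transversal field, and μN = N₀, so the umbilicity function of N₀ is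
μγ. -/
theorem umbilical_radField (hR : IsRSTHL H) (hA : IsAscreen H)
    (hξ : H.IsNullPairOn U ξ N) (hγ : H.IsScreenUmbilicalOn D U N γ) (hx : x ∈ U)
    (v : TangentSpace 𝓘(ℝ, G) x) {Y : Π x : M, TangentSpace 𝓘(ℝ, G) x} (hY : CMDiffAt ∞ (T% Y) x) :
    S.g (H.f x) (H.df x (H.nabla D (fun y ↦ H.P y (Y y)) x v)) (nullVec H (radField hR) x) =
      mu H ξ x * γ x * H.gM x v (Y x) := by
  have h1 := hγ.2 x hx v Y hY
  rw [← smul_eq_nullVec hR hA (hξ.2 x hx), map_smul, smul_eq_mul, mul_assoc, ← h1]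
  rfl

/-- The screen is nonzero and meets the radical trivially, so a nonzero screen vector has a nonzero
product with some tangent vector. This is what allows umbilicity functions to be compared. -/
theorem exists_gM_ne_zero (hdim : 2 ≤ Module.finrank ℝ G) (x : M) :
    ∃ s ∈ H.screen x, s ≠ 0 ∧ ∃ w, H.gM x s w ≠ 0 := by
  have h1 := Submodule.finrank_add_eq_of_isCompl (H.screen_isCompl x)
  rw [H.rank_radical x, show Module.finrank ℝ (TangentSpace 𝓘(ℝ, G) x) = Module.finrank ℝ G from rfl] at h1
  have h2 : H.screen x ≠ ⊥ := fun h ↦ by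
    rw [h, finrank_bot] at h1
    omega
  obtain ⟨s, hs, hs0⟩ := Submodule.exists_mem_ne_zero_of_ne_bot h2
  refine ⟨s, hs, hs0, ?_⟩
  by_contra! h
  exact hs0 (Submodule.disjoint_def.1 (H.screen_isCompl x).disjoint s hs h)

end Local

/-- The function `μ γ` of a screen totally umbilical submanifold. -/
def umbilicity (hU : H.IsScreenTotallyUmbilical D) (x : M) : ℝ :=
  mu H (Classical.choose (Classical.choose_spec (hU x))) x *
    Classical.choose (Classical.choose_spec (Classical.choose_spec (Classical.choose_spec (hU x)))) x

theorem exists_umbilicity_eq (hU : H.IsScreenTotallyUmbilical D) (x : M) :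
    ∃ (U : Set M) (ξ : Π x : M, TangentSpace 𝓘(ℝ, G) x)
      (N : Π x : M, TangentSpace 𝓘(ℝ, E) (H.f x)) (γ : M → ℝ),
      IsOpen U ∧ x ∈ U ∧ H.IsNullPairOn U ξ N ∧ H.IsScreenUmbilicalOn D U N γ ∧
        umbilicity hU x = mu H ξ x * γ x := by
  have h := Classical.choose_spec (Classical.choose_spec (Classical.choose_spec
    (Classical.choose_spec (hU x))))
  exact ⟨_, _, _, _, h.1, h.2.1, h.2.2.1, h.2.2.2, rfl⟩

/-- `umbilicity` is chosen separately at each point. All choices agree, because each μγ is the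
factor in the same relation for N₀ and the induced metric is not zero; this also makes the function
smooth. -/
theorem umbilicity_eq (hR : IsRSTHL H) (hA : IsAscreen H) (hdim : 2 ≤ Module.finrank ℝ G)
    (hU : H.IsScreenTotallyUmbilical D) {U : Set M} {ξ : Π x : M, TangentSpace 𝓘(ℝ, G) x}
    {N : Π x : M, TangentSpace 𝓘(ℝ, E) (H.f x)} {γ : M → ℝ}
    (hξ : H.IsNullPairOn U ξ N) (hγ : H.IsScreenUmbilicalOn D U N γ) (hx : x ∈ U) :
    umbilicity hU x = mu H ξ x * γ x := by
  obtain ⟨U', ξ', N', γ', -, hx', hξ', hγ', h⟩ := exists_umbilicity_eq hU x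
  obtain ⟨s, -, -, w, hw⟩ := exists_gM_ne_zero (H := H) hdim x
  have hY : CMDiffAt ∞ (T% (extend G w : Π y : M, TangentSpace 𝓘(ℝ, G) y)) x := smooth_extend w le_rfl
  have h1 := umbilical_radField hR hA hξ hγ hx s hY
  rw [umbilical_radField hR hA hξ' hγ' hx' s hY, extend_apply_self] at h1
  rw [h]
  exact mul_right_cancel₀ hw h1

theorem umbilicalFrame (hR : IsRSTHL H) (hA : IsAscreen H) (hdim : 2 ≤ Module.finrank ℝ G)
    (hU : H.IsScreenTotallyUmbilical D) : UmbilicalFrame H D (radField hR) (umbilicity hU) where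
  mem_rad := radField_mem hR
  eta_zeta := etaBar_radField hR
  smooth x := by
    obtain ⟨U, ξ, N, γ, ho, hx, hξ, -⟩ := hU x
    exact smooth_radField hR hA ho hξ hx
  eta_screen x _ hs := etaBar_screen hA x hs
  screenTrans_eq := screenTrans_eq_span hR
  ltr_eq := ltr_eq_span hR hA
  smooth_fun x := by
    obtain ⟨U, ξ, N, γ, ho, hx, hξ, hγ⟩ := hU x
    refine ((contMDiffAt_mu ho hξ hx).mul (hγ.1.contMDiffAt (ho.mem_nhds hx))).congr_of_eventuallyEq ?_
    filter_upwards [ho.mem_nhds hx] with y hy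
    exact umbilicity_eq hR hA hdim hU hξ hγ hy
  umbilical x v Y hY := by
    obtain ⟨U, ξ, N, γ, -, hx, hξ, hγ⟩ := hU x
    rw [umbilical_radField hR hA hξ hγ hx v hY, umbilicity_eq hR hA hdim hU hξ hγ hx]

end Ascreen

/-! ### Comparison of a local pair (ξ, N) with the normalised frame. -/

section Local

variable {E : Type*} [NormedAddCommGroup E] [NormedSpace ℝ E] [FiniteDimensional ℝ E]
  {A : Type*} [TopologicalSpace A] [T2Space A] [ChartedSpace E A] [IsManifold 𝓘(ℝ, E) ∞ A]
  {G : Type*} [NormedAddCommGroup G] [NormedSpace ℝ G] [FiniteDimensional ℝ G]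
  {M : Type*} [TopologicalSpace M] [ChartedSpace G M] [IsManifold 𝓘(ℝ, G) ∞ M]
  {S : AlmostContactBMetric E A}
  {D D' : CovariantDerivative 𝓘(ℝ, E) E (TangentSpace 𝓘(ℝ, E) : A → Type _)}
  {H : HalfLightlike G M S.g} {x : M} {F : M → ℝ}
  {U : Set M} {ξ : Π x : M, TangentSpace 𝓘(ℝ, G) x}
  {N : Π x : M, TangentSpace 𝓘(ℝ, E) (H.f x)} {γ : M → ℝ}

/-- Differentiate N₀ = μN and pair with ξ: the derivative of N₀ lies in the screen, so 0 = dμ(v) +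
μτ(v). -/
theorem mu_mul_tau (hR : IsRSTHL H) (hA : IsAscreen H) (K : UmbilicalFrame H D (radField hR) F)
    (hD : IsLeviCivita (fun p x y ↦ S.g p x y) D) (hF0 : S.IsF0 D)
    (hU : IsOpen U) (hξ : H.IsNullPairOn U ξ N) (hx : x ∈ U) (v : TangentSpace 𝓘(ℝ, G) x) :
    mu H ξ x * H.tau D ξ N x v = -mvfderiv 𝓘(ℝ, G) (mu H ξ) x v := by
  have hμ := contMDiffAt_mu hU hξ hx
  have ev : ∀ᶠ y in 𝓝 x, nullVec H (radField hR) y = mu H ξ y • N y := by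
    filter_upwards [hU.mem_nhds hx] with y hy
    exact (smul_eq_nullVec hR hA (hξ.2 y hy)).symm
  have sN : SmoothAlong G 1 H.f N x := by
    refine ((K.smoothAlong_nullVec x).smul (hμ.inv₀ (mu_ne_zero hR hA (hξ.2 x hx)))).of_le
      (by simp) |>.congr ?_
    filter_upwards [ev, hU.mem_nhds hx] with y hy hyU
    rw [hy, smul_smul, inv_mul_cancel₀ (mu_ne_zero hR hA (hξ.2 y hyU)), one_smul]
  have h1 := K.covAlong_nullVec hD hF0 x v
  rw [covAlong_congr ev, covAlong_smul (hμ.of_le (by simp)) sN] at h1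
  have h2 := congrArg (fun w ↦ S.g (H.f x) w (H.df x (ξ x))) h1
  have h3 : S.g (H.f x) (H.df x (H.P x v)) (H.df x (ξ x)) = 0 := by
    rw [eq_mu_smul_radField hR (hξ.2 x hx), map_smul, map_smul, K.g_zeta', smul_zero]
  simp only [map_add, map_smul, add_apply, smul_apply, h3, (hξ.2 x hx).pairing, smul_eq_mul] at h2
  rw [HalfLightlike.tau]
  linarith

theorem etaM_eq (hR : IsRSTHL H) (hA : IsAscreen H) (K : UmbilicalFrame H D (radField hR) F)
    (hξ : H.IsNullPairOn U ξ N) (hx : x ∈ U) (v : TangentSpace 𝓘(ℝ, G) x) :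
    mu H ξ x * H.etaM N x v = etaBar H x v := by
  rw [← K.g_nullVec, ← smul_eq_nullVec hR hA (hξ.2 x hx), map_smul, smul_eq_mul]
  rfl

end Local

end LightlikeGeometry

end

theorem theorem4p4
    {E : Type*} [NormedAddCommGroup E] [NormedSpace ℝ E] [FiniteDimensional ℝ E]
    {A : Type*} [TopologicalSpace A] [T2Space A] [ChartedSpace E A] [IsManifold 𝓘(ℝ, E) ∞ A]
    {G : Type*} [NormedAddCommGroup G] [NormedSpace ℝ G] [FiniteDimensional ℝ G]
    {M : Type*} [TopologicalSpace M] [T2Space M] [ChartedSpace G M] [IsManifold 𝓘(ℝ, G) ∞ M]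
    (n : ℕ) (hn : 2 ≤ n) (hdim : Module.finrank ℝ E = 2 * n + 1)
    -- the ambient `F₀`-manifold of pointwise constant totally real sectional curvatures
    (S : AlmostContactBMetric E A)
    (D D' : CovariantDerivative 𝓘(ℝ, E) E (TangentSpace 𝓘(ℝ, E) : A → Type _))
    (hD : IsLeviCivita (fun p x y ↦ S.g p x y) D) (hD' : IsLeviCivita S.assoc D')
    (hF0 : S.IsF0 D)
    (ν ν' : A → ℝ) (hν : S.HasTotallyRealSectionalCurvatures D D' ν ν')
    -- the screen totally umbilical ascreen radical screen transversal submanifold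
    (H : HalfLightlike G M S.g) (hR : IsRSTHL H) (hA : IsAscreen H)
    (hU : H.IsScreenTotallyUmbilical D) :
    (∀ x : M, ν' (H.f x) = 0) ∧
    (∀ (U : Set M) (ξ : Π x : M, TangentSpace 𝓘(ℝ, G) x)
      (N : Π x : M, TangentSpace 𝓘(ℝ, E) (H.f x)) (γ : M → ℝ),
      IsOpen U → H.IsNullPairOn U ξ N → H.IsScreenUmbilicalOn D U N γ →
      ∀ x ∈ U,
        ν (H.f x) + 2 * H.tau D ξ N x (ξ x) * γ x - 2 * mvfderiv 𝓘(ℝ, G) γ x (ξ x)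
          - 4 * mu H ξ x ^ 2 * γ x ^ 2 = 0 ∧
        (∀ v : TangentSpace 𝓘(ℝ, G) x,
          mvfderiv 𝓘(ℝ, G) (fun y ↦ mu H ξ y * γ y) x (H.P x v) = 0) ∧
        (∀ X Y Z : Π x : M, TangentSpace 𝓘(ℝ, G) x,
          CMDiffAt ∞ (T% X) x → CMDiffAt ∞ (T% Y) x → CMDiffAt ∞ (T% Z) x →
          H.df x (curvature (H.nabla D) X Y Z x) =
            ((ν (H.f x) - 2 * mu H ξ x ^ 2 * γ x ^ 2) * H.gM x (Y x) (Z x)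
                - ν (H.f x) * etaBar H x (Y x) * etaBar H x (Z x)) • H.df x (H.P x (X x))
            - ((ν (H.f x) - 2 * mu H ξ x ^ 2 * γ x ^ 2) * H.gM x (X x) (Z x)
                - ν (H.f x) * etaBar H x (X x) * etaBar H x (Z x)) • H.df x (H.P x (Y x))
            + ((4 * mu H ξ x ^ 2 * γ x ^ 2 - ν (H.f x)) * gPhi H x (Y x) (Z x)) •
                S.phi (H.f x) (H.df x (H.P x (X x)))
            - ((4 * mu H ξ x ^ 2 * γ x ^ 2 - ν (H.f x)) * gPhi H x (X x) (Z x)) •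
                S.phi (H.f x) (H.df x (H.P x (Y x)))
            + (ν (H.f x) / 2 * (H.gM x (Y x) (Z x) * H.etaM N x (X x)
                - H.gM x (X x) (Z x) * H.etaM N x (Y x))) • H.df x (ξ x)) ∧
        (∀ v w : TangentSpace 𝓘(ℝ, G) x,
          ricciAt (H.nabla D) x v w =
            ((4 * (n : ℝ) - 7) / 2 * ν (H.f x)
                - 2 * (2 * (n : ℝ) - 5) * mu H ξ x ^ 2 * γ x ^ 2) * H.gM x v w
            - 2 * ((n : ℝ) - 1) * ν (H.f x) * etaBar H x v * etaBar H x w)) ∧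
    -- the local functions `μ γ` are the restrictions of one function `F` on `M`
    (∃ F : M → ℝ,
      (∀ (U : Set M) (ξ : Π x : M, TangentSpace 𝓘(ℝ, G) x)
        (N : Π x : M, TangentSpace 𝓘(ℝ, E) (H.f x)) (γ : M → ℝ),
        IsOpen U → H.IsNullPairOn U ξ N → H.IsScreenUmbilicalOn D U N γ →
        ∀ x ∈ U, F x = mu H ξ x * γ x) ∧
      ∀ V : Set M, IsOpen V → IsPreconnected V →
        ((∃ c : ℝ, ∀ x ∈ V, F x = c) ↔ ∀ x ∈ V, ν (H.f x) = 4 * F x ^ 2)) := by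
  have hG : Module.finrank ℝ G + 2 = 2 * n + 1 := H.codim.trans hdim
  have hG2 : 2 ≤ Module.finrank ℝ G := by omega
  -- With m = dim M = 2n - 1, the Ricci coefficients m - 5/2, m - 4 and m - 1 become (4n - 7)/2, 2n
  -- - 5 and 2(n - 1).
  have hGr : (Module.finrank ℝ G : ℝ) = 2 * n - 1 := by
    have : (Module.finrank ℝ G : ℝ) + 2 = 2 * n + 1 := by exact_mod_cast hG
    linarith
  have K := umbilicalFrame hR hA hG2 hU
  have main : ∀ x, ν' (H.f x) = 0 ∧ ν (H.f x) =
      2 * mvfderiv 𝓘(ℝ, G) (umbilicity hU) x (radField hR x) + 4 * umbilicity hU x ^ 2 := fun x ↦ by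
    obtain ⟨s, hs, hs0, -⟩ := exists_gM_ne_zero (H := H) hG2 x
    have h := K.main_equation hD hD' hF0 hν (K.eta_screen x s hs) hs0
    exact ⟨h.1, h.2.1⟩
  have screen0 : ∀ x (v : TangentSpace 𝓘(ℝ, G) x),
      mvfderiv 𝓘(ℝ, G) (umbilicity hU) x (H.P x v) = 0 := fun x v ↦ by
    by_cases h0 : H.P x v = 0
    · rw [h0, map_zero]
    · exact (K.main_equation hD hD' hF0 hν (K.etaBar_P x v) h0).2.2
  refine ⟨fun x ↦ (main x).1, fun U ξ N γ ho hξ hγ x hx ↦ ?_, umbilicity hU,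
    fun U ξ N γ _ hξ hγ x hx ↦ umbilicity_eq hR hA hG2 hU hξ hγ hx, fun V hV hc ↦ ⟨?_, ?_⟩⟩
  · have hFx := umbilicity_eq hR hA hG2 hU hξ hγ hx
    have hμ0 := mu_ne_zero hR hA (hξ.2 x hx)
    have hξx := eq_mu_smul_radField hR (hξ.2 x hx)
    have ev : ∀ᶠ y in nhds x, umbilicity hU y = mu H ξ y * γ y := by
      filter_upwards [ho.mem_nhds hx] with y hy
      exact umbilicity_eq hR hA hG2 hU hξ hγ hy
    have dF := mvfderiv_congr (G := G) ev
    have hη := etaM_eq hR hA K hξ hx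
    have hF2 : mu H ξ x ^ 2 * γ x ^ 2 = umbilicity hU x ^ 2 := by rw [hFx]; ring
    refine ⟨?_, fun v ↦ ?_, fun X Y Z hX hY hZ ↦ ?_, fun v w ↦ ?_⟩
    · have h1 : mvfderiv 𝓘(ℝ, G) (umbilicity hU) x (ξ x) =
          mu H ξ x * mvfderiv 𝓘(ℝ, G) γ x (ξ x) + γ x * mvfderiv 𝓘(ℝ, G) (mu H ξ) x (ξ x) := by
        rw [dF, mvfderiv_fun_mul ((contMDiffAt_mu ho hξ hx).mdifferentiableAt (by simp))
          ((hγ.1.contMDiffAt (ho.mem_nhds hx)).mdifferentiableAt (by simp))]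
        simp
      have h2 := mu_mul_tau hR hA K hD hF0 ho hξ hx (ξ x)
      have h3 : mvfderiv 𝓘(ℝ, G) (umbilicity hU) x (ξ x) =
          mu H ξ x * mvfderiv 𝓘(ℝ, G) (umbilicity hU) x (radField hR x) := by
        conv_lhs => rw [hξx]
        rw [map_smul, smul_eq_mul]
      -- Divide dF(ξ) = μ dF(ζ) by μ, expanding F = μγ with dμ(ξ) = -μτ(ξ). This is where τ enters
      -- the equation for γ.
      have h4 : mvfderiv 𝓘(ℝ, G) (umbilicity hU) x (radField hR x) =
          mvfderiv 𝓘(ℝ, G) γ x (ξ x) - H.tau D ξ N x (ξ x) * γ x := by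
        refine mul_left_cancel₀ hμ0 ?_
        rw [← h3, h1]
        linear_combination γ x * h2
      rw [(main x).2, h4, hFx]
      ring
    · rw [← dF]
      exact screen0 x v
    · rw [K.df_curvature_eq hD hD' hF0 hν (main x).1 hX hY hZ, ← hη (X x), ← hη (Y x)]
      have : H.df x (ξ x) = mu H ξ x • H.df x (radField hR x) := by
        conv_lhs => rw [hξx]
        rw [map_smul]
      rw [this, hFx]
      module
    · rw [K.ricciAt_eq hD hD' hF0 hν (main x).1, hGr, ← hF2]
      ring
  · rintro ⟨c, hcst⟩ x hx
    have h1 : mvfderiv 𝓘(ℝ, G) (umbilicity hU) x = 0 := by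
      have ev : ∀ᶠ y in nhds x, umbilicity hU y = c := by
        filter_upwards [hV.mem_nhds hx] with y hy using hcst y hy
      rw [mvfderiv_congr (G := G) ev, mvfderiv_const]
    rw [(main x).2, h1]
    simp
  · intro h
    rcases V.eq_empty_or_nonempty with rfl | ⟨x₀, hx₀⟩
    · exact ⟨0, fun x hx ↦ hx.elim⟩
    · refine ⟨umbilicity hU x₀, fun y hy ↦ eq_of_mvfderiv_eq_zero (G := G) hV hc
        (fun x _ ↦ (K.smooth_fun x).mdifferentiableAt (by simp)) (fun x hx ↦ ?_) hx₀ hy⟩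
      -- The tangent space is spanned by the screen and ζ: dF vanishes on the first always, and on ζ
      -- because ν = 4F².
      ext v
      have h1 := screen0 x v
      have h2 : mvfderiv 𝓘(ℝ, G) (umbilicity hU) x (radField hR x) = 0 := by
        linarith [(main x).2, h x hx]
      rw [K.P_eq, map_sub, map_smul, h2, smul_zero, sub_zero] at h1
      exact h1
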